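/- **Setting.** Fix $\Lambda>0$, a function $\chi\in C^\infty((0,\infty);[0,1])$ with $\chi(r)=1$ for $r<1/2$ and $\chi(r)=0$ for $r>1$, and measurable polarization vectors $\mathbf e_1(k),\mathbf e_2(k)$ such that $(k/|k|,\mathbf e_1(k),\mathbf e_2(k))$ is an orthonormal basis of $\mathbb R^3$ for a.e. $k\in\mathbb R^3$. Fix also $\theta\in C^\infty(\mathbb R;[0,1])$ with $\theta(r)=1$ for $r\le 1/4$ and $\theta(r)=0$ for $r\ge 1/3$. For $\alpha>0$ and $L>1$ put $y=L\alpha^{-1}$, $\chi_y(x)=\theta(|x|/y)$, $\mathbb R^3_y=\{x\in\mathbb R^3: x_1<y\}$, $\mathfrak h_+=L^2(\mathbb R^+\times\mathbb R^2;\mathbb C^2)$, and work on $\mathscr H_y=L^2(\mathbb R^3_y)\otimes(\mathbb C\oplus\mathfrak h_+)$ with vacuum $\Omega$. Let $$h_\alpha=-\Delta-\frac{\alpha}{|x|}\ \text{ (Dirichlet Laplacian on }\mathbb R^3_y),\qquad u_\alpha(x)=\frac{\alpha^{3/2}}{\sqrt{8\pi}}e^{-\alpha|x|/2},\qquad e_\alpha=-\frac{\alpha^2}{4},\qquad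 P=i\nabla_x,$$ $$V_y(x)=\frac12\Big(-\frac1{2y}+\frac1{|\tilde x_y|}+\frac1{|x-(2y,0,0)|}-\frac1{|\tilde x_y-x|}\Big),\qquad \tilde x_y=(2y-x_1,x_2,x_3),$$ $$\lambda_\infty(k)=\Big\{\frac{\chi(|k|/\Lambda)}{\sqrt2\,\pi|k|^{1/2}}\,\mathbf e_\gamma(k)\Big\}_{\gamma=1,2},\qquad \lambda_y(k)=\Big\{\frac{2\chi(|k|/\Lambda)}{\sqrt2\,\pi|k|^{1/2}}\big(\mathbf e^{(1)}_\gamma\cos(k_1y),-\mathbf e^{(2)}_\gamma\sin(k_1y),-\mathbf e^{(3)}_\gamma\sin(k_1y)\big)\Big\}_{\gamma=1,2}.$$ Let $A^+_y=a^\dagger(\lambda_y)$, $A^-_y=a(\lambda_y)$ (vectors with three components), let $H_f^+$ be multiplication by $|k|$ on $\mathfrak h_+$ and $0$ on $\Omega$, and let $$H_y=h_\alpha+H_f^++\alpha V_y-2\alpha^{1/2}P\cdot(A_y^++A_y^-)+\alpha\|\lambda_y\|^2+2\alpha A_y^+\cdot A_y^-$$ act on the sectors with at most one photon, with domain $\mathscr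 D(H_y)=\mathscr D(-\Delta\otimes 1)\cap\mathscr D(1\otimes H_f^+)$. Let $$\Phi^y_\#=2\alpha^{1/2}(h_\alpha-e_\alpha+H_f^+)^{-1}Pu_\alpha\otimes A_y^+\Omega,\qquad \|\Phi^y_\#\|_\#^2=\langle\Phi^y_\#|(h_\alpha-e_\alpha+H_f^+)\Phi^y_\#\rangle .$$ On the Fock space over $L^2(\mathbb R^3;\mathbb C^2)$ let $A^+_\infty=a^\dagger(\lambda_\infty)$, $A_\infty^-=a(\lambda_\infty)$, $H_f=d\Gamma(|k|)$, $P_f=d\Gamma(k)$, and $$\Phi^1_*=H_f^{-1}P_f\cdot A_\infty^-H_f^{-1}A_\infty^+\cdot A_\infty^+\Omega,\qquad \|\Phi_*^1\|_*^2=\langle\Phi_*^1|H_f\Phi_*^1\rangle,\qquad \tilde\Phi^1_*=\sqrt2\,\Phi^1_*|_{k_1>0}.$$ **Theorem 2.4.** There exist $\alpha_0\in(0,1)$ and $C\in\mathbb R$, depending only on the fixed data $\Lambda,\chi,\mathbf e_\gamma,\theta$, such that for all $0<\alpha\le\alpha_0$ and all $L>1$ the vector $\Phi_\#^y$ exists,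 the trial vector $$\varphi_y=\chi_yu_\alpha\otimes\big(\Omega+2\alpha^{3/2}\tilde\Phi_*^1\big)+\Phi_\#^y$$ is a nonzero element of $\mathscr D(H_y)$, and $$\frac{\langle\varphi_y|H_y\varphi_y\rangle}{\langle\varphi_y|\varphi_y\rangle}\le e_\alpha-\frac{\alpha^2}{L^3}+\alpha\|\lambda_y\|^2-\|\Phi_\#^y\|_\#^2+4\alpha^3\|\Phi_*^1\|_*^2+C\Big(\frac{\alpha^2}{L^5}+\alpha^4\log(\alpha^{-1})+\alpha^2Le^{-L/2}\Big).$$ -/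

import Mathlib

open MeasureTheory Filter Topology Set
open scoped ContDiff ComplexConjugate

noncomputable section

namespace CasimirPolder

/-- Position and momentum space `ℝ³`; the paper's coordinates `1,2,3` are `0,1,2` here. -/
abbrev E3 : Type := EuclideanSpace ℝ (Fin 3)

/-- A photon mode: a wave vector and a polarization index. -/
abbrev Mode : Type := E3 × Fin 2

/-- The `j`-th unit vector. -/
def unitVec (j : Fin 3) : E3 := EuclideanSpace.single j 1

/-- The region `ℝ³_y = {x | x₁ < y}` accessible to the electron. -/
def atomRegion (y : ℝ) : Set E3 := {x | x 0 < y}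

/-- Lebesgue measure on `ℝ³_y`. -/
def atomMeasure (y : ℝ) : Measure E3 := volume.restrict (atomRegion y)

/-- The measure of the full one-photon space `L²(ℝ³; ℂ²)`. -/
def modeMeasure : Measure Mode := (volume : Measure E3).prod Measure.count

/-- The measure of the one-photon space `L²(ℝ⁺ × ℝ²; ℂ²)` in the presence of the wall. -/
def wallModeMeasure : Measure Mode :=
  ((volume : Measure E3).restrict {k | 0 < k 0}).prod Measure.count

/-- The measure of `L²(ℝ³_y) ⊗ L²(ℝ⁺ × ℝ²; ℂ²)`, viewed as `L²(ℝ³_y × ℝ⁺ × ℝ² × {1,2})`. -/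
def jointMeasure (y : ℝ) : Measure (E3 × Mode) := (atomMeasure y).prod wallModeMeasure

/-- The `L²` scalar product, antilinear in the first argument. -/
def braket {X : Type*} [MeasurableSpace X] (μ : Measure X) (f g : X → ℂ) : ℂ :=
  ∫ x, conj (f x) * g x ∂μ

/-! ### The fixed data of the radiation field -/

/-- The fixed data of the quantized field: the ultraviolet cut-off `Λ`, the smooth profile `χ` of
the cut-off function `χ(|k|/Λ)`, and a measurable choice of polarization vectors which together
with `k/|k|` form an orthonormal basis of `ℝ³` for almost every `k`. -/
structure Radiation where
  Λ : ℝ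
  Λ_pos : 0 < Λ
  χ : ℝ → ℝ
  χ_smooth : ContDiffOn ℝ ∞ χ (Ioi 0)
  χ_mem : ∀ r, 0 < r → χ r ∈ Icc (0 : ℝ) 1
  χ_one : ∀ r, 0 < r → r < 1 / 2 → χ r = 1
  χ_zero : ∀ r, 1 < r → χ r = 0
  pol : Fin 2 → E3 → E3
  pol_meas : ∀ γ, AEMeasurable (pol γ) volume
  pol_orthonormal : ∀ᵐ k : E3, Orthonormal ℝ ![‖k‖⁻¹ • k, pol 0 k, pol 1 k]

/-- The common scalar factor `χ(|k|/Λ) / (√2 π |k|^{1/2})` of the form factors. -/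
def Radiation.weight (R : Radiation) (k : E3) : ℝ :=
  R.χ (‖k‖ / R.Λ) / (Real.sqrt 2 * Real.pi * Real.sqrt ‖k‖)

/-- The `j`-th component of the dipole form factor `λ_∞` without the wall. -/
def Radiation.freeFormFactor (R : Radiation) (j : Fin 3) (m : Mode) : ℝ :=
  R.weight m.1 * R.pol m.2 m.1 j

/-- The `j`-th component of the dipole form factor `λ_y` with the wall at distance `y`. -/
def Radiation.formFactor (R : Radiation) (y : ℝ) (j : Fin 3) (m : Mode) : ℝ :=
  2 * R.weight m.1 *
    (if j = 0 then R.pol m.2 m.1 j * Real.cos (m.1 0 * y)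
      else -(R.pol m.2 m.1 j * Real.sin (m.1 0 * y)))

/-- `‖λ_y‖²`. -/
def Radiation.formFactorNormSq (R : Radiation) (y : ℝ) : ℝ :=
  ∑ j, ∫ m, R.formFactor y j m ^ 2 ∂wallModeMeasure

/-! ### The vector `Φ_*¹` -/

/-- Creation operator `a†(f)` from the `n`-photon to the `(n+1)`-photon sector. -/
def create (f : Mode → ℂ) {n : ℕ} (Ψ : (Fin n → Mode) → ℂ) : (Fin (n + 1) → Mode) → ℂ :=
  fun m => ((Real.sqrt (n + 1))⁻¹ : ℝ) * ∑ i, f (m i) * Ψ (fun l => m (i.succAbove l))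

/-- Annihilation operator `a(f)` from the `(n+1)`-photon to the `n`-photon sector (no wall). -/
def annihilate (f : Mode → ℂ) {n : ℕ} (Ψ : (Fin (n + 1) → Mode) → ℂ) : (Fin n → Mode) → ℂ :=
  fun m => (Real.sqrt (n + 1) : ℝ) * ∫ p, conj (f p) * Ψ (Fin.cons p m) ∂modeMeasure

/-- `H_f⁻¹` on the `n`-photon sector, `H_f = dΓ(|k|)`. -/
def fieldEnergyInv {n : ℕ} (Ψ : (Fin n → Mode) → ℂ) : (Fin n → Mode) → ℂ :=
  fun m => ((∑ i, ‖(m i).1‖)⁻¹ : ℝ) * Ψ m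

/-- The `j`-th component of the field momentum `P_f = dΓ(k)` on the `n`-photon sector. -/
def fieldMomentum (j : Fin 3) {n : ℕ} (Ψ : (Fin n → Mode) → ℂ) : (Fin n → Mode) → ℂ :=
  fun m => ((∑ i, (m i).1 j : ℝ) : ℂ) * Ψ m

/-- The Fock vacuum. -/
def vacuum : (Fin 0 → Mode) → ℂ := fun _ => 1

/-- The two-photon vector `H_f⁻¹ A_∞⁺ · A_∞⁺ Ω`. -/
def Radiation.twoPhoton (R : Radiation) : (Fin 2 → Mode) → ℂ :=
  fieldEnergyInv (fun m => ∑ j, create (fun p => (R.freeFormFactor j p : ℂ))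
    (create (fun p => (R.freeFormFactor j p : ℂ)) vacuum) m)

/-- The one-photon vector `Φ_*¹ = H_f⁻¹ P_f · A_∞⁻ H_f⁻¹ A_∞⁺ · A_∞⁺ Ω`. -/
def Radiation.phiStar (R : Radiation) (p : Mode) : ℂ :=
  fieldEnergyInv (fun m => ∑ j, fieldMomentum j
    (annihilate (fun q => (R.freeFormFactor j q : ℂ)) R.twoPhoton) m) (fun _ : Fin 1 => p)

/-- `‖Φ_*¹‖²_* = ⟨Φ_*¹ | H_f | Φ_*¹⟩`. -/
def Radiation.phiStarNormSq (R : Radiation) : ℝ :=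
  ∫ p, ‖p.1‖ * ‖R.phiStar p‖ ^ 2 ∂modeMeasure

/-- `√2 Φ_*¹`, to be used on the positive frequencies `k₁ > 0` only. -/
def Radiation.phiStarWall (R : Radiation) (p : Mode) : ℂ := (Real.sqrt 2 : ℝ) * R.phiStar p

/-! ### The atom -/

/-- The hydrogen ground state `u_α`. -/
def groundState (α : ℝ) (x : E3) : ℝ :=
  α ^ (3 / 2 : ℝ) / Real.sqrt (8 * Real.pi) * Real.exp (-(α * ‖x‖ / 2))

/-- The hydrogen ground state energy `e_α`. -/
def groundEnergy (α : ℝ) : ℝ := -(α ^ 2 / 4)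

/-- The `j`-th component of `P u_α`, where `P = i ∇`. -/
def momentumGroundState (α : ℝ) (j : Fin 3) (x : E3) : ℂ :=
  Complex.I * (fderiv ℝ (groundState α) x (unitVec j) : ℝ)

/-- The mirror image `(2y - x₁, x₂, x₃)` of `x`. -/
def mirror (y : ℝ) (x : E3) : E3 := !₂[2 * y - x 0, x 1, x 2]

/-- The electrostatic interaction `V_y` with the wall. -/
def wallPotential (y : ℝ) (x : E3) : ℝ :=
  1 / 2 * (-(1 / (2 * |y|)) + 1 / ‖mirror y x‖ + 1 / ‖x - !₂[2 * y, 0, 0]‖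
    - 1 / ‖mirror y x - x‖)

/-! ### The Dirichlet Laplacian on `ℝ³_y` -/

/-- Test functions: complex valued, smooth, with compact support in `ℝ³_y`. -/
def IsTest (y : ℝ) (η : E3 → ℂ) : Prop :=
  ContDiff ℝ ∞ η ∧ HasCompactSupport η ∧ tsupport η ⊆ atomRegion y

/-- `u` belongs to `H¹₀(ℝ³_y)`, the closure of the test functions in the `H¹` norm, and `G` is
its gradient. -/
def IsH10 (y : ℝ) (u : E3 → ℂ) (G : Fin 3 → E3 → ℂ) : Prop :=
  MemLp u 2 (atomMeasure y) ∧ (∀ j, MemLp (G j) 2 (atomMeasure y)) ∧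
  ∃ η : ℕ → E3 → ℂ, (∀ n, IsTest y (η n)) ∧
    Tendsto (fun n => eLpNorm (fun x => u x - η n x) 2 (atomMeasure y)) atTop (𝓝 0) ∧
    ∀ j, Tendsto (fun n => eLpNorm (fun x => G j x - fderiv ℝ (η n) x (unitVec j)) 2
      (atomMeasure y)) atTop (𝓝 0)

/-- `u` is in the domain of the Dirichlet Laplacian of `ℝ³_y`, with gradient `G` and
`w = -Δ u ∈ L²`. -/
def IsDirichletLaplacian (y : ℝ) (u : E3 → ℂ) (G : Fin 3 → E3 → ℂ) (w : E3 → ℂ) : Prop :=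
  IsH10 y u G ∧ MemLp w 2 (atomMeasure y) ∧
  ∀ η, IsTest y η →
    ∑ j, ∫ x, G j x * fderiv ℝ η x (unitVec j) ∂(atomMeasure y)
      = ∫ x, w x * η x ∂(atomMeasure y)

/-- `g` is in the domain of `(-Δ^D) ⊗ 1` on `L²(ℝ³_y) ⊗ L²(ℝ⁺ × ℝ²; ℂ²)`, with gradient `G` in
the position variable and `w = (-Δ^D ⊗ 1) g`: the operator acts fibre by fibre over the modes. -/
def IsDirichletLaplacianTensor (y : ℝ) (g : E3 × Mode → ℂ) (G : Fin 3 → E3 × Mode → ℂ)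
    (w : E3 × Mode → ℂ) : Prop :=
  MemLp g 2 (jointMeasure y) ∧ (∀ j, MemLp (G j) 2 (jointMeasure y)) ∧
  MemLp w 2 (jointMeasure y) ∧
  ∀ᵐ m ∂wallModeMeasure, IsDirichletLaplacian y (fun x => g (x, m)) (fun j x => G j (x, m))
    (fun x => w (x, m))

/-! ### The operator `h_α - e_α + H_f⁺` and the vector `Φ_#^y` -/

/-- `Φ ∈ D(h_α - e_α + H_f⁺) ⊆ L²(ℝ³_y) ⊗ L²(ℝ⁺ × ℝ²; ℂ²)` and
`(h_α - e_α + H_f⁺) Φ = η`, where `h_α = -Δ^D - α/|x|`. -/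
def HasSharpValue (α y : ℝ) (Φ η : E3 × Mode → ℂ) : Prop :=
  ∃ (G : Fin 3 → E3 × Mode → ℂ) (w : E3 × Mode → ℂ),
    IsDirichletLaplacianTensor y Φ G w ∧
    MemLp (fun p => (‖p.2.1‖ : ℂ) * Φ p) 2 (jointMeasure y) ∧
    MemLp η 2 (jointMeasure y) ∧
    η =ᵐ[jointMeasure y] fun p =>
      w p + ((-(α / ‖p.1‖) - groundEnergy α + ‖p.2.1‖ : ℝ) : ℂ) * Φ p

/-- The vector `2 α^{1/2} P u_α ⊗ A_y⁺ Ω = 2 α^{1/2} ∑ⱼ (Pⱼ u_α) ⊗ λ_y^{(j)}`. -/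
def Radiation.sharpSource (R : Radiation) (α y : ℝ) (p : E3 × Mode) : ℂ :=
  2 * (Real.sqrt α : ℝ) * ∑ j, momentumGroundState α j p.1 * (R.formFactor y j p.2 : ℂ)

/-- `Φ = Φ_#^y = 2 α^{1/2} (h_α - e_α + H_f⁺)⁻¹ P u_α ⊗ A_y⁺ Ω`. The operator is injective, so
this determines `Φ` almost everywhere. -/
def Radiation.IsPhiSharp (R : Radiation) (α y : ℝ) (Φ : E3 × Mode → ℂ) : Prop :=
  HasSharpValue α y Φ (R.sharpSource α y)

/-- `‖Φ‖²_# = ⟨Φ | (h_α - e_α + H_f⁺) Φ⟩` for the vector `Φ = Φ_#^y`, whose image under the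
operator is `sharpSource`. -/
def Radiation.phiSharpNormSq (R : Radiation) (α y : ℝ) (Φ : E3 × Mode → ℂ) : ℝ :=
  (braket (jointMeasure y) Φ (R.sharpSource α y)).re

/-! ### The Hamiltonian `H_y` -/

/-- Elements of `L²(ℝ³_y) ⊗ (ℂ ⊕ L²(ℝ⁺ × ℝ²; ℂ²))`, given by functions: the vacuum component and
the one-photon component. Square integrability is part of the predicates below. -/
abbrev State : Type := (E3 → ℂ) × (E3 × Mode → ℂ)

/-- The scalar product of the Hilbert space of the system. -/
def stateInner (y : ℝ) (ψ φ : State) : ℂ :=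
  braket (atomMeasure y) ψ.1 φ.1 + braket (jointMeasure y) ψ.2 φ.2

/-- The squared norm of the Hilbert space of the system. -/
def stateNormSq (y : ℝ) (ψ : State) : ℝ :=
  ∫ x, ‖ψ.1 x‖ ^ 2 ∂(atomMeasure y) + ∫ p, ‖ψ.2 p‖ ^ 2 ∂(jointMeasure y)

/-- The `j`-th component of `A_y⁻` from the one-photon sector to the vacuum sector. -/
def Radiation.lower (R : Radiation) (y : ℝ) (j : Fin 3) (g : E3 × Mode → ℂ) (x : E3) : ℂ :=
  ∫ m, conj (R.formFactor y j m : ℂ) * g (x, m) ∂wallModeMeasure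

/-- The `j`-th component of `A_y⁺` from the vacuum sector to the one-photon sector. -/
def Radiation.raise (R : Radiation) (y : ℝ) (j : Fin 3) (f : E3 → ℂ) (p : E3 × Mode) : ℂ :=
  (R.formFactor y j p.2 : ℂ) * f p.1

/-- The multiplication operator `-α/|x| + α V_y + α ‖λ_y‖²`. -/
def Radiation.potential (R : Radiation) (α y : ℝ) (x : E3) : ℝ :=
  -(α / ‖x‖) + α * wallPotential y x + α * R.formFactorNormSq y

/-- `ψ ∈ D(H_y) = D(-Δ^D ⊗ 1) ∩ D(1 ⊗ H_f⁺)` and `H_y ψ = η`, where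
`H_y = h_α + H_f⁺ + α V_y - 2 α^{1/2} Re P·A_y + α ‖λ_y‖² + 2 α A_y⁺·A_y⁻` on the sectors with at
most one photon. Here `P = i ∇` commutes with `A_y`, because of the dipole approximation. -/
def Radiation.HasHamiltonianValue (R : Radiation) (α y : ℝ) (ψ η : State) : Prop :=
  ∃ (G₀ : Fin 3 → E3 → ℂ) (w₀ : E3 → ℂ) (G₁ : Fin 3 → E3 × Mode → ℂ) (w₁ : E3 × Mode → ℂ),
    IsDirichletLaplacian y ψ.1 G₀ w₀ ∧
    IsDirichletLaplacianTensor y ψ.2 G₁ w₁ ∧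
    MemLp (fun p => (‖p.2.1‖ : ℂ) * ψ.2 p) 2 (jointMeasure y) ∧
    MemLp η.1 2 (atomMeasure y) ∧ MemLp η.2 2 (jointMeasure y) ∧
    (η.1 =ᵐ[atomMeasure y] fun x =>
      w₀ x + (R.potential α y x : ℂ) * ψ.1 x
        - 2 * (Real.sqrt α : ℝ) * ∑ j, R.lower y j (fun p => Complex.I * G₁ j p) x) ∧
    (η.2 =ᵐ[jointMeasure y] fun p =>
      w₁ p + ((‖p.2.1‖ + R.potential α y p.1 : ℝ) : ℂ) * ψ.2 p
        - 2 * (Real.sqrt α : ℝ) * ∑ j, R.raise y j (fun x => Complex.I * G₀ j x) p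
        + 2 * (α : ℂ) * ∑ j, R.raise y j (R.lower y j ψ.2) p)

/-! ### The trial vector -/

/-- Profile of the smooth radial cut-off `χ_y(x) = θ(|x|/y)`, which localizes the electron away
from the wall: `χ_y = 1` for `|x| ≤ y/4` and `χ_y = 0` for `|x| ≥ y/3`. -/
structure IsLocalizer (θ : ℝ → ℝ) : Prop where
  smooth : ContDiff ℝ ∞ θ
  mem : ∀ r, θ r ∈ Icc (0 : ℝ) 1
  one : ∀ r, r ≤ 1 / 4 → θ r = 1
  zero : ∀ r, 1 / 3 ≤ r → θ r = 0

/-- The trial vector `(χ_y u_α) ⊗ (Ω + 2 α^{3/2} √2 Φ_*¹|_{k₁ > 0}) + Φ`. -/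
def Radiation.trial (R : Radiation) (θ : ℝ → ℝ) (α y : ℝ) (Φ : E3 × Mode → ℂ) : State :=
  (fun x => ((θ (‖x‖ / y) * groundState α x : ℝ) : ℂ),
   fun p => ((θ (‖p.1‖ / y) * groundState α p.1 : ℝ) : ℂ) *
      (2 * (α ^ (3 / 2 : ℝ) : ℝ) * R.phiStarWall p.2) + Φ p)

end CasimirPolder

end

noncomputable section

namespace CasimirPolder

/-! ### Integration in polar coordinates -/

section Polar

variable {F : Type*} [NormedAddCommGroup F] [NormedSpace ℝ F]

/-! The correction `Φ_*¹` is zero. On one photon `P_f` is multiplication by the wave vector `p`, so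
`Φ_*¹(p)` contracts the tensor `∫ λ_∞(q) ⊗ λ_∞(q) / (|q| + |p|) dq` with `p` and with the
polarization `e_γ(p)`. The tensor is isotropic and `p · e_γ(p) = 0`
(`Radiation.phiStar_ae_eq_zero`). The trial vector is therefore `(χ_y u_α, Φ_#)`, and `‖Φ_*¹‖²_*`
vanishes on the right-hand side.

The vector `Φ_#` rests on the factorization `h_α - e_α = D* D` with `D = ∇ + (α/2) x/|x|`, which
annihilates `u_α` (`IsH10.twisted_form`). For each photon energy `t > 0` the equation `(h_α - e_α +
t) U = ∂ⱼ u_α` is solved by inverting a coercive form on the closure of the test functions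
(`exists_form_resolvent`, `exists_isFiberResolvent`). Since `∂ⱼ u_α` is `-½ Dⱼ* u_α` in the weak
sense, `‖D U‖² ≤ 1/4` and `t ‖U‖² ≤ 1/16`, whatever the position of the wall; directly, `t ‖U‖ ≤
α/2`. Together `‖U‖² ≤ α² / (2t(α² + t))`, and integration against `|λ_y|²`, of order `1/|k|`, gives
`‖Φ_#‖² = O(α³ log α⁻¹)`. The solutions are continuous in `log t`, hence have a jointly measurable
version (`exists_jointly_measurable`), which is superposed over the modes
(`Radiation.exists_isSharpField`). Hardy inequalities for `|x|` and for the distance to the wall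
give the domain properties.

The energy is computed exactly in `Radiation.IsSharpField.energy_eq`. The operator `h_α - e_α +
H_f⁺` contributes `+‖Φ_#‖²_#`, and the coupling contributes `-2 Re ⟨Φ_#, S⟩`, where `S` differs from
the source of `Φ_#` only by the cut-off; the net result is `-‖Φ_#‖²_#`. All effects of the cut-off
live on `|x| ≥ y/4`, where the fifth moment of `u_α²` yields `L⁻⁵`. The remaining terms on `Φ_#`
cost `α ‖Φ_#‖² = O(α⁴ log α⁻¹)`. In `⟨V_y⟩` the reflection `x ↦ -x` removes the odd terms of the
expansion, and the quadratic term `-(|x|² + x₁²)/(16 y³)` gives `-α²/L³`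
(`integral_wallPotential_le`). Division by the norm is harmless (`div_le_of_le_add`): the correction
terms are `O(α²)` and the squared norm differs from `1` by `O(L⁻⁵ + α³ log α⁻¹)`. -/

lemma finrank_E3 : Module.finrank ℝ E3 = 3 := by simp

/-- Integration in polar coordinates reduces the vanishing of an integral to rays. -/
lemma integral_eq_zero_of_rays (g : E3 → F) (hg : Integrable g)
    (h : ∀ ξ : E3, ‖ξ‖ = 1 → IntegrableOn (fun r : ℝ => r ^ 2 • g (r • ξ)) (Ioi 0) →
      ∫ r in Ioi (0 : ℝ), r ^ 2 • g (r • ξ) = 0) :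
    ∫ x, g x = 0 := by
  have hmp := (volume : Measure E3).measurePreserving_homeomorphUnitSphereProd
  have hemb := Homeomorph.measurableEmbedding (homeomorphUnitSphereProd E3)
  let G : (Metric.sphere (0 : E3) 1 × Ioi (0 : ℝ)) → F := fun p => g (p.2.1 • p.1.1)
  have hG : ∀ x : ({(0 : E3)}ᶜ : Set E3), G (homeomorphUnitSphereProd E3 x) = g x.1 := by
    intro x
    have hx : (x : E3) ≠ 0 := x.2
    have hx' : ‖(x : E3)‖ ≠ 0 := norm_ne_zero_iff.2 hx
    simp [G, smul_smul, hx']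
  have e1 : ∫ x, g x = ∫ x : ({(0 : E3)}ᶜ : Set E3), g x.1 ∂((volume : Measure E3).comap (↑)) := by
    rw [integral_subtype_comap (measurableSet_singleton _).compl g, restrict_compl_singleton]
  have hi : Integrable G ((volume : Measure E3).toSphere.prod
      (.volumeIoiPow (Module.finrank ℝ E3 - 1))) := by
    rw [← hmp.integrable_comp_emb hemb]
    have : G ∘ (homeomorphUnitSphereProd E3) = fun x : ({(0 : E3)}ᶜ : Set E3) => g x.1 :=
      funext hG
    rw [this]
    have := (integrableOn_iff_comap_subtypeVal (μ := (volume : Measure E3)) (f := g)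
      (measurableSet_singleton (0 : E3)).compl).1 hg.integrableOn
    exact this
  have e2 : ∫ x : ({(0 : E3)}ᶜ : Set E3), g x.1 ∂((volume : Measure E3).comap (↑)) =
      ∫ p, G p ∂((volume : Measure E3).toSphere.prod
        (.volumeIoiPow (Module.finrank ℝ E3 - 1))) := by
    rw [← hmp.integral_comp hemb G]
    simp_rw [hG]
  rw [e1, e2, integral_prod _ hi]
  refine integral_eq_zero_of_ae ?_
  -- By Fubini almost every ray carries an integrable function, which is all that `h` needs.
  filter_upwards [hi.prod_right_ae] with ξ hξ
  simp only [Measure.volumeIoiPow, ENNReal.ofReal] at hξ ⊢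
  rw [integrable_withDensity_iff_integrable_smul
    ((measurable_subtype_coe.pow_const _).real_toNNReal)] at hξ
  rw [integral_withDensity_eq_integral_smul
      ((measurable_subtype_coe.pow_const _).real_toNNReal),
    integral_subtype_comap measurableSet_Ioi fun a : ℝ =>
      Real.toNNReal (a ^ (Module.finrank ℝ E3 - 1)) • g (a • ξ.1)]
  have hξ' : IntegrableOn (fun a : ℝ =>
      Real.toNNReal (a ^ (Module.finrank ℝ E3 - 1)) • g (a • ξ.1)) (Ioi 0) := by
    rw [integrableOn_iff_comap_subtypeVal measurableSet_Ioi]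
    exact hξ
  have hc : ∀ a ∈ Ioi (0 : ℝ), Real.toNNReal (a ^ (Module.finrank ℝ E3 - 1)) • g (a • ξ.1)
      = a ^ 2 • g (a • ξ.1) := by
    intro a ha
    rw [NNReal.smul_def, Real.coe_toNNReal _ (pow_nonneg (le_of_lt ha) _), finrank_E3]
  rw [setIntegral_congr_fun measurableSet_Ioi hc]
  exact h ξ.1 (by simp) (hξ'.congr_fun hc measurableSet_Ioi)

/-- The distributional identity `div (x/|x|) = 2/|x|`. -/
lemma integral_radial_divergence [CompleteSpace F] (φ : E3 → F)
    (hd : ∀ x ≠ 0, DifferentiableAt ℝ φ x)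
    (hi : Integrable fun x => fderiv ℝ φ x (‖x‖⁻¹ • x) + (2 / ‖x‖) • φ x)
    (h0 : ∀ ξ : E3, ‖ξ‖ = 1 → Tendsto (fun r : ℝ => r ^ 2 • φ (r • ξ)) (𝓝[>] 0) (𝓝 0))
    (hs : ∃ ρ : ℝ, ∀ x, ρ < ‖x‖ → φ x = 0) :
    ∫ x, (fderiv ℝ φ x (‖x‖⁻¹ • x) + (2 / ‖x‖) • φ x) = 0 := by
  refine integral_eq_zero_of_rays _ hi fun ξ hξ hint => ?_
  obtain ⟨ρ, hρ⟩ := hs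
  -- On a ray the integrand with its polar weight is the derivative of `r ^ 2 • φ (r • ξ)`; the
  -- boundary terms vanish at `0` by `h0` and at infinity by `hs`.
  have key := integral_Ioi_of_hasDerivAt_of_tendsto (a := (0 : ℝ)) (m := 0)
    (f := fun r : ℝ => r ^ 2 • φ (r • ξ))
    (f' := fun r : ℝ => r ^ 2 • (fderiv ℝ φ (r • ξ) (‖r • ξ‖⁻¹ • (r • ξ)) +
      (2 / ‖r • ξ‖) • φ (r • ξ))) ?_ ?_ hint ?_
  · simpa using key
  · rw [← continuousWithinAt_Ioi_iff_Ici]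
    simpa [ContinuousWithinAt] using h0 ξ hξ
  · intro r hr
    have hr0 : (0 : ℝ) < r := hr
    have hne : r • ξ ≠ 0 := smul_ne_zero hr0.ne' (by rintro rfl; simp at hξ)
    have h1 : HasDerivAt (fun r : ℝ => φ (r • ξ)) (fderiv ℝ φ (r • ξ) ξ) r := by
      have h2 : HasDerivAt (fun r : ℝ => r • ξ) ξ r := by
        simpa using (hasDerivAt_id r).smul_const ξ
      exact (hd _ hne).hasFDerivAt.comp_hasDerivAt r h2
    have h3 := (hasDerivAt_pow 2 r).smul h1
    have hn : ‖r • ξ‖ = r := by rw [norm_smul, hξ, mul_one, Real.norm_of_nonneg hr0.le]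
    refine (show HasDerivAt (fun r : ℝ => r ^ 2 • φ (r • ξ)) _ r from h3).congr_deriv ?_
    rw [hn, smul_smul, inv_mul_cancel₀ hr0.ne', one_smul, smul_add, smul_smul]
    congr 2
    field_simp
    simp [mul_comm]
  · refine tendsto_const_nhds.congr' ?_
    filter_upwards [eventually_gt_atTop (max ρ 0)] with r hr
    have : ‖r • ξ‖ = r := by
      rw [norm_smul, hξ, mul_one, Real.norm_of_nonneg ((le_max_right _ _).trans hr.le)]
    rw [hρ (r • ξ) (by rw [this]; exact (le_max_left _ _).trans_lt hr), smul_zero]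

/-- Radial integrals over `ℝ³`. -/
lemma integral_radial (f : ℝ → ℝ) :
    ∫ x : E3, f ‖x‖ = 4 * Real.pi * ∫ r in Ioi (0 : ℝ), r ^ 2 * f r := by
  have h := integral_fun_norm_addHaar (volume : Measure E3) f
  rw [finrank_E3] at h
  rw [h, measureReal_def, EuclideanSpace.volume_ball_fin_three]
  have : (ENNReal.ofReal 1 ^ 3 * ENNReal.ofReal (Real.pi * 4 / 3)).toReal = Real.pi * 4 / 3 := by
    rw [ENNReal.ofReal_one, one_pow, one_mul, ENNReal.toReal_ofReal (by positivity)]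
  rw [this]
  simp only [nsmul_eq_mul, smul_eq_mul, Nat.cast_ofNat, Nat.add_one_sub_one]
  ring

lemma integrable_radial_iff (f : ℝ → ℝ) :
    Integrable (fun x : E3 => f ‖x‖) ↔ IntegrableOn (fun r : ℝ => r ^ 2 * f r) (Ioi 0) := by
  have h := integrable_fun_norm_addHaar (volume : Measure E3) (f := f)
  rw [finrank_E3] at h
  simpa using h

/-- `|x|⁻²` is locally integrable on `ℝ³`. -/
lemma integrableOn_norm_inv_sq (ρ : ℝ) :
    IntegrableOn (fun x : E3 => (‖x‖ ^ 2)⁻¹) (Metric.closedBall 0 ρ) := by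
  rw [← integrable_indicator_iff measurableSet_closedBall]
  have h := (integrable_radial_iff ((Iic ρ).indicator fun r => (r ^ 2)⁻¹)).2 ?_
  · refine h.congr (Eventually.of_forall fun x => ?_)
    simp [indicator]
  · have : IntegrableOn ((Iic ρ).indicator fun _ : ℝ => (1 : ℝ)) (Ioi 0) := by
      rw [IntegrableOn, integrable_indicator_iff measurableSet_Iic, IntegrableOn,
        Measure.restrict_restrict measurableSet_Iic]
      exact (integrable_const (μ := volume.restrict (Ioc 0 ρ)) (1 : ℝ)).mono_measure
        (Measure.restrict_mono (fun x hx => ⟨hx.2, hx.1⟩ : Iic ρ ∩ Ioi 0 ⊆ Ioc 0 ρ) le_rfl)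
    refine this.congr_fun (fun r hr => ?_) measurableSet_Ioi
    have : (0 : ℝ) < r := hr
    by_cases h : r ≤ ρ <;> simp [indicator, h]
    field_simp

end Polar

/-! ### Partial derivatives and integrability near the origin -/

lemma E3_eq_sum (x : E3) : x = ∑ j, x j • unitVec j := by
  ext i
  simp [unitVec, Fin.sum_univ_three]
  fin_cases i <;> simp

lemma norm_unitVec (j : Fin 3) : ‖unitVec j‖ = 1 := by simp [unitVec]

lemma norm_sq_eq_sum (x : E3) : ‖x‖ ^ 2 = ∑ j, x j ^ 2 := by
  rw [EuclideanSpace.norm_sq_eq]; simp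

lemma abs_coord_le (x : E3) (j : Fin 3) : |x j| ≤ ‖x‖ := by
  simpa using PiLp.norm_apply_le x j

lemma continuous_coord (j : Fin 3) : Continuous fun x : E3 => x j := by fun_prop

lemma measurable_coord (j : Fin 3) : Measurable fun x : E3 => x j :=
  (continuous_coord j).measurable

lemma abs_direction_le (x : E3) (j : Fin 3) : |x j / ‖x‖| ≤ 1 := by
  rw [abs_div, abs_norm]
  exact div_le_one_of_le₀ (abs_coord_le x j) (norm_nonneg _)

lemma sum_direction_sq {x : E3} (hx : x ≠ 0) : ∑ j, (x j / ‖x‖) ^ 2 = 1 := by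
  simp_rw [div_pow, ← Finset.sum_div, ← norm_sq_eq_sum]
  exact div_self (pow_ne_zero 2 (norm_ne_zero_iff.2 hx))

lemma ae_ne_zero : ∀ᵐ x : E3, x ≠ 0 := by
  simp [ae_iff]

lemma ae_atomMeasure_ne_zero (y : ℝ) : ∀ᵐ x ∂atomMeasure y, x ≠ 0 :=
  ae_restrict_of_ae ae_ne_zero

lemma apply_radial {F : Type*} [NormedAddCommGroup F] [NormedSpace ℝ F] (T : E3 →L[ℝ] F) (x : E3) :
    T (‖x‖⁻¹ • x) = ∑ j, (x j / ‖x‖) • T (unitVec j) := by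
  conv_lhs => rw [E3_eq_sum x, ← E3_eq_sum x]
  rw [map_smul]
  conv_lhs => rw [E3_eq_sum x]
  rw [map_sum, Finset.smul_sum]
  refine Finset.sum_congr rfl fun j _ => ?_
  rw [map_smul, smul_smul, ← E3_eq_sum x, div_eq_inv_mul]

/-- In dimension three a singularity of order two at the origin is integrable; this comparison
serves all the Coulomb and Hardy weights. -/
lemma integrable_of_bound_inv_sq {F : Type*} [NormedAddCommGroup F] {g : E3 → F} {M ρ : ℝ}
    (hg : AEStronglyMeasurable g volume)
    (hb : ∀ x ≠ 0, ‖x‖ ≤ ρ → ‖g x‖ ≤ M * (1 + (‖x‖ ^ 2)⁻¹)) (h0 : ∀ x ≠ 0, ρ < ‖x‖ → g x = 0) :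
    Integrable g := by
  have h1 : IntegrableOn (fun x : E3 => M * (1 + (‖x‖ ^ 2)⁻¹)) (Metric.closedBall 0 ρ) := by
    refine Integrable.const_mul (Integrable.add ?_ (integrableOn_norm_inv_sq ρ)) M
    exact integrableOn_const (measure_closedBall_lt_top.ne)
  have h2 := (integrable_indicator_iff measurableSet_closedBall).2 h1
  refine h2.mono' hg ?_
  filter_upwards [ae_ne_zero] with x hx
  by_cases h : ‖x‖ ≤ ρ
  · simpa [indicator, h] using hb x hx h
  · rw [h0 x hx (not_le.1 h)]
    simp [indicator, h]

lemma inv_norm_le (x : E3) : ‖x‖⁻¹ ≤ 1 + (‖x‖ ^ 2)⁻¹ := by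
  have h : 0 ≤ (‖x‖⁻¹ - 1) ^ 2 := sq_nonneg _
  have h2 : (‖x‖ ^ 2)⁻¹ = ‖x‖⁻¹ ^ 2 := by rw [inv_pow]
  have h3 : 0 ≤ ‖x‖⁻¹ := by positivity
  rw [h2]; nlinarith

/-! ### Radial identities for functions of compact support -/

section Radial

variable {F : Type*} [NormedAddCommGroup F] [NormedSpace ℝ F]

lemma exists_bound_of_contDiff {φ : E3 → F} (h : ContDiff ℝ 1 φ) (hc : HasCompactSupport φ) :
    ∃ M ρ : ℝ, 0 ≤ M ∧ 0 ≤ ρ ∧ (∀ x, ‖φ x‖ ≤ M) ∧ (∀ x, ‖fderiv ℝ φ x‖ ≤ M) ∧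
      (∀ x, ρ < ‖x‖ → φ x = 0) ∧ (∀ x, ρ < ‖x‖ → fderiv ℝ φ x = 0) := by
  obtain ⟨M₁, h₁⟩ := hc.exists_bound_of_continuous h.continuous
  have hc' : HasCompactSupport (fderiv ℝ φ) := hc.fderiv (𝕜 := ℝ)
  obtain ⟨M₂, h₂⟩ := hc'.exists_bound_of_continuous (h.continuous_fderiv (by simp))
  obtain ⟨ρ, hρ⟩ := hc.isBounded.subset_closedBall (0 : E3)
  have hz : ∀ x, max ρ 0 < ‖x‖ → x ∉ tsupport φ := fun x hx hx' => by
    have := hρ hx'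
    rw [mem_closedBall_zero_iff] at this
    exact absurd ((le_max_left _ _).trans_lt hx) (not_lt.2 this)
  refine ⟨max M₁ M₂, max ρ 0, ?_, le_max_right _ _, fun x => (h₁ x).trans (le_max_left _ _),
    fun x => (h₂ x).trans (le_max_right _ _), fun x hx => image_eq_zero_of_notMem_tsupport (hz x hx),
    fun x hx => image_eq_zero_of_notMem_tsupport
      fun hx' => hz x hx (tsupport_fderiv_subset ℝ hx')⟩
  exact ((norm_nonneg _).trans (h₁ 0)).trans (le_max_left _ _)

lemma norm_apply_radial_le (T : E3 →L[ℝ] F) (x : E3) : ‖T (‖x‖⁻¹ • x)‖ ≤ ‖T‖ := by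
  refine (T.le_opNorm _).trans (mul_le_of_le_one_right (norm_nonneg _) ?_)
  rw [norm_smul, norm_inv, norm_norm]
  exact inv_mul_le_one

lemma aestronglyMeasurable_radial_deriv {φ : E3 → F} (h : ContDiff ℝ 1 φ) :
    AEStronglyMeasurable (fun x => fderiv ℝ φ x (‖x‖⁻¹ • x)) (volume : Measure E3) := by
  simp_rw [apply_radial]
  have : ∀ j : Fin 3, Measurable fun x : E3 => x j / ‖x‖ := fun j =>
    (measurable_coord j).div measurable_norm
  have hf := h.continuous_fderiv (by simp)
  refine Finset.aestronglyMeasurable_fun_sum _ fun j _ =>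
    (this j).aestronglyMeasurable.smul ?_
  exact (hf.clm_apply continuous_const).aestronglyMeasurable

lemma integrable_radial_deriv {φ : E3 → F} (h : ContDiff ℝ 1 φ) (hc : HasCompactSupport φ) :
    Integrable fun x : E3 => fderiv ℝ φ x (‖x‖⁻¹ • x) := by
  obtain ⟨M, ρ, hM, -, -, h2, -, h4⟩ := exists_bound_of_contDiff h hc
  refine integrable_of_bound_inv_sq (M := M) (ρ := ρ) (aestronglyMeasurable_radial_deriv h)
    (fun x _ _ => (norm_apply_radial_le _ _).trans ((h2 x).trans ?_)) fun x _ hx => by simp [h4 x hx]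
  exact le_mul_of_one_le_right hM (by simp)

lemma integrable_div_norm {φ : E3 → F} (h : Continuous φ) (hc : HasCompactSupport φ) :
    Integrable fun x : E3 => ‖x‖⁻¹ • φ x := by
  obtain ⟨M, hM⟩ := hc.exists_bound_of_continuous h
  have hM0 : 0 ≤ M := (norm_nonneg _).trans (hM 0)
  obtain ⟨ρ, hρ⟩ := hc.isBounded.subset_closedBall (0 : E3)
  refine integrable_of_bound_inv_sq (M := M) (ρ := ρ)
    (measurable_norm.inv.aestronglyMeasurable.smul h.aestronglyMeasurable)
    (fun x _ _ => ?_) fun x _ hx => ?_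
  · rw [norm_smul, norm_inv, norm_norm, mul_comm]
    exact mul_le_mul (hM x) (inv_norm_le x) (by positivity) hM0
  · rw [image_eq_zero_of_notMem_tsupport (f := φ) (fun h => ?_), smul_zero]
    have := hρ h
    rw [mem_closedBall_zero_iff] at this
    exact absurd hx (not_lt.2 this)

lemma integrable_div_norm_sq {φ : E3 → F} (h : Continuous φ) (hc : HasCompactSupport φ) :
    Integrable fun x : E3 => (‖x‖ ^ 2)⁻¹ • φ x := by
  obtain ⟨M, hM⟩ := hc.exists_bound_of_continuous h
  have hM0 : 0 ≤ M := (norm_nonneg _).trans (hM 0)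
  obtain ⟨ρ, hρ⟩ := hc.isBounded.subset_closedBall (0 : E3)
  refine integrable_of_bound_inv_sq (M := M) (ρ := ρ)
    ((measurable_norm.pow_const 2).inv.aestronglyMeasurable.smul h.aestronglyMeasurable)
    (fun x _ _ => ?_) fun x _ hx => ?_
  · rw [norm_smul, norm_inv, norm_pow, norm_norm, mul_comm]
    exact mul_le_mul (hM x) (by simp) (by positivity) hM0
  · rw [image_eq_zero_of_notMem_tsupport (f := φ) (fun h => ?_), smul_zero]
    have := hρ h
    rw [mem_closedBall_zero_iff] at this
    exact absurd hx (not_lt.2 this)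

/-- The divergence identity for `φ` itself. It produces the Coulomb potential from the cross terms
of `D* D`. -/
lemma integral_radial_deriv [CompleteSpace F] {φ : E3 → F} (h : ContDiff ℝ 1 φ)
    (hc : HasCompactSupport φ) :
    ∫ x, fderiv ℝ φ x (‖x‖⁻¹ • x) = -(2 : ℝ) • ∫ x, ‖x‖⁻¹ • φ x := by
  obtain ⟨M, ρ, hM, -, h1, h2, h3, h4⟩ := exists_bound_of_contDiff h hc
  have key := integral_radial_divergence φ (fun x _ => (h.differentiable (by simp)) x)
    ?_ ?_ ⟨ρ, h3⟩
  · simp_rw [div_eq_mul_inv, mul_smul] at key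
    have hi2 : Integrable (fun x : E3 => (2 : ℝ) • ‖x‖⁻¹ • φ x) :=
      (integrable_div_norm h.continuous hc).smul (2 : ℝ)
    rw [integral_add (integrable_radial_deriv h hc) hi2, integral_smul] at key
    rw [eq_neg_of_add_eq_zero_left key, neg_smul]
  · simp_rw [div_eq_mul_inv, mul_smul]
    exact (integrable_radial_deriv h hc).add ((integrable_div_norm h.continuous hc).smul (2 : ℝ))
  · intro ξ _
    have h5 : Continuous fun r : ℝ => r ^ 2 • φ (r • ξ) :=
      (continuous_pow 2).smul (h.continuous.comp (continuous_id.smul continuous_const))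
    have := h5.tendsto 0
    simp only [ne_eq, OfNat.ofNat_ne_zero, not_false_eq_true, zero_pow, zero_smul] at this
    exact this.mono_left nhdsWithin_le_nhds

/-- The divergence identity for `ψ/|x|`: the derivative of the weight gives `-ψ/|x|²` and the
divergence gives `2ψ/|x|²`, so one copy of `ψ/|x|²` remains. This is the source of the Hardy
inequality. -/
lemma integral_radial_deriv_div [CompleteSpace F] {ψ : E3 → F} (h : ContDiff ℝ 1 ψ)
    (hc : HasCompactSupport ψ) :
    ∫ x, ‖x‖⁻¹ • fderiv ℝ ψ x (‖x‖⁻¹ • x) = -∫ x, (‖x‖ ^ 2)⁻¹ • ψ x := by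
  obtain ⟨M, ρ, hM, -, h1, h2, h3, h4⟩ := exists_bound_of_contDiff h hc
  have hi1 : Integrable fun x : E3 => ‖x‖⁻¹ • fderiv ℝ ψ x (‖x‖⁻¹ • x) := by
    refine integrable_of_bound_inv_sq (M := M) (ρ := ρ)
      (measurable_norm.inv.aestronglyMeasurable.smul (aestronglyMeasurable_radial_deriv h))
      (fun x _ _ => ?_) fun x _ hx => by simp [h4 x hx]
    rw [norm_smul, norm_inv, norm_norm, mul_comm]
    exact mul_le_mul ((norm_apply_radial_le _ _).trans (h2 x)) (inv_norm_le x) (by positivity) hM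
  have hi2 := integrable_div_norm_sq h.continuous hc
  have hd : ∀ x : E3, x ≠ 0 → HasFDerivAt (fun x : E3 => ‖x‖⁻¹ • ψ x) (‖x‖⁻¹ • fderiv ℝ ψ x +
      (-(‖x‖ ^ 2)⁻¹ • fderiv ℝ (fun x : E3 => ‖x‖) x).smulRight (ψ x)) x := by
    intro x hx
    have hn : DifferentiableAt ℝ (fun x : E3 => ‖x‖) x := (contDiffAt_norm ℝ hx).differentiableAt
      (n := 1) (by simp)
    have h6 := (hasDerivAt_inv (norm_ne_zero_iff.2 hx)).comp_hasFDerivAt x hn.hasFDerivAt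
    exact h6.smul ((h.differentiable (by simp)) x).hasFDerivAt
  have he : ∀ x : E3, x ≠ 0 → fderiv ℝ (fun x : E3 => ‖x‖⁻¹ • ψ x) x (‖x‖⁻¹ • x) +
      (2 / ‖x‖) • (‖x‖⁻¹ • ψ x) = ‖x‖⁻¹ • fderiv ℝ ψ x (‖x‖⁻¹ • x) + (‖x‖ ^ 2)⁻¹ • ψ x := by
    intro x hx
    have hn : DifferentiableAt ℝ (fun x : E3 => ‖x‖) x := (contDiffAt_norm ℝ hx).differentiableAt
      (n := 1) (by simp)
    have hx' : ‖x‖ ≠ 0 := norm_ne_zero_iff.2 hx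
    rw [(hd x hx).fderiv]
    simp only [add_apply, smul_apply,
      ContinuousLinearMap.smulRight_apply, map_smul, hn.fderiv_norm_self]
    rw [smul_add, add_assoc, smul_smul _ _ (ψ x), smul_smul _ _ (ψ x), ← add_smul]
    congr 2
    simp only [smul_eq_mul]
    field_simp
    ring
  have key := integral_radial_divergence (fun x : E3 => ‖x‖⁻¹ • ψ x)
    (fun x hx => (hd x hx).differentiableAt) ?_ ?_ ⟨ρ, fun x hx => by simp [h3 x hx]⟩
  · rw [integral_congr_ae (ae_ne_zero.mono fun x hx => he x hx), integral_add hi1 hi2] at key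
    exact eq_neg_of_add_eq_zero_left key
  · exact (hi1.add hi2).congr (ae_ne_zero.mono fun x hx => (he x hx).symm)
  · intro ξ hξ
    have h5 : Continuous fun r : ℝ => r • ψ (r • ξ) :=
      continuous_id.smul (h.continuous.comp (continuous_id.smul continuous_const))
    have := h5.tendsto 0
    rw [zero_smul] at this
    refine (this.mono_left nhdsWithin_le_nhds).congr' ?_
    filter_upwards [self_mem_nhdsWithin] with r hr
    have hr0 : (0 : ℝ) < r := hr
    rw [norm_smul, hξ, mul_one, Real.norm_of_nonneg hr0.le, smul_smul]
    congr 1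
    field_simp

end Radial

/-! ### Square integrable functions -/

section L2

variable {X : Type*} [MeasurableSpace X] {μ : Measure X}

lemma eLpNorm_two_sq {E : Type*} [NormedAddCommGroup E] (f : X → E) :
    eLpNorm f 2 μ ^ 2 = ∫⁻ x, ‖f x‖ₑ ^ 2 ∂μ := by
  have h := eLpNorm_nnreal_pow_eq_lintegral (f := f) (μ := μ) (p := 2) two_ne_zero
  have h2 : (((2 : NNReal) : ℝ)) = ((2 : ℕ) : ℝ) := by norm_num
  simp only [h2, ENNReal.rpow_natCast] at h
  exact h

lemma integrable_norm_sq {E : Type*} [NormedAddCommGroup E] {f : X → E} (hf : MemLp f 2 μ) :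
    Integrable (fun x => ‖f x‖ ^ 2) μ := hf.integrable_norm_pow two_ne_zero

lemma eLpNorm_two_sq_eq_ofReal {E : Type*} [NormedAddCommGroup E] {f : X → E}
    (hf : MemLp f 2 μ) : eLpNorm f 2 μ ^ 2 = ENNReal.ofReal (∫ x, ‖f x‖ ^ 2 ∂μ) := by
  rw [eLpNorm_two_sq, ofReal_integral_eq_lintegral_ofReal (integrable_norm_sq hf)
    (Eventually.of_forall fun x => sq_nonneg _)]
  refine lintegral_congr fun x => ?_
  rw [ENNReal.ofReal_pow (norm_nonneg _), ofReal_norm]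

/-- Hölder turns `L²` convergence into `L¹` convergence of the products. This is how identities pass
from test functions to `H¹₀`. -/
lemma tendsto_integral_mul_L2 {a v : X → ℂ} {w : ℕ → X → ℂ} (ha : MemLp a 2 μ) (hv : MemLp v 2 μ)
    (hw : ∀ n, MemLp (w n) 2 μ)
    (h : Tendsto (fun n => eLpNorm (fun x => v x - w n x) 2 μ) atTop (𝓝 0)) :
    Tendsto (fun n => ∫ x, a x * w n x ∂μ) atTop (𝓝 (∫ x, a x * v x ∂μ)) := by
  refine tendsto_integral_of_L1' _ (ha.integrable_mul hv).aestronglyMeasurable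
    (Eventually.of_forall fun n => ha.integrable_mul (hw n)) ?_
  have h1 : Tendsto (fun n => eLpNorm a 2 μ * eLpNorm (fun x => v x - w n x) 2 μ) atTop (𝓝 0) := by
    have := ENNReal.Tendsto.const_mul h (Or.inr ha.eLpNorm_ne_top)
    rwa [mul_zero] at this
  refine tendsto_of_tendsto_of_tendsto_of_le_of_le tendsto_const_nhds h1 (fun _ => zero_le)
    fun n => ?_
  have := eLpNorm_smul_le_mul_eLpNorm (p := 2) (q := 2) (r := 1)
    ((hv.sub (hw n)).aestronglyMeasurable) ha.aestronglyMeasurable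
  refine le_trans (le_of_eq ?_) this
  rw [← eLpNorm_neg]
  congr 1
  ext x
  simp only [Pi.neg_apply, Pi.sub_apply, Pi.smul_apply', Pi.mul_apply, smul_eq_mul]
  ring

end L2

/-! ### Test functions -/

section Test

variable {y : ℝ} {η ζ : E3 → ℂ}

namespace IsTest

lemma contDiff_one (h : IsTest y η) : ContDiff ℝ 1 η := h.1.of_le (by simp)

lemma continuous (h : IsTest y η) : Continuous η := h.1.continuous

lemma differentiable (h : IsTest y η) : Differentiable ℝ η := h.contDiff_one.differentiable (by simp)

lemma continuous_deriv (h : IsTest y η) (v : E3) : Continuous fun x => fderiv ℝ η x v :=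
  (h.contDiff_one.continuous_fderiv (by simp)).clm_apply continuous_const

lemma support_deriv (h : IsTest y η) (v : E3) : HasCompactSupport fun x => fderiv ℝ η x v :=
  h.2.1.fderiv_apply (𝕜 := ℝ) v

lemma memLp (h : IsTest y η) : MemLp η 2 (atomMeasure y) :=
  (h.continuous.memLp_of_hasCompactSupport h.2.1).restrict _

lemma memLp_deriv (h : IsTest y η) (v : E3) :
    MemLp (fun x => fderiv ℝ η x v) 2 (atomMeasure y) :=
  ((h.continuous_deriv v).memLp_of_hasCompactSupport (h.support_deriv v)).restrict _

lemma eq_zero (h : IsTest y η) {x : E3} (hx : x ∉ atomRegion y) : η x = 0 :=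
  image_eq_zero_of_notMem_tsupport fun h' => hx (h.2.2 h')

lemma deriv_eq_zero (h : IsTest y η) {x : E3} (hx : x ∉ atomRegion y) : fderiv ℝ η x = 0 :=
  image_eq_zero_of_notMem_tsupport fun h' => hx (h.2.2 (tsupport_fderiv_subset ℝ h'))

lemma star_comp (h : IsTest y η) : IsTest y fun x => conj (η x) := by
  have h1 : HasCompactSupport fun x => (starRingEnd ℂ) (η x) :=
    h.2.1.comp_left (g := starRingEnd ℂ) (map_zero _)
  refine ⟨Complex.conjCLE.contDiff.comp h.1, h1, ?_⟩
  refine (closure_mono ?_).trans h.2.2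
  intro x hx hx'
  exact hx (by simp [hx'])

lemma fderiv_conj (h : IsTest y η) (x v : E3) :
    fderiv ℝ (fun x => (starRingEnd ℂ) (η x)) x v = (starRingEnd ℂ) (fderiv ℝ η x v) := by
  have := (Complex.conjCLE.toContinuousLinearMap.hasFDerivAt (x := η x)).comp x
    (h.differentiable x).hasFDerivAt
  have h2 := this.fderiv
  have h3 : (Complex.conjCLE.toContinuousLinearMap ∘ η) = fun x => (starRingEnd ℂ) (η x) := by
    ext x; simp
  rw [h3] at h2
  rw [h2]
  simp

lemma mul_left (h : IsTest y η) {χ : E3 → ℂ} (hχ : ContDiff ℝ ∞ χ) : IsTest y fun x => χ x * η x := by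
  refine ⟨hχ.mul h.1, h.2.1.mul_left, ?_⟩
  exact (tsupport_mul_subset_right).trans h.2.2

lemma add (h : IsTest y η) (h' : IsTest y ζ) : IsTest y fun x => η x + ζ x := by
  refine ⟨h.1.add h'.1, h.2.1.add h'.2.1, ?_⟩
  exact (tsupport_add η ζ).trans (union_subset h.2.2 h'.2.2)

lemma const_mul (h : IsTest y η) (c : ℂ) : IsTest y fun x => c * η x := h.mul_left contDiff_const

lemma zero : IsTest y fun _ => 0 := by
  refine ⟨contDiff_const, HasCompactSupport.zero, ?_⟩
  have : tsupport (fun _ : E3 => (0 : ℂ)) = ∅ := tsupport_eq_empty_iff.2 rfl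
  rw [this]
  exact empty_subset _

lemma fderiv_mul (h : IsTest y η) (h' : IsTest y ζ) (x v : E3) :
    fderiv ℝ (fun x => η x * ζ x) x v = η x * fderiv ℝ ζ x v + fderiv ℝ η x v * ζ x := by
  have := (h.differentiable x).hasFDerivAt.mul (h'.differentiable x).hasFDerivAt
  rw [show (fun x => η x * ζ x) = η * ζ from rfl, this.fderiv]
  simp [mul_comm]

/-- Moves integrals to the whole space, where integration by parts has no boundary. -/
lemma setIntegral_eq {F : Type*} [NormedAddCommGroup F] [NormedSpace ℝ F] {g : E3 → F}
    (hg : ∀ x, x ∉ atomRegion y → g x = 0) : ∫ x, g x ∂atomMeasure y = ∫ x, g x :=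
  setIntegral_eq_integral_of_forall_compl_eq_zero hg

end IsTest

lemma memLp_direction_mul (α : ℝ) {v : E3 → ℂ} {μ : Measure E3} (hv : MemLp v 2 μ) (j : Fin 3) :
    MemLp (fun x => ((α * (x j / ‖x‖) : ℝ) : ℂ) * v x) 2 μ := by
  have hm : Measurable fun x : E3 => ((α * (x j / ‖x‖) : ℝ) : ℂ) :=
    Complex.measurable_ofReal.comp (((measurable_coord j).div measurable_norm).const_mul α)
  refine MemLp.of_le_mul (c := |α|) hv (hm.aestronglyMeasurable.mul hv.aestronglyMeasurable)
    (Eventually.of_forall fun x => ?_)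
  rw [norm_mul, Complex.norm_real, Real.norm_eq_abs, abs_mul]
  gcongr
  exact mul_le_of_le_one_right (abs_nonneg _) (abs_direction_le x j)

/-- `div (x/|x|) = 2/|x|`, tested against a product of test functions. -/
lemma IsTest.radial_identity (h : IsTest y η) (h' : IsTest y ζ) :
    ∑ j, ∫ x, ((x j / ‖x‖ : ℝ) : ℂ) *
      (fderiv ℝ η x (unitVec j) * ζ x + η x * fderiv ℝ ζ x (unitVec j)) ∂atomMeasure y
      = -2 * ∫ x, ((‖x‖⁻¹ : ℝ) : ℂ) * η x * ζ x ∂atomMeasure y := by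
  have hφ := h'.mul_left h.1
  have key := integral_radial_deriv hφ.contDiff_one hφ.2.1
  simp_rw [apply_radial, h.fderiv_mul h'] at key
  have e1 : ∫ x, ((‖x‖⁻¹ : ℝ) : ℂ) * η x * ζ x ∂atomMeasure y = ∫ x, ‖x‖⁻¹ • (η x * ζ x) := by
    rw [IsTest.setIntegral_eq fun x hx => by simp [h.eq_zero hx]]
    simp [mul_assoc]
  rw [e1]
  have hint : ∀ j, Integrable (fun x => ((x j / ‖x‖ : ℝ) : ℂ) *
      (fderiv ℝ η x (unitVec j) * ζ x + η x * fderiv ℝ ζ x (unitVec j))) := by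
    intro j
    have hm : Measurable fun x : E3 => ((x j / ‖x‖ : ℝ) : ℂ) :=
      Complex.measurable_ofReal.comp ((measurable_coord j).div measurable_norm)
    have hc : Integrable fun x => (fderiv ℝ η x (unitVec j) * ζ x +
        η x * fderiv ℝ ζ x (unitVec j)) :=
      (((h.continuous_deriv _).mul h'.continuous).add
        (h.continuous.mul (h'.continuous_deriv _))).integrable_of_hasCompactSupport
        (h'.2.1.mul_left.add h.2.1.mul_right)
    refine hc.bdd_mul (c := 1) hm.aestronglyMeasurable (Eventually.of_forall fun x => ?_)
    rw [Complex.norm_real]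
    exact abs_direction_le x j
  have e2 : ∑ j, ∫ x, ((x j / ‖x‖ : ℝ) : ℂ) *
      (fderiv ℝ η x (unitVec j) * ζ x + η x * fderiv ℝ ζ x (unitVec j)) ∂atomMeasure y =
      ∫ x, ∑ j, (x j / ‖x‖) • (η x * fderiv ℝ ζ x (unitVec j) + fderiv ℝ η x (unitVec j) * ζ x) := by
    have : ∀ j : Fin 3, ∫ x, ((x j / ‖x‖ : ℝ) : ℂ) *
      (fderiv ℝ η x (unitVec j) * ζ x + η x * fderiv ℝ ζ x (unitVec j)) ∂atomMeasure y =
      ∫ x, ((x j / ‖x‖ : ℝ) : ℂ) *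
      (fderiv ℝ η x (unitVec j) * ζ x + η x * fderiv ℝ ζ x (unitVec j)) := fun j =>
      IsTest.setIntegral_eq fun x hx => by simp [h.eq_zero hx, h'.eq_zero hx]
    simp_rw [this]
    rw [← integral_finsetSum _ fun j _ => hint j]
    refine integral_congr_ae (Eventually.of_forall fun x => Finset.sum_congr rfl fun j _ => ?_)
    simp only [Complex.real_smul]
    ring
  rw [e2, key]
  simp

/-! ### Hardy inequalities for test functions -/

lemma norm_fderiv_norm_sq_le (h : Differentiable ℝ η) (x v : E3) :
    ‖fderiv ℝ (fun x => ‖η x‖ ^ 2) x v‖ ≤ 2 * ‖η x‖ * ‖fderiv ℝ η x v‖ := by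
  have := (h x).hasFDerivAt.norm_sq
  rw [this.fderiv]
  simp only [smul_apply, ContinuousLinearMap.comp_apply, innerSL_apply_apply, Real.norm_eq_abs, nsmul_eq_mul, Nat.cast_ofNat, abs_mul, abs_two]
  rw [mul_assoc]
  gcongr
  exact abs_real_inner_le_norm _ _

/-- Cauchy–Schwarz against the direction `x/|x|`, a unit vector off the origin and zero at it. -/
lemma sq_norm_radial_le (T : E3 →L[ℝ] ℂ) (x : E3) :
    ‖T (‖x‖⁻¹ • x)‖ ^ 2 ≤ ∑ j, ‖T (unitVec j)‖ ^ 2 := by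
  rw [apply_radial]
  have h1 : ‖∑ j, (x j / ‖x‖) • T (unitVec j)‖ ≤ ∑ j, |x j / ‖x‖| * ‖T (unitVec j)‖ := by
    refine (norm_sum_le _ _).trans (Finset.sum_le_sum fun j _ => ?_)
    rw [norm_smul, Real.norm_eq_abs]
  have h2 := Finset.sum_mul_sq_le_sq_mul_sq Finset.univ (fun j => |x j / ‖x‖|)
    fun j => ‖T (unitVec j)‖
  have h3 : ∑ j, |x j / ‖x‖| ^ 2 ≤ 1 := by
    simp_rw [sq_abs]
    by_cases hx : x = 0
    · simp [hx]
    · exact (sum_direction_sq hx).le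
  calc _ ≤ (∑ j, |x j / ‖x‖| * ‖T (unitVec j)‖) ^ 2 := by gcongr
    _ ≤ _ := h2
    _ ≤ 1 * _ := by gcongr
    _ = _ := one_mul _

/-- Common core of both Hardy inequalities: `|ρ T| ≤ ½ ρ² |η|² + 2 d²`, and half of the left-hand
side, finite by `hi`, is absorbed; this gives the constant `4`. -/
lemma hardy_of_identity (h : IsTest y η) {ρ T d : E3 → ℝ}
    (hi : Integrable fun x => ρ x ^ 2 * ‖η x‖ ^ 2)
    (hid : ∫ x, ρ x * T x = -∫ x, ρ x ^ 2 * ‖η x‖ ^ 2)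
    (hT : ∀ x, ‖T x‖ ≤ 2 * ‖η x‖ * d x)
    (hd : ∀ x, d x ^ 2 ≤ ∑ j, ‖fderiv ℝ η x (unitVec j)‖ ^ 2) :
    ∫ x, ρ x ^ 2 * ‖η x‖ ^ 2 ≤ 4 * ∫ x, ∑ j, ‖fderiv ℝ η x (unitVec j)‖ ^ 2 := by
  have hg : Integrable fun x => ∑ j, ‖fderiv ℝ η x (unitVec j)‖ ^ 2 := by
    refine integrable_finsetSum _ fun j _ => ?_
    exact ((h.continuous_deriv _).memLp_of_hasCompactSupport
      (h.support_deriv _)).integrable_norm_pow (p := 2) two_ne_zero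
  have h1 : ‖∫ x, ρ x * T x‖ ≤ ∫ x, (1 / 2 * (ρ x ^ 2 * ‖η x‖ ^ 2) +
      2 * ∑ j, ‖fderiv ℝ η x (unitVec j)‖ ^ 2) := by
    refine norm_integral_le_of_norm_le ((hi.const_mul _).add (hg.const_mul _))
      (Eventually.of_forall fun x => ?_)
    rw [norm_mul, Real.norm_eq_abs]
    have := sq_nonneg (|ρ x| * ‖η x‖ - 2 * d x)
    have h2 : |ρ x| * ‖T x‖ ≤ |ρ x| * (2 * ‖η x‖ * d x) :=
      mul_le_mul_of_nonneg_left (hT x) (abs_nonneg _)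
    have h3 := sq_abs (ρ x)
    have h4 := hd x
    rw [← h3]
    nlinarith
  rw [integral_add (hi.const_mul _) (hg.const_mul _), integral_const_mul, integral_const_mul] at h1
  have h2 := (le_abs_self _).trans ((abs_neg (∫ x, ρ x * T x)).le.trans h1)
  rw [hid, neg_neg] at h2
  linarith

lemma contDiff_norm_sq (h : IsTest y η) : ContDiff ℝ 1 fun x => ‖η x‖ ^ 2 :=
  h.contDiff_one.norm_sq ℝ

lemma hasCompactSupport_norm_sq (h : IsTest y η) : HasCompactSupport fun x => ‖η x‖ ^ 2 :=
  h.2.1.comp_left (g := fun z : ℂ => ‖z‖ ^ 2) (by simp)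

lemma IsTest.hardy (h : IsTest y η) :
    ∫ x, ‖x‖⁻¹ ^ 2 * ‖η x‖ ^ 2 ≤ 4 * ∫ x, ∑ j, ‖fderiv ℝ η x (unitVec j)‖ ^ 2 := by
  have hψ := contDiff_norm_sq h
  have hc := hasCompactSupport_norm_sq h
  refine hardy_of_identity h (ρ := fun x => ‖x‖⁻¹)
    (T := fun x => fderiv ℝ (fun x => ‖η x‖ ^ 2) x (‖x‖⁻¹ • x))
    (d := fun x => ‖fderiv ℝ η x (‖x‖⁻¹ • x)‖) ?_ ?_
    (fun x => norm_fderiv_norm_sq_le h.differentiable _ _) fun x => sq_norm_radial_le _ _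
  · simpa using integrable_div_norm_sq hψ.continuous hc
  · simpa using integral_radial_deriv_div hψ hc

/-- The weight is singular only on the wall, which the support of a test function does not reach. -/
lemma continuous_wall_mul (h : IsTest y η) (n : ℕ) {g : E3 → ℝ} (hg : Continuous g)
    (hs : tsupport g ⊆ tsupport η) : Continuous fun x : E3 => (y - x 0)⁻¹ ^ n * g x := by
  refine continuous_of_tsupport fun x hx => ?_
  have hx' : x ∈ tsupport η := hs (tsupport_mul_subset_right hx)
  have hx0 : x 0 < y := h.2.2 hx'
  have : ContinuousAt (fun x : E3 => y - x 0) x := (continuous_const.sub (continuous_coord 0)).continuousAt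
  exact ((this.inv₀ (by linarith [hx0] : (0 : ℝ) < y - x 0).ne').pow n).mul hg.continuousAt

/-- The one-dimensional Hardy argument in the first coordinate: the derivative of `(y - x₁)⁻¹` is
its own square. -/
lemma IsTest.hardy_wall (h : IsTest y η) :
    ∫ x, (y - x 0)⁻¹ ^ 2 * ‖η x‖ ^ 2 ≤ 4 * ∫ x, ∑ j, ‖fderiv ℝ η x (unitVec j)‖ ^ 2 := by
  have hψ := contDiff_norm_sq h
  have hc := hasCompactSupport_norm_sq h
  have hs : tsupport (fun x => ‖η x‖ ^ 2) ⊆ tsupport η := by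
    refine closure_mono fun x hx hx' => hx ?_
    simp [hx']
  have hs' : tsupport (fun x => fderiv ℝ (fun x => ‖η x‖ ^ 2) x (unitVec 0)) ⊆ tsupport η :=
    (tsupport_fderiv_apply_subset ℝ (unitVec 0)).trans hs
  have hcd : Continuous fun x => fderiv ℝ (fun x => ‖η x‖ ^ 2) x (unitVec 0) :=
    (hψ.continuous_fderiv (by simp)).clm_apply continuous_const
  have hcc : HasCompactSupport fun x => fderiv ℝ (fun x => ‖η x‖ ^ 2) x (unitVec 0) :=
    hc.fderiv_apply (𝕜 := ℝ) _
  have hd : ∀ x : E3, x 0 < y → HasFDerivAt (fun x : E3 => (y - x 0)⁻¹)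
      (-((y - x 0) ^ 2)⁻¹ • -(EuclideanSpace.proj (𝕜 := ℝ) (0 : Fin 3))) x := by
    intro x hx
    have h1 : HasFDerivAt (fun x : E3 => y - x 0) (-(EuclideanSpace.proj (𝕜 := ℝ) (0 : Fin 3))) x :=
      ((EuclideanSpace.proj (𝕜 := ℝ) (0 : Fin 3)).hasFDerivAt).const_sub y
    exact (hasDerivAt_inv (by linarith : (0 : ℝ) < y - x 0).ne').comp_hasFDerivAt x h1
  have hde : ∀ x : E3, fderiv ℝ (fun x : E3 => (y - x 0)⁻¹) x (unitVec 0) * ‖η x‖ ^ 2 =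
      (y - x 0)⁻¹ ^ 2 * ‖η x‖ ^ 2 := by
    intro x
    by_cases hx : x 0 < y
    · rw [(hd x hx).fderiv]
      simp [unitVec]
    · simp [h.eq_zero (x := x) hx]
  have hI2 : Integrable fun x : E3 => (y - x 0)⁻¹ ^ 2 * ‖η x‖ ^ 2 :=
    (continuous_wall_mul h 2 hψ.continuous hs).integrable_of_hasCompactSupport hc.mul_left
  refine hardy_of_identity h (ρ := fun x => (y - x 0)⁻¹)
    (T := fun x => fderiv ℝ (fun x => ‖η x‖ ^ 2) x (unitVec 0))
    (d := fun x => ‖fderiv ℝ η x (unitVec 0)‖) hI2 ?_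
    (fun x => norm_fderiv_norm_sq_le h.differentiable _ _) fun x => ?_
  · rw [integral_mul_fderiv_eq_neg_fderiv_mul_of_integrable]
    · simp_rw [hde]
    · simpa only [hde] using hI2
    · simpa using (continuous_wall_mul h 1 hcd hs').integrable_of_hasCompactSupport hcc.mul_left
    · simpa using (continuous_wall_mul h 1 hψ.continuous hs).integrable_of_hasCompactSupport
        hc.mul_left
    · exact fun x hx => (hd x (h.2.2 (hs hx))).differentiableAt
    · exact fun x _ => hψ.differentiable (by simp) x
  · exact Finset.single_le_sum (f := fun j => ‖fderiv ℝ η x (unitVec j)‖ ^ 2)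
      (fun j _ => sq_nonneg _) (Finset.mem_univ 0)

end Test

lemma integrable_mul_L2 {X : Type*} [MeasurableSpace X] {μ : Measure X} {f g : X → ℂ}
    (hf : MemLp f 2 μ) (hg : MemLp g 2 μ) : Integrable (fun x => f x * g x) μ :=
  hf.integrable_mul hg

lemma integral_eq_add {X F : Type*} [MeasurableSpace X] {μ : Measure X} [NormedAddCommGroup F]
    [NormedSpace ℝ F] {h f g : X → F} (hf : Integrable f μ) (hg : Integrable g μ)
    (he : ∀ x, h x = f x + g x) : ∫ x, h x ∂μ = ∫ x, f x ∂μ + ∫ x, g x ∂μ := by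
  simp_rw [he]
  exact integral_add hf hg

/-! ### Extension to `H¹₀` -/

section H10

variable {y : ℝ} {η v : E3 → ℂ} {G : Fin 3 → E3 → ℂ}

lemma IsTest.eLpNorm_weight_le (h : IsTest y η) {ρ : E3 → ℝ} (hm : Measurable ρ)
    (hi : Integrable fun x => ρ x ^ 2 * ‖η x‖ ^ 2)
    (hb : ∫ x, ρ x ^ 2 * ‖η x‖ ^ 2 ≤ 4 * ∫ x, ∑ j, ‖fderiv ℝ η x (unitVec j)‖ ^ 2) :
    eLpNorm (fun x => (ρ x : ℂ) * η x) 2 (atomMeasure y) ^ 2 ≤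
      4 * ∑ j, eLpNorm (fun x => fderiv ℝ η x (unitVec j)) 2 (atomMeasure y) ^ 2 := by
  have hρ : Measurable fun x => (ρ x : ℂ) := Complex.measurable_ofReal.comp hm
  have hmem : MemLp (fun x => (ρ x : ℂ) * η x) 2 volume := by
    have hmeas : AEStronglyMeasurable (fun x => (ρ x : ℂ) * η x) volume :=
      hρ.aestronglyMeasurable.mul h.continuous.aestronglyMeasurable
    rw [memLp_two_iff_integrable_sq_norm hmeas]
    refine hi.congr (Eventually.of_forall fun x => ?_)
    simp [mul_pow]
  rw [eLpNorm_two_sq_eq_ofReal (μ := atomMeasure y) (hmem.restrict _)]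
  simp_rw [fun j => eLpNorm_two_sq_eq_ofReal (h.memLp_deriv (unitVec j))]
  rw [← ENNReal.ofReal_sum_of_nonneg fun j _ => integral_nonneg fun x => sq_nonneg _]
  rw [show (4 : ENNReal) = ENNReal.ofReal 4 by norm_num, ← ENNReal.ofReal_mul (by norm_num)]
  refine ENNReal.ofReal_le_ofReal ?_
  rw [IsTest.setIntegral_eq fun x hx => by simp [h.eq_zero hx]]
  simp_rw [fun j => IsTest.setIntegral_eq (y := y)
    (g := fun x => ‖fderiv ℝ η x (unitVec j)‖ ^ 2) fun x hx => by simp [h.deriv_eq_zero hx]]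
  rw [← integral_finsetSum]
  · simpa [mul_pow] using hb
  · intro j _
    exact ((h.continuous_deriv _).memLp_of_hasCompactSupport
      (h.support_deriv _)).integrable_norm_pow (p := 2) two_ne_zero

/-- A weighted bound by the gradient passes from test functions to `H¹₀`. -/
lemma IsH10.eLpNorm_weight_le (h : IsH10 y v G) {ρ : E3 → ℝ} (hm : Measurable ρ)
    (hb : ∀ η, IsTest y η → eLpNorm (fun x => (ρ x : ℂ) * η x) 2 (atomMeasure y) ^ 2 ≤
      4 * ∑ j, eLpNorm (fun x => fderiv ℝ η x (unitVec j)) 2 (atomMeasure y) ^ 2) :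
    eLpNorm (fun x => (ρ x : ℂ) * v x) 2 (atomMeasure y) ^ 2 ≤
      4 * ∑ j, eLpNorm (G j) 2 (atomMeasure y) ^ 2 := by
  obtain ⟨hv, hG, η, hη, hlim, hlimG⟩ := h
  have hm' : AEStronglyMeasurable (fun x => (ρ x : ℂ)) (atomMeasure y) :=
    (Complex.measurable_ofReal.comp hm).aestronglyMeasurable
  have h1 : TendstoInMeasure (atomMeasure y) η atTop v := by
    refine tendstoInMeasure_of_tendsto_eLpNorm two_ne_zero
      (fun n => (hη n).memLp.aestronglyMeasurable) hv.aestronglyMeasurable ?_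
    refine hlim.congr fun n => ?_
    rw [← eLpNorm_neg]
    congr 1; ext x; simp
  -- Fatou along an almost everywhere convergent subsequence; the weight is unbounded, so
  -- convergence of the weighted norms is not available.
  obtain ⟨ns, hns, hae⟩ := h1.exists_seq_tendsto_ae
  have h2 : eLpNorm (fun x => (ρ x : ℂ) * v x) 2 (atomMeasure y) ≤
      atTop.liminf fun n => eLpNorm (fun x => (ρ x : ℂ) * η (ns n) x) 2 (atomMeasure y) := by
    refine Lp.eLpNorm_lim_le_liminf_eLpNorm
      (fun n => hm'.mul (hη _).memLp.aestronglyMeasurable) _ ?_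
    filter_upwards [hae] with x hx using hx.const_mul _
  have h3 : Tendsto (fun n => 4 * ∑ j, (eLpNorm (G j) 2 (atomMeasure y) +
      eLpNorm (fun x => G j x - fderiv ℝ (η (ns n)) x (unitVec j)) 2 (atomMeasure y)) ^ 2) atTop
      (𝓝 (4 * ∑ j, eLpNorm (G j) 2 (atomMeasure y) ^ 2)) := by
    refine ENNReal.Tendsto.const_mul (tendsto_finsetSum _ fun j _ => ?_) (Or.inr (by norm_num))
    have := tendsto_const_nhds (x := eLpNorm (G j) 2 (atomMeasure y)) |>.add
      ((hlimG j).comp hns.tendsto_atTop)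
    rw [add_zero] at this
    exact ENNReal.Tendsto.pow this
  have h4 : ∀ n, eLpNorm (fun x => (ρ x : ℂ) * η (ns n) x) 2 (atomMeasure y) ^ 2 ≤
      4 * ∑ j, (eLpNorm (G j) 2 (atomMeasure y) +
      eLpNorm (fun x => G j x - fderiv ℝ (η (ns n)) x (unitVec j)) 2 (atomMeasure y)) ^ 2 := by
    intro n
    refine (hb _ (hη _)).trans ?_
    gcongr with j
    have := eLpNorm_sub_le (p := 2) (hG j).aestronglyMeasurable
      ((hG j).sub ((hη (ns n)).memLp_deriv (unitVec j))).aestronglyMeasurable one_le_two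
    refine le_trans (le_of_eq ?_) this
    congr 1; ext x; simp
  -- The gradient norms of the approximations are eventually below any `c` larger than their limit.
  have h5 : ∀ c : ENNReal, 4 * ∑ j, eLpNorm (G j) 2 (atomMeasure y) ^ 2 < c →
      eLpNorm (fun x => (ρ x : ℂ) * v x) 2 (atomMeasure y) ^ 2 ≤ c := by
    intro c hc
    have h6 := h3.eventually (gt_mem_nhds hc)
    have h7 : eLpNorm (fun x => (ρ x : ℂ) * v x) 2 (atomMeasure y) ≤ c ^ (1 / 2 : ℝ) := by
      refine h2.trans (liminf_le_of_frequently_le' (h6.frequently.mono fun n hn => ?_))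
      rw [one_div, ENNReal.le_rpow_inv_iff two_pos]
      simpa using (h4 n).trans hn.le
    rw [one_div, ENNReal.le_rpow_inv_iff two_pos] at h7
    simpa using h7
  exact le_of_forall_gt_imp_ge_of_dense h5

/-- The Hardy inequality. -/
lemma IsH10.hardy (h : IsH10 y v G) :
    eLpNorm (fun x => ((‖x‖⁻¹ : ℝ) : ℂ) * v x) 2 (atomMeasure y) ^ 2 ≤
      4 * ∑ j, eLpNorm (G j) 2 (atomMeasure y) ^ 2 := by
  refine h.eLpNorm_weight_le (ρ := fun x => ‖x‖⁻¹) measurable_norm.inv fun η hη => ?_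
  refine hη.eLpNorm_weight_le (ρ := fun x => ‖x‖⁻¹) measurable_norm.inv ?_ hη.hardy
  simpa using integrable_div_norm_sq (contDiff_norm_sq hη).continuous (hasCompactSupport_norm_sq hη)

/-- The Hardy inequality for the distance to the wall. -/
lemma IsH10.hardy_wall (h : IsH10 y v G) :
    eLpNorm (fun x => (((y - x 0)⁻¹ : ℝ) : ℂ) * v x) 2 (atomMeasure y) ^ 2 ≤
      4 * ∑ j, eLpNorm (G j) 2 (atomMeasure y) ^ 2 := by
  have hm : Measurable fun x : E3 => (y - x 0)⁻¹ := (measurable_const.sub (measurable_coord 0)).inv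
  refine h.eLpNorm_weight_le (ρ := fun x => (y - x 0)⁻¹) hm fun η hη => ?_
  refine hη.eLpNorm_weight_le (ρ := fun x => (y - x 0)⁻¹) hm ?_ hη.hardy_wall
  have hs : tsupport (fun x => ‖η x‖ ^ 2) ⊆ tsupport η := by
    refine closure_mono fun x hx hx' => hx ?_
    simp [hx']
  exact (continuous_wall_mul hη 2 (contDiff_norm_sq hη).continuous hs).integrable_of_hasCompactSupport
    (hasCompactSupport_norm_sq hη).mul_left

lemma memLp_of_weight_le {ρ : E3 → ℝ} (hm : Measurable ρ) (hv : MemLp v 2 (atomMeasure y))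
    (hG : ∀ j, MemLp (G j) 2 (atomMeasure y))
    (h : eLpNorm (fun x => (ρ x : ℂ) * v x) 2 (atomMeasure y) ^ 2 ≤
      4 * ∑ j, eLpNorm (G j) 2 (atomMeasure y) ^ 2) :
    MemLp (fun x => (ρ x : ℂ) * v x) 2 (atomMeasure y) := by
  refine ⟨(Complex.measurable_ofReal.comp hm).aestronglyMeasurable.mul hv.aestronglyMeasurable, ?_⟩
  have h1 : 4 * ∑ j, eLpNorm (G j) 2 (atomMeasure y) ^ 2 < ⊤ :=
    ENNReal.mul_lt_top (by norm_num)
      (ENNReal.sum_lt_top.2 fun j _ => ENNReal.pow_lt_top (hG j).eLpNorm_lt_top)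
  by_contra h2
  rw [not_lt, top_le_iff] at h2
  rw [h2] at h
  simp only [ne_eq, OfNat.ofNat_ne_zero, not_false_eq_true, ENNReal.top_pow, top_le_iff] at h
  exact h1.ne h

lemma IsH10.memLp_div_norm (h : IsH10 y v G) :
    MemLp (fun x => ((‖x‖⁻¹ : ℝ) : ℂ) * v x) 2 (atomMeasure y) :=
  memLp_of_weight_le (ρ := fun x => ‖x‖⁻¹) measurable_norm.inv h.1 h.2.1 h.hardy

lemma IsTest.isH10 (h : IsTest y η) : IsH10 y η fun j x => fderiv ℝ η x (unitVec j) :=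
  ⟨h.memLp, fun _ => h.memLp_deriv _, fun _ => η, fun _ => h, by simp, by simp⟩

lemma IsTest.memLp_div_norm (h : IsTest y η) :
    MemLp (fun x => ((‖x‖⁻¹ : ℝ) : ℂ) * η x) 2 (atomMeasure y) :=
  h.isH10.memLp_div_norm

/-- Integration by parts. -/
lemma IsTest.integral_mul_deriv {ζ : E3 → ℂ} (h : IsTest y η) (h' : IsTest y ζ) (w : E3) :
    ∫ x, η x * fderiv ℝ ζ x w ∂atomMeasure y = -∫ x, fderiv ℝ η x w * ζ x ∂atomMeasure y := by
  rw [IsTest.setIntegral_eq fun x hx => by simp [h.eq_zero hx],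
    IsTest.setIntegral_eq fun x hx => by simp [h'.eq_zero hx]]
  refine integral_mul_fderiv_eq_neg_fderiv_mul_of_integrable ?_ ?_ ?_
    (fun x _ => h.differentiable x) fun x _ => h'.differentiable x
  · exact ((h.continuous_deriv w).mul h'.continuous).integrable_of_hasCompactSupport
      h'.2.1.mul_left
  · exact (h.continuous.mul (h'.continuous_deriv w)).integrable_of_hasCompactSupport
      h.2.1.mul_right
  · exact (h.continuous.mul h'.continuous).integrable_of_hasCompactSupport h.2.1.mul_right

lemma IsH10.integral_test_mul (h : IsH10 y v G) (hη : IsTest y η) (j : Fin 3) :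
    ∫ x, η x * G j x ∂atomMeasure y = -∫ x, fderiv ℝ η x (unitVec j) * v x ∂atomMeasure y := by
  obtain ⟨hv, hG, w, hw, hlim, hlimG⟩ := h
  have h1 := tendsto_integral_mul_L2 hη.memLp (hG j) (fun n => (hw n).memLp_deriv (unitVec j))
    (hlimG j)
  have h2 := (tendsto_integral_mul_L2 (hη.memLp_deriv (unitVec j)) hv (fun n => (hw n).memLp)
    hlim).neg
  refine tendsto_nhds_unique h1 (h2.congr fun n => ?_)
  rw [hη.integral_mul_deriv (hw n)]

/-- The limit is taken in one factor at a time: `IsH10.integral_test_mul` has already replaced one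
test function, and here the other is replaced. -/
lemma IsH10.integral_mul {f : E3 → ℂ} {K : Fin 3 → E3 → ℂ} (hf : IsH10 y f K) (h : IsH10 y v G)
    (j : Fin 3) : ∫ x, f x * G j x ∂atomMeasure y = -∫ x, K j x * v x ∂atomMeasure y := by
  obtain ⟨hf, hK, w, hw, hlim, hlimG⟩ := hf
  have h1 := tendsto_integral_mul_L2 (h.2.1 j) hf (fun n => (hw n).memLp) hlim
  have h2 := (tendsto_integral_mul_L2 h.1 (hK j) (fun n => (hw n).memLp_deriv (unitVec j))
    (hlimG j)).neg
  simp_rw [fun x => mul_comm (f x) (G j x), fun x => mul_comm (K j x) (v x)]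
  refine tendsto_nhds_unique h1 (h2.congr fun n => ?_)
  simp_rw [fun x => mul_comm (G j x) (w n x), fun x => mul_comm (v x)]
  rw [h.integral_test_mul (hw n)]

lemma IsH10.radial_identity (h : IsH10 y v G) (hη : IsTest y η) :
    ∑ j, ∫ x, ((x j / ‖x‖ : ℝ) : ℂ) *
      (fderiv ℝ η x (unitVec j) * v x + η x * G j x) ∂atomMeasure y
      = -2 * ∫ x, ((‖x‖⁻¹ : ℝ) : ℂ) * η x * v x ∂atomMeasure y := by
  obtain ⟨hv, hG, w, hw, hlim, hlimG⟩ := h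
  have hb : ∀ j, MemLp (fun x => ((x j / ‖x‖ : ℝ) : ℂ) * η x) 2 (atomMeasure y) := fun j => by
    simpa using memLp_direction_mul 1 hη.memLp j
  have hb' : ∀ j, MemLp (fun x => ((x j / ‖x‖ : ℝ) : ℂ) * fderiv ℝ η x (unitVec j)) 2
      (atomMeasure y) := fun j => by
    simpa using memLp_direction_mul 1 (hη.memLp_deriv (unitVec j)) j
  have e : ∀ (v : E3 → ℂ) (G : Fin 3 → E3 → ℂ), MemLp v 2 (atomMeasure y) →
      (∀ j, MemLp (G j) 2 (atomMeasure y)) → ∀ j, ∫ x, ((x j / ‖x‖ : ℝ) : ℂ) *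
      (fderiv ℝ η x (unitVec j) * v x + η x * G j x) ∂atomMeasure y =
      ∫ x, (((x j / ‖x‖ : ℝ) : ℂ) * fderiv ℝ η x (unitVec j)) * v x ∂atomMeasure y +
      ∫ x, (((x j / ‖x‖ : ℝ) : ℂ) * η x) * G j x ∂atomMeasure y := by
    intro v G hv hG j
    exact integral_eq_add (integrable_mul_L2 (hb' j) hv) (integrable_mul_L2 (hb j) (hG j))
      fun x => by ring
  have h1 : Tendsto (fun n => ∑ j, ∫ x, ((x j / ‖x‖ : ℝ) : ℂ) *
      (fderiv ℝ η x (unitVec j) * w n x + η x * fderiv ℝ (w n) x (unitVec j)) ∂atomMeasure y) atTop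
      (𝓝 (∑ j, ∫ x, ((x j / ‖x‖ : ℝ) : ℂ) *
      (fderiv ℝ η x (unitVec j) * v x + η x * G j x) ∂atomMeasure y)) := by
    refine tendsto_finsetSum _ fun j _ => ?_
    rw [e v G hv hG j]
    simp_rw [fun n => e (w n) (fun j x => fderiv ℝ (w n) x (unitVec j)) (hw n).memLp
      (fun j => (hw n).memLp_deriv _) j]
    exact (tendsto_integral_mul_L2 (hb' j) hv (fun n => (hw n).memLp) hlim).add
      (tendsto_integral_mul_L2 (hb j) (hG j) (fun n => (hw n).memLp_deriv _) (hlimG j))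
  have h2 := (tendsto_integral_mul_L2 hη.memLp_div_norm hv (fun n => (hw n).memLp) hlim).const_mul
    (-2 : ℂ)
  refine tendsto_nhds_unique h1 (h2.congr fun n => ?_)
  rw [hη.radial_identity (hw n)]

/-- The drift `(α/2) xⱼ/|x|` by which the gradient is conjugated with the ground state. -/
def drift (α : ℝ) (j : Fin 3) (x : E3) : ℂ := ((α / 2 * (x j / ‖x‖) : ℝ) : ℂ)

lemma memLp_drift_mul (α : ℝ) {v : E3 → ℂ} {μ : Measure E3} (hv : MemLp v 2 μ) (j : Fin 3) :
    MemLp (fun x => drift α j x * v x) 2 μ := memLp_direction_mul (α / 2) hv j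

/-- The factorization `h_α - e_α = D* D` with `D = ∇ + (α/2) x/|x|`. -/
lemma IsH10.twisted_form (h : IsH10 y v G) (hη : IsTest y η) (α : ℝ) :
    ∑ j, ∫ x, (fderiv ℝ η x (unitVec j) + drift α j x * η x) * (G j x + drift α j x * v x)
      ∂atomMeasure y =
    ∑ j, ∫ x, fderiv ℝ η x (unitVec j) * G j x ∂atomMeasure y
      - α * ∫ x, ((‖x‖⁻¹ : ℝ) : ℂ) * η x * v x ∂atomMeasure y
      + (α ^ 2 / 4 : ℝ) * ∫ x, η x * v x ∂atomMeasure y := by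
  have i1 : ∀ j, Integrable (fun x => fderiv ℝ η x (unitVec j) * G j x) (atomMeasure y) := fun j =>
    (hη.memLp_deriv _).integrable_mul (h.2.1 j)
  have i2 : ∀ j, Integrable (fun x => ((x j / ‖x‖ : ℝ) : ℂ) *
      (fderiv ℝ η x (unitVec j) * v x + η x * G j x)) (atomMeasure y) := fun j => by
    have a1 := (memLp_direction_mul 1 (hη.memLp_deriv (unitVec j)) j).integrable_mul h.1
    have a2 := (memLp_direction_mul 1 hη.memLp j).integrable_mul (h.2.1 j)
    refine (a1.add a2).congr (Eventually.of_forall fun x => ?_)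
    simp only [Pi.add_apply, Pi.mul_apply, one_mul]
    ring
  have i3 : ∀ j, Integrable (fun x => drift α j x * η x * (drift α j x * v x))
      (atomMeasure y) := fun j =>
    (memLp_drift_mul α hη.memLp j).integrable_mul (memLp_drift_mul α h.1 j)
  have e1 : ∀ j, ∫ x, (fderiv ℝ η x (unitVec j) + drift α j x * η x) *
      (G j x + drift α j x * v x) ∂atomMeasure y =
      ∫ x, fderiv ℝ η x (unitVec j) * G j x ∂atomMeasure y + (α / 2 : ℝ) *
      ∫ x, ((x j / ‖x‖ : ℝ) : ℂ) *
      (fderiv ℝ η x (unitVec j) * v x + η x * G j x) ∂atomMeasure y +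
      ∫ x, drift α j x * η x * (drift α j x * v x) ∂atomMeasure y := by
    intro j
    rw [← integral_const_mul, ← integral_eq_add (i1 j) ((i2 j).const_mul _) fun x => rfl]
    refine integral_eq_add ((i1 j).add ((i2 j).const_mul _)) (i3 j) fun x => ?_
    simp only [drift, Complex.ofReal_mul]
    ring
  -- The drift has constant length `α/2` off the origin, so its square contributes exactly `-e_α`.
  have e2 : ∑ j, ∫ x, drift α j x * η x * (drift α j x * v x) ∂atomMeasure y =
      (α ^ 2 / 4 : ℝ) * ∫ x, η x * v x ∂atomMeasure y := by
    rw [← integral_finsetSum _ fun j _ => i3 j, ← integral_const_mul]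
    refine integral_congr_ae ((ae_atomMeasure_ne_zero y).mono fun x hx => ?_)
    have h1 : ∑ j, ((x j / ‖x‖ : ℝ) : ℂ) ^ 2 = 1 := by
      exact_mod_cast sum_direction_sq hx
    calc ∑ j, drift α j x * η x * (drift α j x * v x)
        = ((α / 2 : ℝ) : ℂ) ^ 2 * (η x * v x) * ∑ j, ((x j / ‖x‖ : ℝ) : ℂ) ^ 2 := by
          rw [Finset.mul_sum]
          refine Finset.sum_congr rfl fun j _ => ?_
          simp only [drift, Complex.ofReal_mul]
          ring
      _ = _ := by rw [h1]; push_cast; ring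
  simp_rw [e1]
  -- The cross terms carry `α/2` and the radial identity `-2`, which makes the Coulomb term
  -- `-α/|x|`.
  rw [Finset.sum_add_distrib, Finset.sum_add_distrib, ← Finset.mul_sum, h.radial_identity hη, e2]
  push_cast
  ring

end H10

/-! ### The hydrogen ground state -/

section Ground

/-- A smooth approximation of the ground state; `ε = 0` is the ground state itself. -/
def smoothGround (α ε : ℝ) (x : E3) : ℝ :=
  α ^ (3 / 2 : ℝ) / Real.sqrt (8 * Real.pi) * Real.exp (-(α * Real.sqrt (‖x‖ ^ 2 + ε ^ 2) / 2))

lemma smoothGround_zero (α : ℝ) : smoothGround α 0 = groundState α := by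
  ext x
  simp [smoothGround, groundState]

lemma hasFDerivAt_smoothGround (α ε : ℝ) {x : E3} (h : ‖x‖ ^ 2 + ε ^ 2 ≠ 0) :
    HasFDerivAt (smoothGround α ε)
      ((-(α / 2 * smoothGround α ε x / Real.sqrt (‖x‖ ^ 2 + ε ^ 2))) • innerSL ℝ x) x := by
  have h1 : HasFDerivAt (fun x : E3 => ‖x‖ ^ 2 + ε ^ 2) (2 • innerSL ℝ x) x :=
    (hasStrictFDerivAt_norm_sq x).hasFDerivAt.add_const _
  have h2 := (((h1.sqrt h).const_mul (α / 2)).neg.exp).const_mul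
    (α ^ (3 / 2 : ℝ) / Real.sqrt (8 * Real.pi))
  have h3 : (fun x : E3 => α ^ (3 / 2 : ℝ) / Real.sqrt (8 * Real.pi) *
      Real.exp (-(α / 2 * Real.sqrt (‖x‖ ^ 2 + ε ^ 2)))) = smoothGround α ε := by
    ext x
    simp only [smoothGround]
    congr 3
    ring
  have h4 : HasFDerivAt (smoothGround α ε) _ x := h3 ▸ h2
  refine h4.congr_fderiv ?_
  ext w
  have h5 : smoothGround α ε x = α ^ (3 / 2 : ℝ) / Real.sqrt (8 * Real.pi) *
      Real.exp (-(α / 2 * Real.sqrt (‖x‖ ^ 2 + ε ^ 2))) := by rw [← h3]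
  simp only [smul_apply, neg_apply, innerSL_apply_apply, smul_eq_mul, nsmul_eq_mul, h5, Pi.neg_apply]
  push_cast
  ring

lemma fderiv_smoothGround (α ε : ℝ) {x : E3} (h : ‖x‖ ^ 2 + ε ^ 2 ≠ 0) (j : Fin 3) :
    fderiv ℝ (smoothGround α ε) x (unitVec j) =
      -(α / 2 * (x j / Real.sqrt (‖x‖ ^ 2 + ε ^ 2))) * smoothGround α ε x := by
  rw [(hasFDerivAt_smoothGround α ε h).fderiv]
  simp only [smul_apply, innerSL_apply_apply, smul_eq_mul, unitVec]
  rw [EuclideanSpace.inner_single_right]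
  simp
  ring

lemma fderiv_groundState (α : ℝ) {x : E3} (hx : x ≠ 0) (j : Fin 3) :
    fderiv ℝ (groundState α) x (unitVec j) = -(α / 2 * (x j / ‖x‖)) * groundState α x := by
  have h : ‖x‖ ^ 2 + (0 : ℝ) ^ 2 ≠ 0 := by
    have := norm_ne_zero_iff.2 hx
    positivity
  rw [← smoothGround_zero, fderiv_smoothGround α 0 h]
  simp

lemma contDiff_smoothGround (α : ℝ) {ε : ℝ} (hε : ε ≠ 0) : ContDiff ℝ ∞ (smoothGround α ε) := by
  unfold smoothGround
  refine contDiff_const.mul (Real.contDiff_exp.comp ?_)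
  refine ((contDiff_const.mul (ContDiff.sqrt ?_ ?_)).div_const 2).neg
  · exact (_root_.contDiff_norm_sq ℝ).add contDiff_const
  · intro x
    positivity

lemma groundState_nonneg {α : ℝ} (hα : 0 ≤ α) (x : E3) : 0 ≤ groundState α x := by
  unfold groundState; positivity

lemma smoothGround_nonneg {α : ℝ} (hα : 0 ≤ α) (ε : ℝ) (x : E3) : 0 ≤ smoothGround α ε x := by
  unfold smoothGround; positivity

lemma norm_le_sqrt (x : E3) (ε : ℝ) : ‖x‖ ≤ Real.sqrt (‖x‖ ^ 2 + ε ^ 2) :=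
  Real.le_sqrt_of_sq_le (by nlinarith [sq_nonneg ε])

lemma smoothGround_le {α : ℝ} (hα : 0 ≤ α) (ε : ℝ) (x : E3) :
    smoothGround α ε x ≤ groundState α x := by
  unfold smoothGround groundState
  gcongr
  exact norm_le_sqrt x ε

lemma continuous_groundState (α : ℝ) : Continuous (groundState α) := by
  unfold groundState
  fun_prop

lemma continuous_smoothGround (α ε : ℝ) : Continuous (smoothGround α ε) := by
  unfold smoothGround
  fun_prop

lemma tendsto_smoothGround (α : ℝ) {ε : ℕ → ℝ} (hε : Tendsto ε atTop (𝓝 0)) (x : E3) :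
    Tendsto (fun n => smoothGround α (ε n) x) atTop (𝓝 (groundState α x)) := by
  have h : Continuous fun ε => smoothGround α ε x := by
    unfold smoothGround
    fun_prop
  rw [← smoothGround_zero]
  exact (h.tendsto 0).comp hε

lemma tendsto_fderiv_smoothGround (α : ℝ) {ε : ℕ → ℝ} (hε : Tendsto ε atTop (𝓝 0)) {x : E3}
    (hx : x ≠ 0) (j : Fin 3) :
    Tendsto (fun n => fderiv ℝ (smoothGround α (ε n)) x (unitVec j)) atTop
      (𝓝 (fderiv ℝ (groundState α) x (unitVec j))) := by
  have hx' : 0 < ‖x‖ := norm_pos_iff.2 hx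
  have h : ∀ ε : ℝ, ‖x‖ ^ 2 + ε ^ 2 ≠ 0 := fun ε => by positivity
  rw [← smoothGround_zero]
  simp_rw [fderiv_smoothGround α _ (h _)]
  have hc : ContinuousAt (fun ε : ℝ => -(α / 2 * (x j / Real.sqrt (‖x‖ ^ 2 + ε ^ 2))) *
      smoothGround α ε x) 0 := by
    have h1 : ContinuousAt (fun ε : ℝ => smoothGround α ε x) 0 := by
      unfold smoothGround
      fun_prop
    have h2 : ContinuousAt (fun ε : ℝ => Real.sqrt (‖x‖ ^ 2 + ε ^ 2)) 0 := by fun_prop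
    exact (((continuousAt_const.div h2 (Real.sqrt_ne_zero'.2 (by positivity))).const_mul
      (α / 2)).neg).mul h1
  exact hc.tendsto.comp hε

lemma abs_fderiv_smoothGround_le {α : ℝ} (hα : 0 ≤ α) (ε : ℝ) {x : E3} (h : ‖x‖ ^ 2 + ε ^ 2 ≠ 0)
    (j : Fin 3) : |fderiv ℝ (smoothGround α ε) x (unitVec j)| ≤ α / 2 * groundState α x := by
  rw [fderiv_smoothGround α ε h, abs_mul, abs_neg, abs_mul, abs_of_nonneg (smoothGround_nonneg hα ε x),
    abs_of_nonneg (by positivity : 0 ≤ α / 2)]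
  have h1 : |x j / Real.sqrt (‖x‖ ^ 2 + ε ^ 2)| ≤ 1 := by
    rw [abs_div, abs_of_nonneg (Real.sqrt_nonneg _)]
    exact div_le_one_of_le₀ ((abs_coord_le x j).trans (norm_le_sqrt x ε)) (Real.sqrt_nonneg _)
  have := smoothGround_le hα ε x
  have h0 := smoothGround_nonneg hα ε x
  calc α / 2 * |x j / Real.sqrt (‖x‖ ^ 2 + ε ^ 2)| * smoothGround α ε x
      ≤ α / 2 * 1 * groundState α x := by gcongr
    _ = _ := by ring

lemma abs_fderiv_groundState_le {α : ℝ} (hα : 0 ≤ α) {x : E3} (hx : x ≠ 0)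
    (j : Fin 3) : |fderiv ℝ (groundState α) x (unitVec j)| ≤ α / 2 * groundState α x := by
  have h : ‖x‖ ^ 2 + (0 : ℝ) ^ 2 ≠ 0 := by
    have := norm_ne_zero_iff.2 hx
    positivity
  have := abs_fderiv_smoothGround_le hα 0 h j
  rwa [smoothGround_zero] at this

/-- Moments of the ground state density. -/
lemma integrable_moment {α : ℝ} (hα : 0 < α) (n : ℕ) :
    Integrable (fun x : E3 => ‖x‖ ^ n * groundState α x ^ 2) := by
  have h := (integrable_radial_iff (fun r => r ^ n *
    (α ^ (3 / 2 : ℝ) / Real.sqrt (8 * Real.pi) * Real.exp (-(α * r / 2))) ^ 2)).2 ?_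
  · exact h
  have h1 : IntegrableOn (fun r : ℝ => r ^ ((n : ℝ) + 2) * Real.exp (-α * r)) (Ioi 0) := by
    have := integrableOn_rpow_mul_exp_neg_mul_rpow (p := 1) (s := (n : ℝ) + 2) (b := α)
      (by have : (0 : ℝ) ≤ n := n.cast_nonneg; linarith) one_pos hα
    simpa using this
  refine IntegrableOn.congr_fun (h1.const_mul ((α ^ (3 / 2 : ℝ) / Real.sqrt (8 * Real.pi)) ^ 2))
    (fun r hr => ?_) measurableSet_Ioi
  have hr0 : (0 : ℝ) < r := hr
  have e1 : Real.exp (-(α * r / 2)) ^ 2 = Real.exp (-α * r) := by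
    rw [← Real.exp_nat_mul]
    congr 1
    push_cast
    ring
  rw [mul_pow, e1, show (n : ℝ) + 2 = ((n + 2 : ℕ) : ℝ) by push_cast; ring, Real.rpow_natCast]
  ring

/-- Polar coordinates and `Γ(n + 3) = (n + 2)!`. The values `1`, `12/α²`, `360/α⁴`, `2520/α⁵` for `n
= 0, 2, 4, 5` determine the numerical constants further on. -/
lemma integral_moment {α : ℝ} (hα : 0 < α) (n : ℕ) :
    ∫ x : E3, ‖x‖ ^ n * groundState α x ^ 2 = (n + 2).factorial / 2 / α ^ n := by
  have h := integral_radial (fun r => r ^ n *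
    (α ^ (3 / 2 : ℝ) / Real.sqrt (8 * Real.pi) * Real.exp (-(α * r / 2))) ^ 2)
  have e0 : (fun x : E3 => ‖x‖ ^ n * groundState α x ^ 2) = fun x => ‖x‖ ^ n *
    (α ^ (3 / 2 : ℝ) / Real.sqrt (8 * Real.pi) * Real.exp (-(α * ‖x‖ / 2))) ^ 2 := rfl
  rw [e0, h]
  have e1 : ∫ r in Ioi (0 : ℝ), r ^ 2 * (r ^ n *
      (α ^ (3 / 2 : ℝ) / Real.sqrt (8 * Real.pi) * Real.exp (-(α * r / 2))) ^ 2) =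
      (α ^ 3 / (8 * Real.pi)) * ∫ r in Ioi (0 : ℝ), r ^ (((n + 3 : ℕ) : ℝ) - 1) *
        Real.exp (-(α * r)) := by
    rw [← integral_const_mul]
    refine setIntegral_congr_fun measurableSet_Ioi fun r hr => ?_
    have hr0 : (0 : ℝ) < r := hr
    have e1 : Real.exp (-(α * r / 2)) ^ 2 = Real.exp (-(α * r)) := by
      rw [← Real.exp_nat_mul]
      congr 1
      push_cast
      ring
    have e2 : (α ^ (3 / 2 : ℝ)) ^ 2 = α ^ 3 := by
      rw [← Real.rpow_natCast, ← Real.rpow_mul hα.le]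
      norm_num
    rw [mul_pow, div_pow, e1, e2, Real.sq_sqrt (by positivity),
      show (((n + 3 : ℕ) : ℝ) - 1) = ((n + 2 : ℕ) : ℝ) by push_cast; ring, Real.rpow_natCast]
    ring
  rw [e1, Real.integral_rpow_mul_exp_neg_mul_Ioi (by positivity) hα,
    show ((n + 3 : ℕ) : ℝ) = ((n + 2 : ℕ) : ℝ) + 1 by push_cast; ring, Real.Gamma_nat_eq_factorial]
  rw [show ((n + 2 : ℕ) : ℝ) + 1 = ((n + 3 : ℕ) : ℝ) by push_cast; ring, Real.rpow_natCast]
  have : Real.pi ≠ 0 := Real.pi_ne_zero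
  have hα' := hα.ne'
  rw [one_div, inv_pow]
  field_simp
  ring

lemma integral_groundState_sq {α : ℝ} (hα : 0 < α) : ∫ x : E3, groundState α x ^ 2 = 1 := by
  have := integral_moment hα 0
  simpa [Nat.factorial] using this

lemma memLp_groundState {α : ℝ} (hα : 0 < α) (μ : Measure E3) (hμ : μ ≤ volume) :
    MemLp (fun x => (groundState α x : ℂ)) 2 μ := by
  have hm : AEStronglyMeasurable (fun x => (groundState α x : ℂ)) volume :=
    (Complex.continuous_ofReal.comp (continuous_groundState α)).aestronglyMeasurable
  refine MemLp.mono_measure hμ ((memLp_two_iff_integrable_sq_norm hm).2 ?_)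
  simpa using integrable_moment hα 0

lemma measurable_fderiv_groundState (α : ℝ) (j : Fin 3) :
    Measurable fun x => fderiv ℝ (groundState α) x (unitVec j) :=
  measurable_fderiv_apply_const ℝ _ _

lemma memLp_fderiv_groundState {α : ℝ} (hα : 0 < α) {μ : Measure E3} (hμ : μ ≤ volume)
    (j : Fin 3) : MemLp (fun x => (fderiv ℝ (groundState α) x (unitVec j) : ℂ)) 2 μ := by
  refine MemLp.of_le_mul (c := α / 2) (memLp_groundState hα μ hμ)
    (Complex.measurable_ofReal.comp (measurable_fderiv_groundState α j)).aestronglyMeasurable ?_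
  have : ∀ᵐ x ∂μ, x ≠ 0 := (Measure.absolutelyContinuous_of_le hμ).ae_le ae_ne_zero
  filter_upwards [this] with x hx
  rw [Complex.norm_real, Complex.norm_real, Real.norm_eq_abs, Real.norm_eq_abs,
    abs_of_nonneg (groundState_nonneg hα.le x)]
  exact abs_fderiv_groundState_le hα.le hx j

lemma atomMeasure_le (y : ℝ) : atomMeasure y ≤ volume := Measure.restrict_le_self

/-- Integration by parts against the ground state. -/
lemma IsTest.integral_groundState_mul {α y : ℝ} (hα : 0 < α) {η : E3 → ℂ} (h : IsTest y η) (j : Fin 3) :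
    ∫ x, (groundState α x : ℂ) * fderiv ℝ η x (unitVec j) ∂atomMeasure y =
      -∫ x, (fderiv ℝ (groundState α) x (unitVec j) : ℂ) * η x ∂atomMeasure y := by
  rw [IsTest.setIntegral_eq fun x hx => by simp [h.deriv_eq_zero hx],
    IsTest.setIntegral_eq fun x hx => by simp [h.eq_zero hx]]
  -- The ground state has a cusp at the origin, so the integration by parts is done for its smooth
  -- approximations; they and their derivatives are dominated by `u_α` and `(α/2) u_α`.
  let ε : ℕ → ℝ := fun n => 1 / ((n : ℝ) + 1)
  have hε : Tendsto ε atTop (𝓝 0) := tendsto_one_div_add_atTop_nhds_zero_nat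
  have hε0 : ∀ n, ε n ≠ 0 := fun n => (Nat.one_div_pos_of_nat).ne'
  have hcg : Continuous fun x => (groundState α x : ℂ) :=
    Complex.continuous_ofReal.comp (continuous_groundState α)
  have hd : ∀ n x, HasFDerivAt (fun x => (smoothGround α (ε n) x : ℂ))
      (Complex.ofRealCLM.comp (fderiv ℝ (smoothGround α (ε n)) x)) x := fun n x =>
    Complex.ofRealCLM.hasFDerivAt.comp x
      (((contDiff_smoothGround α (hε0 n)).differentiable (by simp)) x).hasFDerivAt
  have hcd : ∀ n, Continuous fun x => (fderiv ℝ (smoothGround α (ε n)) x (unitVec j) : ℂ) :=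
    fun n => Complex.continuous_ofReal.comp
      (((contDiff_smoothGround α (hε0 n)).continuous_fderiv (by simp)).clm_apply continuous_const)
  have hcs : ∀ n, Continuous fun x => (smoothGround α (ε n) x : ℂ) := fun n =>
    Complex.continuous_ofReal.comp (continuous_smoothGround α _)
  have h1 : ∀ n, ∫ x, (smoothGround α (ε n) x : ℂ) * fderiv ℝ η x (unitVec j) =
      -∫ x, (fderiv ℝ (smoothGround α (ε n)) x (unitVec j) : ℂ) * η x := by
    intro n
    have e : ∀ x, fderiv ℝ (fun x => (smoothGround α (ε n) x : ℂ)) x (unitVec j) =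
        (fderiv ℝ (smoothGround α (ε n)) x (unitVec j) : ℂ) := fun x => by
      rw [(hd n x).fderiv]; rfl
    rw [integral_mul_fderiv_eq_neg_fderiv_mul_of_integrable]
    · simp_rw [e]
    · simp_rw [e]
      exact ((hcd n).mul h.continuous).integrable_of_hasCompactSupport h.2.1.mul_left
    · exact ((hcs n).mul (h.continuous_deriv _)).integrable_of_hasCompactSupport
        (h.support_deriv _).mul_left
    · exact ((hcs n).mul h.continuous).integrable_of_hasCompactSupport h.2.1.mul_left
    · exact fun x _ => (hd n x).differentiableAt
    · exact fun x _ => h.differentiable x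
  have h2 : Tendsto (fun n => ∫ x, (smoothGround α (ε n) x : ℂ) * fderiv ℝ η x (unitVec j)) atTop
      (𝓝 (∫ x, (groundState α x : ℂ) * fderiv ℝ η x (unitVec j))) := by
    refine tendsto_integral_of_dominated_convergence
      (fun x => groundState α x * ‖fderiv ℝ η x (unitVec j)‖)
      (fun n => ((hcs n).mul (h.continuous_deriv _)).aestronglyMeasurable) ?_ (fun n => ?_) ?_
    · exact ((continuous_groundState α).mul (h.continuous_deriv _).norm).integrable_of_hasCompactSupport
        (h.support_deriv _).norm.mul_left
    · refine Eventually.of_forall fun x => ?_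
      rw [norm_mul, Complex.norm_real, Real.norm_of_nonneg (smoothGround_nonneg hα.le _ _)]
      gcongr
      exact smoothGround_le hα.le _ _
    · refine Eventually.of_forall fun x => ?_
      exact ((Complex.continuous_ofReal.tendsto _).comp (tendsto_smoothGround α hε x)).mul_const _
  have h3 : Tendsto (fun n => ∫ x, (fderiv ℝ (smoothGround α (ε n)) x (unitVec j) : ℂ) * η x) atTop
      (𝓝 (∫ x, (fderiv ℝ (groundState α) x (unitVec j) : ℂ) * η x)) := by
    refine tendsto_integral_of_dominated_convergence
      (fun x => α / 2 * groundState α x * ‖η x‖)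
      (fun n => ((hcd n).mul h.continuous).aestronglyMeasurable) ?_ (fun n => ?_) ?_
    · exact (((continuous_groundState α).const_mul _).mul h.continuous.norm).integrable_of_hasCompactSupport
        h.2.1.norm.mul_left
    · refine Eventually.of_forall fun x => ?_
      rw [norm_mul, Complex.norm_real, Real.norm_eq_abs]
      gcongr
      refine abs_fderiv_smoothGround_le hα.le _ ?_ _
      have := hε0 n
      positivity
    · filter_upwards [ae_ne_zero] with x hx
      exact ((Complex.continuous_ofReal.tendsto _).comp
        (tendsto_fderiv_smoothGround α hε hx j)).mul_const _
  exact tendsto_nhds_unique h2 (h3.neg.congr fun n => (h1 n).symm)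

/-- `⟨∂ⱼu | v⟩ = -½ ⟨u | Dⱼ v⟩`: the gradient of the ground state is in the range of `D*`. -/
lemma IsTest.integral_gradient_mul {α y : ℝ} (hα : 0 < α) {η : E3 → ℂ} (h : IsTest y η) (j : Fin 3) :
    ∫ x, (fderiv ℝ (groundState α) x (unitVec j) : ℂ) * η x ∂atomMeasure y =
      -(1 / 2) * ∫ x, (groundState α x : ℂ) *
        (fderiv ℝ η x (unitVec j) + drift α j x * η x) ∂atomMeasure y := by
  have hu := memLp_groundState hα (atomMeasure y) (atomMeasure_le y)
  have h1 : ∫ x, (groundState α x : ℂ) * (fderiv ℝ η x (unitVec j) + drift α j x * η x)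
      ∂atomMeasure y = ∫ x, (groundState α x : ℂ) * fderiv ℝ η x (unitVec j) ∂atomMeasure y +
      ∫ x, -((fderiv ℝ (groundState α) x (unitVec j) : ℂ) * η x) ∂atomMeasure y := by
    have h2 : Integrable (fun x => -((fderiv ℝ (groundState α) x (unitVec j) : ℂ) * η x))
        (atomMeasure y) :=
      (integrable_mul_L2 (memLp_fderiv_groundState hα (atomMeasure_le y) j) h.memLp).neg
    rw [← integral_add (integrable_mul_L2 hu (h.memLp_deriv _)) h2]
    -- Off the origin `u_α` times the drift is `-∂ⱼ u_α`. The derivative term gives the same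
    -- integral once more after integration by parts, whence the factor `½`.
    refine integral_congr_ae ((ae_atomMeasure_ne_zero y).mono fun x hx => ?_)
    simp only [fderiv_groundState α hx j, drift]
    push_cast
    ring
  rw [h1, h.integral_groundState_mul hα, integral_neg]
  ring

end Ground

/-! ### Joint measurability of continuous families in `L²` -/

/-- Replacing `F t` by its value at the first point of a dense sequence within distance `2⁻ⁿ` leaves
only countably many `L²` functions, so the approximation is jointly measurable. It converges
geometrically in `L²`, hence almost everywhere for each `t`, and the pointwise limit remains jointly
measurable. -/
lemma exists_jointly_measurable {T X : Type*} [TopologicalSpace T]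
    [TopologicalSpace.SeparableSpace T] [Nonempty T] [MeasurableSpace T] [OpensMeasurableSpace T]
    [MeasurableSpace X] {μ : Measure X} {F : T → Lp ℂ 2 μ} (hF : Continuous F) :
    ∃ g : T × X → ℂ, Measurable g ∧ ∀ t, (fun x => g (t, x)) =ᵐ[μ] F t := by
  classical
  let q := TopologicalSpace.denseSeq T
  let B : ℕ → ENNReal := fun n => 2⁻¹ ^ n
  have hB0 : ∀ n, 0 < B n := fun n => ENNReal.pow_pos (by simp) n
  have hopen : ∀ n i, IsOpen {t | edist (F t) (F (q i)) < B n} := fun n i =>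
    isOpen_lt (by fun_prop) continuous_const
  have hex : ∀ n t, ∃ i, edist (F t) (F (q i)) < B n := by
    intro n t
    have ho : IsOpen {s | edist (F t) (F s) < B n} := isOpen_lt (by fun_prop) continuous_const
    obtain ⟨i, hi⟩ := (TopologicalSpace.denseRange_denseSeq T).exists_mem_open ho
      ⟨t, by simpa using hB0 n⟩
    exact ⟨i, hi⟩
  let N : ℕ → T → ℕ := fun n t => Nat.find (hex n t)
  have hN : ∀ n t, edist (F t) (F (q (N n t))) < B n := fun n t => Nat.find_spec (hex n t)
  have hNm : ∀ n, Measurable (N n) := fun n => measurable_find (hex n) fun i =>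
    (hopen n i).measurableSet
  let f : ℕ → T × X → ℂ := fun n p => F (q (N n p.1)) p.2
  have hv : Measurable fun p : ℕ × X => F (q p.1) p.2 :=
    measurable_from_prod_countable_right fun i =>
      (Lp.stronglyMeasurable (F (q i))).measurable
  have hf : ∀ n, Measurable (f n) := fun n =>
    hv.comp (((hNm n).comp measurable_fst).prodMk measurable_snd)
  refine ⟨fun p => atTop.limUnder fun n => f n p,
    (StronglyMeasurable.limUnder fun n => (hf n).stronglyMeasurable).measurable, fun t => ?_⟩
  have hm : ∀ n, AEStronglyMeasurable (fun x => f n (t, x)) μ := fun n =>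
    (Lp.aestronglyMeasurable (F (q (N n t))))
  have hsum : ∑' n, 4 * B n ≠ ⊤ := by
    rw [ENNReal.tsum_mul_left, ENNReal.tsum_geometric]
    simp
    norm_num
  have hd : ∀ n, eLpNorm ((fun x => f n (t, x)) - (F t : X → ℂ)) 2 μ < B n := by
    intro n
    have := hN n t
    rw [edist_comm, Lp.edist_def] at this
    exact this
  -- The triangle inequality gives `2 * B M`; the factor `4` leaves room for the strict inequality.
  have hcau : ∀ M n m : ℕ, M ≤ n → M ≤ m →
      eLpNorm ((fun x => f n (t, x)) - fun x => f m (t, x)) 2 μ < 4 * B M := by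
    intro M n m hn hm'
    have hmono : ∀ k, M ≤ k → B k ≤ B M := fun k hk =>
      pow_le_pow_right_of_le_one' (by simp) hk
    have h1 : eLpNorm ((fun x => f n (t, x)) - fun x => f m (t, x)) 2 μ ≤ B n + B m := by
      have e : ((fun x => f n (t, x)) - fun x => f m (t, x)) =
          ((fun x => f n (t, x)) - (F t : X → ℂ)) - ((fun x => f m (t, x)) - (F t : X → ℂ)) := by
        ext x; simp
      rw [e]
      refine (eLpNorm_sub_le ((hm n).sub (Lp.aestronglyMeasurable _))
        ((hm m).sub (Lp.aestronglyMeasurable _)) one_le_two).trans ?_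
      exact add_le_add (hd n).le (hd m).le
    refine (h1.trans (add_le_add (hmono n hn) (hmono m hm'))).trans_lt ?_
    rw [← two_mul]
    refine ENNReal.mul_lt_mul_left (hB0 M).ne' ?_ (by norm_num)
    exact ENNReal.pow_ne_top (by simp)
  have hlim := Lp.ae_tendsto_of_cauchy_eLpNorm hm one_le_two hsum hcau
  have hlim' : ∀ᵐ x ∂μ, Tendsto (fun n => f n (t, x)) atTop
      (𝓝 (atTop.limUnder fun n => f n (t, x))) := by
    filter_upwards [hlim] with x hx using tendsto_nhds_limUnder hx
  have h1 : TendstoInMeasure μ (fun n x => f n (t, x)) atTop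
      (fun x => atTop.limUnder fun n => f n (t, x)) := by
    have hlm : AEStronglyMeasurable (fun x => atTop.limUnder fun n => f n (t, x)) μ :=
      aestronglyMeasurable_of_tendsto_ae atTop hm hlim'
    exact tendstoInMeasure_of_tendsto_eLpNorm two_ne_zero hm hlm
      (Lp.cauchy_tendsto_of_tendsto hm _ hsum hcau hlim')
  have h2 : TendstoInMeasure μ (fun n x => f n (t, x)) atTop (F t) := by
    refine tendstoInMeasure_of_tendsto_eLpNorm two_ne_zero hm (Lp.aestronglyMeasurable _) ?_
    refine tendsto_of_tendsto_of_tendsto_of_le_of_le tendsto_const_nhds ?_ (fun _ => zero_le)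
      fun n => (hd n).le
    exact ENNReal.tendsto_pow_atTop_nhds_zero_of_lt_one (by simp)
  exact tendstoInMeasure_ae_unique h1 h2

/-! ### The resolvent of a form operator -/

section Resolvent

variable {H K : Type*} [NormedAddCommGroup H] [InnerProductSpace ℂ H] [CompleteSpace H]
  [NormedAddCommGroup K] [InnerProductSpace ℂ K] [CompleteSpace K]

/-- For a contraction `P : H → K`, the solution `a(t)` of
`⟨b, a⟩ + (t - 1) ⟨P b, P a⟩ = ⟨P b, f⟩` depends continuously on `t > 0`. -/
lemma exists_form_resolvent (P : H →L[ℂ] K) (hP : ∀ a, ‖P a‖ ≤ ‖a‖) (f : K) :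
    ∃ a : ℝ → H, ContinuousOn a (Ioi 0) ∧ ∀ t, 0 < t → ∀ b,
      inner ℂ b (a t) + (t - 1) * inner ℂ (P b) (P (a t)) = inner ℂ (P b) f := by
  -- The equation reads `A t a = P* f`. Since `P` is a contraction, `⟨x, A t x⟩ = ‖x‖² + (t - 1)‖P
  -- x‖² ≥ min 1 t ‖x‖²`, so `A t` is invertible, and inversion is continuous at units. For `H` with
  -- the norm `‖v‖² + ‖D v‖²` and `P` the inclusion in `L²`, the equation is `D* D a + t a = f`.
  let A : ℝ → H →L[ℂ] H := fun t => 1 + ((t - 1 : ℝ) : ℂ) • (P.adjoint ∘L P)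
  have hA : ∀ t b a, inner ℂ b (A t a) = inner ℂ b a + (t - 1) * inner ℂ (P b) (P a) := by
    intro t b a
    simp [A, ContinuousLinearMap.adjoint_inner_right]
  have hunit : ∀ t, 0 < t → IsUnit (A t) := by
    intro t ht
    refine ContinuousLinearMap.isUnit_of_forall_le_norm_inner_map (A t)
      (c := ⟨min 1 t, by positivity⟩) (by exact lt_min one_pos ht) fun x => ?_
    have h1 : inner ℂ x (A t x) = ((‖x‖ ^ 2 + (t - 1) * ‖P x‖ ^ 2 : ℝ) : ℂ) := by
      rw [hA, inner_self_eq_norm_sq_to_K, inner_self_eq_norm_sq_to_K]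
      push_cast
      rfl
    rw [← norm_inner_symm, h1, Complex.norm_real]
    refine le_trans ?_ (le_abs_self _)
    have h2 := hP x
    have h3 : ‖P x‖ ^ 2 ≤ ‖x‖ ^ 2 := by gcongr
    change ‖x‖ ^ 2 * min 1 t ≤ _
    rcases le_total 1 t with h | h
    · rw [min_eq_left h]
      nlinarith [sq_nonneg ‖P x‖]
    · rw [min_eq_right h]
      nlinarith
  refine ⟨fun t => Ring.inverse (A t) (P.adjoint f), ?_, fun t ht b => ?_⟩
  · intro t ht
    have hAc : Continuous A := by fun_prop
    obtain ⟨u, hu⟩ := hunit t ht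
    have h1 : ContinuousAt Ring.inverse (A t) := hu ▸ NormedRing.inverse_continuousAt u
    have h2 : ContinuousAt (fun t => Ring.inverse (A t)) t :=
      ContinuousAt.comp (f := A) (g := Ring.inverse) h1 hAc.continuousAt
    exact (h2.clm_apply continuousAt_const).continuousWithinAt
  · rw [← hA]
    have : A t (Ring.inverse (A t) (P.adjoint f)) = P.adjoint f := by
      change (A t * Ring.inverse (A t)) (P.adjoint f) = _
      rw [Ring.mul_inverse_cancel _ (hunit t ht)]
      rfl
    rw [this, ContinuousLinearMap.adjoint_inner_right]

end Resolvent

/-! ### The form domain and the resolvent of `h_α - e_α` -/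

section FormDomain

lemma integral_eq_add_ae {X F : Type*} [MeasurableSpace X] {μ : Measure X} [NormedAddCommGroup F]
    [NormedSpace ℝ F] {h f g : X → F} (hf : Integrable f μ) (hg : Integrable g μ)
    (he : ∀ᵐ x ∂μ, h x = f x + g x) : ∫ x, h x ∂μ = ∫ x, f x ∂μ + ∫ x, g x ∂μ := by
  rw [integral_congr_ae he]
  exact integral_add hf hg

lemma IsH10.congr {y : ℝ} {u u' : E3 → ℂ} {G G' : Fin 3 → E3 → ℂ} (h : IsH10 y u G)
    (hu : u =ᵐ[atomMeasure y] u') (hG : ∀ j, G j =ᵐ[atomMeasure y] G' j) : IsH10 y u' G' := by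
  obtain ⟨h1, h2, η, hη, h3, h4⟩ := h
  refine ⟨h1.ae_eq hu, fun j => (h2 j).ae_eq (hG j), η, hη, h3.congr fun n => ?_,
    fun j => (h4 j).congr fun n => ?_⟩
  · exact eLpNorm_congr_ae (hu.mono fun x hx => by simp [hx])
  · exact eLpNorm_congr_ae ((hG j).mono fun x hx => by simp [hx])

lemma Lp_norm_sq {X : Type*} [MeasurableSpace X] {μ : Measure X} (f : Lp ℂ 2 μ) :
    ‖f‖ ^ 2 = ∫ x, ‖f x‖ ^ 2 ∂μ := by
  have h := eLpNorm_two_sq_eq_ofReal (Lp.memLp f)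
  rw [Lp.norm_def, ← ENNReal.toReal_pow, h, ENNReal.toReal_ofReal (integral_nonneg fun x => sq_nonneg _)]

lemma Lp_inner {X : Type*} [MeasurableSpace X] {μ : Measure X} (f g : Lp ℂ 2 μ) :
    inner ℂ f g = ∫ x, conj (f x) * g x ∂μ := by
  rw [L2.inner_def]
  exact integral_congr_ae (Eventually.of_forall fun x => by simp [mul_comm])

lemma conj_drift (α : ℝ) (j : Fin 3) (x : E3) : conj (drift α j x) = drift α j x :=
  Complex.conj_ofReal _

/-- Vectors `(v, D₁ v, D₂ v, D₃ v)`. -/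
abbrev FormSpace (y : ℝ) : Type := PiLp 2 fun _ : Option (Fin 3) => Lp ℂ 2 (atomMeasure y)

/-- `D_j η = ∂_j η + (α/2) (x_j/|x|) η`. -/
def twistedDeriv (α : ℝ) (j : Fin 3) (η : E3 → ℂ) (x : E3) : ℂ :=
  fderiv ℝ η x (unitVec j) + drift α j x * η x

lemma IsTest.memLp_twistedDeriv {y : ℝ} {η : E3 → ℂ} (h : IsTest y η) (α : ℝ) (j : Fin 3) :
    MemLp (twistedDeriv α j η) 2 (atomMeasure y) :=
  (h.memLp_deriv _).add (memLp_drift_mul α h.memLp j)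

/-- The vectors `(η, D₁ η, D₂ η, D₃ η)` with a test function `η`. -/
def testForms (α y : ℝ) : Submodule ℂ (FormSpace y) where
  carrier := {a | ∃ η, IsTest y η ∧ a none =ᵐ[atomMeasure y] η ∧
    ∀ j, a (some j) =ᵐ[atomMeasure y] twistedDeriv α j η}
  zero_mem' := by
    refine ⟨fun _ => 0, IsTest.zero, Lp.coeFn_zero _ _ _, fun j => ?_⟩
    refine (Lp.coeFn_zero _ _ _).trans (Eventually.of_forall fun x => ?_)
    simp [twistedDeriv]
  add_mem' := by
    rintro a b ⟨η, hη, h1, h2⟩ ⟨ζ, hζ, h3, h4⟩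
    refine ⟨fun x => η x + ζ x, hη.add hζ, ?_, fun j => ?_⟩
    · refine (Lp.coeFn_add (a none) (b none)).trans ?_
      filter_upwards [h1, h3] with x hx hx' using by simp [hx, hx']
    · refine (Lp.coeFn_add (a (some j)) (b (some j))).trans ?_
      filter_upwards [h2 j, h4 j] with x hx hx'
      have := (hη.differentiable x).hasFDerivAt.add (hζ.differentiable x).hasFDerivAt
      have e : fderiv ℝ (fun x => η x + ζ x) x = fderiv ℝ η x + fderiv ℝ ζ x := this.fderiv
      simp only [Pi.add_apply, hx, hx', twistedDeriv, e, add_apply]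
      ring
  smul_mem' := by
    rintro c a ⟨η, hη, h1, h2⟩
    refine ⟨fun x => c * η x, hη.const_mul c, ?_, fun j => ?_⟩
    · refine (Lp.coeFn_smul c (a none)).trans ?_
      filter_upwards [h1] with x hx using by simp [hx]
    · refine (Lp.coeFn_smul c (a (some j))).trans ?_
      filter_upwards [h2 j] with x hx
      have := (hη.differentiable x).hasFDerivAt.const_mul c
      have e : fderiv ℝ (fun x => c * η x) x = c • fderiv ℝ η x := this.fderiv
      simp only [Pi.smul_apply, hx, twistedDeriv, e, smul_apply, smul_eq_mul]
      ring

/-- The form domain of `h_α`. -/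
abbrev formDomain (α y : ℝ) : Submodule ℂ (FormSpace y) := (testForms α y).topologicalClosure

/-- The inclusion of the form domain in `L²`. -/
def formEmbedding (α y : ℝ) : formDomain α y →L[ℂ] Lp ℂ 2 (atomMeasure y) :=
  (PiLp.proj 2 (fun _ : Option (Fin 3) => Lp ℂ 2 (atomMeasure y)) (𝕜 := ℂ) none).comp
    (formDomain α y).subtypeL

lemma formEmbedding_apply {α y : ℝ} (a : formDomain α y) :
    formEmbedding α y a = a.1 none := rfl

lemma norm_formEmbedding_le {α y : ℝ} (a : formDomain α y) : ‖formEmbedding α y a‖ ≤ ‖a‖ :=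
  PiLp.norm_apply_le a.1 none

/-- The vector `(η, D₁ η, D₂ η, D₃ η)`. -/
def IsTest.toForm {y : ℝ} {η : E3 → ℂ} (h : IsTest y η) (α : ℝ) : formDomain α y :=
  ⟨WithLp.toLp 2 fun o => match o with
    | none => h.memLp.toLp η
    | some j => (h.memLp_twistedDeriv α j).toLp _,
   (testForms α y).le_topologicalClosure
    ⟨η, h, h.memLp.coeFn_toLp, fun j => (h.memLp_twistedDeriv α j).coeFn_toLp⟩⟩

/-- The drift is bounded, so convergence of `(η, D η)` implies convergence of `η` in `H¹`. -/
lemma formDomain_isH10 {α y : ℝ} (a : formDomain α y) :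
    IsH10 y (a.1 none) fun j x => a.1 (some j) x - drift α j x * a.1 none x := by
  have ha : a.1 ∈ closure (testForms α y : Set (FormSpace y)) := a.2
  obtain ⟨b, hb, hlim⟩ := mem_closure_iff_seq_limit.1 ha
  choose η hη h1 h2 using hb
  have hc : ∀ o, Tendsto (fun n => eLpNorm ((a.1 o : E3 → ℂ) - (b n o : E3 → ℂ)) 2 (atomMeasure y)) atTop (𝓝 0) := by
    intro o
    have : Tendsto (fun n => b n o) atTop (𝓝 (a.1 o)) :=
      (((PiLp.continuous_apply 2 (fun _ : Option (Fin 3) => Lp ℂ 2 (atomMeasure y)) o)).tendsto _).comp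
        hlim
    rw [tendsto_iff_edist_tendsto_0] at this
    refine this.congr fun n => ?_
    rw [edist_comm, Lp.edist_def]
  have hmem := Lp.memLp (a.1 none)
  refine ⟨hmem, fun j => (Lp.memLp _).sub (memLp_drift_mul α hmem j), η, hη,
    (hc none).congr fun n => ?_, fun j => ?_⟩
  · exact eLpNorm_congr_ae ((h1 n).mono fun x hx => by simp [hx])
  · have h3 : ∀ n, eLpNorm (fun x => (a.1 (some j) x - drift α j x * a.1 none x) -
        fderiv ℝ (η n) x (unitVec j)) 2 (atomMeasure y) ≤
        eLpNorm ((a.1 (some j) : E3 → ℂ) - (b n (some j) : E3 → ℂ)) 2 (atomMeasure y) +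
        ENNReal.ofReal |α / 2| * eLpNorm ((a.1 none : E3 → ℂ) - (b n none : E3 → ℂ)) 2 (atomMeasure y) := by
      intro n
      have hsub : MemLp ((a.1 none : E3 → ℂ) - (b n none : E3 → ℂ)) 2 (atomMeasure y) :=
        hmem.sub (Lp.memLp (b n none))
      have e : eLpNorm (fun x => (a.1 (some j) x - drift α j x * a.1 none x) -
          fderiv ℝ (η n) x (unitVec j)) 2 (atomMeasure y) =
          eLpNorm (((a.1 (some j) : E3 → ℂ) - (b n (some j) : E3 → ℂ)) -
            fun x => drift α j x * ((a.1 none : E3 → ℂ) - (b n none : E3 → ℂ)) x) 2 (atomMeasure y) := by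
        refine eLpNorm_congr_ae ?_
        filter_upwards [h1 n, h2 n j] with x hx hx'
        simp only [Pi.sub_apply, hx, hx', twistedDeriv]
        ring
      rw [e]
      refine (eLpNorm_sub_le ((Lp.aestronglyMeasurable _).sub (Lp.aestronglyMeasurable _))
        (memLp_drift_mul α hsub j).aestronglyMeasurable one_le_two).trans ?_
      refine add_le_add le_rfl ?_
      refine eLpNorm_le_mul_eLpNorm_of_ae_le_mul (Eventually.of_forall fun x => ?_) 2
      rw [norm_mul, drift, Complex.norm_real, Real.norm_eq_abs, abs_mul]
      gcongr
      exact mul_le_of_le_one_right (abs_nonneg _) (abs_direction_le x j)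
    refine tendsto_of_tendsto_of_tendsto_of_le_of_le tendsto_const_nhds ?_ (fun _ => zero_le) h3
    have := (hc (some j)).add (ENNReal.Tendsto.const_mul (a := ENNReal.ofReal |α / 2|) (hc none)
      (Or.inr ENNReal.ofReal_ne_top))
    simpa using this

/-- Both sides are continuous in `b`, so the identity for test functions extends to the closure. It
pairs the source with `D b` instead of `b`, so the bound on `D U` does not degenerate at small
photon energy. -/
lemma formDomain_inner_gradient {α y : ℝ} (hα : 0 < α) (j : Fin 3) (b : formDomain α y) :
    inner ℂ (b.1 none) ((memLp_fderiv_groundState hα (atomMeasure_le y) j).toLp _) =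
      -(1 / 2) * inner ℂ (b.1 (some j)) ((memLp_groundState hα _ (atomMeasure_le y)).toLp _) := by
  set f := (memLp_fderiv_groundState hα (atomMeasure_le y) j).toLp _ with hf
  set u := (memLp_groundState hα _ (atomMeasure_le y)).toLp _ with hu
  have hcl : IsClosed {b : FormSpace y | inner ℂ (b none) f = -(1 / 2) * inner ℂ (b (some j)) u} :=
    isClosed_eq (by fun_prop) (by fun_prop)
  have hsub : (testForms α y : Set (FormSpace y)) ⊆
      {b : FormSpace y | inner ℂ (b none) f = -(1 / 2) * inner ℂ (b (some j)) u} := by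
    rintro b ⟨η, hη, h1, h2⟩
    have key := hη.star_comp.integral_gradient_mul hα j
    have hfe := MemLp.coeFn_toLp (memLp_fderiv_groundState hα (atomMeasure_le y) j)
    have hue := MemLp.coeFn_toLp (memLp_groundState hα _ (atomMeasure_le y))
    simp only [mem_ofPred_eq, Lp_inner]
    have e1 : ∫ x, conj (b none x) * f x ∂atomMeasure y = ∫ x,
        (fderiv ℝ (groundState α) x (unitVec j) : ℂ) * conj (η x) ∂atomMeasure y := by
      refine integral_congr_ae ?_
      filter_upwards [h1, hfe] with x hx hx'
      rw [hf, hx', hx, mul_comm]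
    have e2 : ∫ x, conj (b (some j) x) * u x ∂atomMeasure y = ∫ x, (groundState α x : ℂ) *
        (fderiv ℝ (fun x => conj (η x)) x (unitVec j) + drift α j x * conj (η x))
        ∂atomMeasure y := by
      refine integral_congr_ae ?_
      filter_upwards [h2 j, hue] with x hx hx'
      rw [hu, hx', hx, mul_comm, hη.fderiv_conj, twistedDeriv]
      simp [conj_drift]
    rw [e1, e2, key]
  exact closure_minimal hsub hcl b.2

/-- The solution of `(h_α - e_α + eˢ) U(s) = ∂ⱼ u_α`, with the bounds that hold uniformly in the
position of the wall. -/
structure IsFiberResolvent (α y : ℝ) (j : Fin 3) (U : ℝ × E3 → ℂ) (D : Fin 3 → ℝ × E3 → ℂ) :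
    Prop where
  meas : Measurable U
  measD : ∀ i, Measurable (D i)
  memLpD : ∀ s i, MemLp (fun x => D i (s, x)) 2 (atomMeasure y)
  isH10 : ∀ s, IsH10 y (fun x => U (s, x)) fun i x => D i (s, x) - drift α i x * U (s, x)
  weak : ∀ s η, IsTest y η →
    ∑ i, ∫ x, (D i (s, x) - drift α i x * U (s, x)) * fderiv ℝ η x (unitVec i) ∂atomMeasure y =
      ∫ x, ((fderiv ℝ (groundState α) x (unitVec j) : ℂ) +
        ((α * ‖x‖⁻¹ + groundEnergy α - Real.exp s : ℝ) : ℂ) * U (s, x)) * η x ∂atomMeasure y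
  boundD : ∀ s, ∑ i, ∫ x, ‖D i (s, x)‖ ^ 2 ∂atomMeasure y ≤ 1 / 4
  bound : ∀ s, Real.exp s * ∫ x, ‖U (s, x)‖ ^ 2 ∂atomMeasure y ≤ 1 / 16
  bound' : ∀ s, Real.exp s ^ 2 * ∫ x, ‖U (s, x)‖ ^ 2 ∂atomMeasure y ≤ α ^ 2 / 4

lemma integral_fderiv_groundState_sq_le {α : ℝ} (hα : 0 < α) (y : ℝ) (j : Fin 3) :
    ∫ x, ‖(fderiv ℝ (groundState α) x (unitVec j) : ℂ)‖ ^ 2 ∂atomMeasure y ≤ α ^ 2 / 4 := by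
  have hi : Integrable (fun x : E3 => (α / 2) ^ 2 * groundState α x ^ 2) volume := by
    simpa using (integrable_moment hα 0).const_mul ((α / 2) ^ 2)
  calc _ ≤ ∫ x, (α / 2) ^ 2 * groundState α x ^ 2 ∂atomMeasure y := by
        refine integral_mono_ae (integrable_norm_sq
          (memLp_fderiv_groundState hα (atomMeasure_le y) j)) hi.restrict ?_
        filter_upwards [ae_atomMeasure_ne_zero y] with x hx
        rw [Complex.norm_real, Real.norm_eq_abs, ← mul_pow]
        gcongr
        exact abs_fderiv_groundState_le hα.le hx j
    _ ≤ ∫ x, (α / 2) ^ 2 * groundState α x ^ 2 :=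
        setIntegral_le_integral hi (Eventually.of_forall fun x => by positivity)
    _ = _ := by rw [integral_const_mul, integral_groundState_sq hα]; ring

lemma norm_toLp_sq {X : Type*} [MeasurableSpace X] {μ : Measure X} {f : X → ℂ} (hf : MemLp f 2 μ) :
    ‖hf.toLp f‖ ^ 2 = ∫ x, ‖f x‖ ^ 2 ∂μ := by
  rw [Lp_norm_sq]
  exact integral_congr_ae (hf.coeFn_toLp.mono fun x hx => by simp [hx])

lemma exists_isFiberResolvent {α : ℝ} (hα : 0 < α) (y : ℝ) (j : Fin 3) :
    ∃ U D, IsFiberResolvent α y j U D := by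
  set hfm := memLp_fderiv_groundState hα (atomMeasure_le y) j with hfm'
  set f := hfm.toLp _ with hf
  set hum := memLp_groundState hα _ (atomMeasure_le y) with hum'
  set u := hum.toLp _ with hu
  obtain ⟨a, hac, ha⟩ := exists_form_resolvent (formEmbedding α y) norm_formEmbedding_le f
  -- Writing the photon energy as `eˢ` makes the parameter space all of `ℝ`, where the solution is
  -- continuous everywhere.
  have hcont : Continuous fun s : ℝ => a (Real.exp s) :=
    hac.comp_continuous Real.continuous_exp fun s => Real.exp_pos s
  have hco : ∀ o, Continuous fun s : ℝ => (a (Real.exp s)).1 o := fun o =>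
    (PiLp.continuous_apply 2 (fun _ : Option (Fin 3) => Lp ℂ 2 (atomMeasure y)) o).comp
      (continuous_subtype_val.comp hcont)
  choose g hg hga using fun o => exists_jointly_measurable (hco o)
  have hga' : ∀ s, ∀ᵐ x ∂atomMeasure y, ∀ o, g o (s, x) = (a (Real.exp s)).1 o x := fun s =>
    ae_all_iff.2 fun o => hga o s
  have hinner : ∀ s (b : formDomain α y), ∑ i, inner ℂ (b.1 (some i)) ((a (Real.exp s)).1 (some i)) +
      (Real.exp s) * inner ℂ (b.1 none) ((a (Real.exp s)).1 none) = inner ℂ (b.1 none) f := by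
    intro s b
    have := ha _ (Real.exp_pos s) b
    rw [formEmbedding_apply, formEmbedding_apply, Submodule.coe_inner, PiLp.inner_apply,
      Fintype.sum_option] at this
    rw [← this]
    ring
  -- The equation tested against its own solution.
  have hnorm : ∀ s, ∑ i, ‖(a (Real.exp s)).1 (some i)‖ ^ 2 +
      Real.exp s * ‖(a (Real.exp s)).1 none‖ ^ 2 =
      (inner ℂ ((a (Real.exp s)).1 none) f : ℂ).re := by
    intro s
    rw [← hinner s (a (Real.exp s))]
    simp_rw [inner_self_eq_norm_sq_to_K]
    rw [← Complex.ofReal_re (∑ i, ‖(a (Real.exp s)).1 (some i)‖ ^ 2 +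
      Real.exp s * ‖(a (Real.exp s)).1 none‖ ^ 2)]
    congr 1
    push_cast
    rfl
  have hun : ‖u‖ ≤ 1 := by
    have h1 : ‖u‖ ^ 2 ≤ 1 := by
      rw [hu, norm_toLp_sq, ← integral_groundState_sq hα]
      simp only [Complex.norm_real, Real.norm_eq_abs, sq_abs]
      refine setIntegral_le_integral ?_ (Eventually.of_forall fun x => by positivity)
      simpa using integrable_moment hα 0
    exact (sq_le_one_iff₀ (norm_nonneg _)).1 h1
  have hfn : ‖f‖ ^ 2 ≤ α ^ 2 / 4 := by
    rw [hf, norm_toLp_sq]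
    exact integral_fderiv_groundState_sq_le hα y j
  -- With `d = ‖Dⱼ a‖` the right-hand side is `d/2` because `‖u_α‖ ≤ 1`. As `d²` is part of the
  -- left-hand side, `d ≤ 1/2`, the gradient part is at most `1/4`, and `eˢ ‖a‖² ≤ d/2 - d² ≤ 1/16`.
  have hD : ∀ s, ∑ i, ‖(a (Real.exp s)).1 (some i)‖ ^ 2 +
      Real.exp s * ‖(a (Real.exp s)).1 none‖ ^ 2 ≤ 1 / 2 * ‖(a (Real.exp s)).1 (some j)‖ := by
    intro s
    rw [hnorm, hf, formDomain_inner_gradient hα j]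
    refine (Complex.re_le_norm _).trans ?_
    rw [norm_mul]
    have h1 := norm_inner_le_norm (𝕜 := ℂ) ((a (Real.exp s)).1 (some j)) u
    have h2 : ‖(-(1 / 2) : ℂ)‖ = 1 / 2 := by norm_num
    rw [h2]
    refine mul_le_mul_of_nonneg_left (h1.trans ?_) (by norm_num)
    exact mul_le_of_le_one_right (norm_nonneg _) hun
  have hj : ∀ s, ‖(a (Real.exp s)).1 (some j)‖ ^ 2 ≤ ∑ i, ‖(a (Real.exp s)).1 (some i)‖ ^ 2 :=
    fun s => Finset.single_le_sum (f := fun i => ‖(a (Real.exp s)).1 (some i)‖ ^ 2)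
      (fun i _ => sq_nonneg _) (Finset.mem_univ j)
  have eD : ∀ s o, ∫ x, ‖g o (s, x)‖ ^ 2 ∂atomMeasure y = ‖(a (Real.exp s)).1 o‖ ^ 2 := by
    intro s o
    rw [Lp_norm_sq]
    exact integral_congr_ae ((hga o s).mono fun x hx => by simp only [hx])
  refine ⟨g none, fun i => g (some i), ⟨hg none, fun i => hg _, fun s i => ?_, fun s => ?_,
    fun s η hη => ?_, fun s => ?_, fun s => ?_, fun s => ?_⟩⟩
  · exact (Lp.memLp ((a (Real.exp s)).1 (some i))).ae_eq (hga _ s).symm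
  · refine (formDomain_isH10 (a (Real.exp s))).congr (hga none s).symm fun i => ?_
    filter_upwards [hga' s] with x hx using by simp only [hx]
  · have h10 := formDomain_isH10 (a (Real.exp s))
    have h1 := h10.twisted_form hη α
    -- The form is antilinear in the test vector while the weak equation is bilinear, hence the
    -- complex conjugate of `η`.
    have h2 := hinner s (hη.star_comp.toForm α)
    simp only [Lp_inner] at h2
    have e1 : ∀ i, ∫ x, conj (((hη.star_comp.toForm α).1 (some i) : Lp ℂ 2 (atomMeasure y)) x) *
        (a (Real.exp s)).1 (some i) x ∂atomMeasure y =
        ∫ x, (fderiv ℝ η x (unitVec i) + drift α i x * η x) *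
        (((a (Real.exp s)).1 (some i) x - drift α i x * (a (Real.exp s)).1 none x) +
          drift α i x * (a (Real.exp s)).1 none x) ∂atomMeasure y := by
      intro i
      refine integral_congr_ae ?_
      have := (hη.star_comp.memLp_twistedDeriv α i).coeFn_toLp
      filter_upwards [this] with x hx
      have hx' : ((hη.star_comp.toForm α).1 (some i) : Lp ℂ 2 (atomMeasure y)) x =
        twistedDeriv α i (fun x => conj (η x)) x := hx
      rw [hx', sub_add_cancel, twistedDeriv, hη.fderiv_conj]
      simp [conj_drift]
    have e2 : ∀ F : Lp ℂ 2 (atomMeasure y),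
        ∫ x, conj (((hη.star_comp.toForm α).1 none : Lp ℂ 2 (atomMeasure y)) x) *
        F x ∂atomMeasure y = ∫ x, η x * F x ∂atomMeasure y := by
      intro F
      refine integral_congr_ae ?_
      filter_upwards [hη.star_comp.memLp.coeFn_toLp] with x hx
      have hx' : ((hη.star_comp.toForm α).1 none : Lp ℂ 2 (atomMeasure y)) x = conj (η x) := hx
      rw [hx', Complex.conj_conj]
    rw [Finset.sum_congr rfl fun i _ => e1 i, e2, e2, h1] at h2
    have hmem := Lp.memLp ((a (Real.exp s)).1 none)
    have i1 := integrable_mul_L2 hη.memLp hfm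
    have i2 := integrable_mul_L2 hη.memLp_div_norm hmem
    have i3 := integrable_mul_L2 hη.memLp hmem
    have e3 : ∫ x, ((fderiv ℝ (groundState α) x (unitVec j) : ℂ) +
        ((α * ‖x‖⁻¹ + groundEnergy α - Real.exp s : ℝ) : ℂ) * g none (s, x)) * η x ∂atomMeasure y =
        ∫ x, η x * (fderiv ℝ (groundState α) x (unitVec j) : ℂ) ∂atomMeasure y +
        ∫ x, ((α : ℂ) * (((‖x‖⁻¹ : ℝ) : ℂ) * η x * (a (Real.exp s)).1 none x) +
          ((groundEnergy α - Real.exp s : ℝ) : ℂ) * (η x * (a (Real.exp s)).1 none x))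
          ∂atomMeasure y := by
      refine integral_eq_add_ae i1 ((i2.const_mul _).add (i3.const_mul _)) ?_
      filter_upwards [hga' s] with x hx
      rw [hx]
      push_cast
      ring
    rw [e3, integral_add (i2.const_mul _) (i3.const_mul _), integral_const_mul, integral_const_mul]
    have e4 : ∫ x, η x * f x ∂atomMeasure y =
        ∫ x, η x * (fderiv ℝ (groundState α) x (unitVec j) : ℂ) ∂atomMeasure y :=
      integral_congr_ae (hfm.coeFn_toLp.mono fun x hx => by simp only; rw [hf, hx])
    rw [e4] at h2
    have e5 : ∀ i, ∫ x, (g (some i) (s, x) - drift α i x * g none (s, x)) *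
        fderiv ℝ η x (unitVec i) ∂atomMeasure y = ∫ x, fderiv ℝ η x (unitVec i) *
        ((a (Real.exp s)).1 (some i) x - drift α i x * (a (Real.exp s)).1 none x)
        ∂atomMeasure y := by
      intro i
      refine integral_congr_ae ?_
      filter_upwards [hga' s] with x hx
      rw [hx, hx, mul_comm]
    rw [Finset.sum_congr rfl fun i _ => e5 i, ← h2, groundEnergy]
    push_cast
    ring
  · simp_rw [eD]
    have h1 := hD s
    have h2 := hj s
    have h3 : 0 ≤ Real.exp s * ‖(a (Real.exp s)).1 none‖ ^ 2 := by positivity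
    have h4 : ‖(a (Real.exp s)).1 (some j)‖ ≤ 1 / 2 := by
      by_contra h
      push Not at h
      nlinarith
    linarith
  · rw [eD]
    have h1 := hD s
    have h2 := hj s
    nlinarith [sq_nonneg (‖(a (Real.exp s)).1 (some j)‖ - 1 / 4)]
  · rw [eD]
    have h1 := hnorm s
    have h2 : 0 ≤ ∑ i, ‖(a (Real.exp s)).1 (some i)‖ ^ 2 :=
      Finset.sum_nonneg fun i _ => sq_nonneg _
    -- The last bound uses only `‖∂ⱼ u_α‖ ≤ α/2`; it is the better one for photon energies above
    -- `α²`.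
    have h3 : (inner ℂ ((a (Real.exp s)).1 none) f : ℂ).re ≤ ‖(a (Real.exp s)).1 none‖ * ‖f‖ :=
      (Complex.re_le_norm _).trans (norm_inner_le_norm _ _)
    set p := ‖(a (Real.exp s)).1 none‖ with hp
    have hp0 : 0 ≤ p := norm_nonneg _
    have h4 : Real.exp s * p ^ 2 ≤ p * ‖f‖ := by linarith
    have h5 : Real.exp s * p ≤ ‖f‖ := by
      rcases hp0.eq_or_lt with h | h
      · rw [← h, mul_zero]; exact norm_nonneg _
      · refine le_of_mul_le_mul_left (le_trans (le_of_eq ?_) h4) h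
        ring
    calc Real.exp s ^ 2 * p ^ 2 = (Real.exp s * p) ^ 2 := by ring
      _ ≤ ‖f‖ ^ 2 := by gcongr
      _ ≤ _ := hfn

end FormDomain

/-! ### Form factors -/

section FormFactors

instance (y : ℝ) : SigmaFinite (atomMeasure y) := by unfold atomMeasure; infer_instance
instance : SigmaFinite wallModeMeasure := by unfold wallModeMeasure; infer_instance

lemma wallModeMeasure_le : wallModeMeasure ≤ modeMeasure := by
  unfold wallModeMeasure modeMeasure
  exact Measure.prod_mono Measure.restrict_le_self le_rfl

lemma ae_mode {p : E3 → Prop} (h : ∀ᵐ k : E3, p k) : ∀ᵐ m ∂modeMeasure, p m.1 :=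
  Measure.quasiMeasurePreserving_fst.ae h

lemma ae_wall {p : Mode → Prop} (h : ∀ᵐ m ∂modeMeasure, p m) : ∀ᵐ m ∂wallModeMeasure, p m :=
  (Measure.absolutelyContinuous_of_le wallModeMeasure_le).ae_le h

lemma ae_joint_fst {y : ℝ} {p : E3 → Prop} (h : ∀ᵐ x ∂atomMeasure y, p x) :
    ∀ᵐ q ∂jointMeasure y, p q.1 := Measure.quasiMeasurePreserving_fst.ae h

lemma ae_joint_snd {y : ℝ} {p : Mode → Prop} (h : ∀ᵐ m ∂wallModeMeasure, p m) :
    ∀ᵐ q ∂jointMeasure y, p q.2 := Measure.quasiMeasurePreserving_snd.ae h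

variable (R : Radiation)

lemma Radiation.ae_pol : ∀ᵐ k : E3, k ≠ 0 ∧ ‖k‖ ≠ R.Λ ∧
    Orthonormal ℝ ![‖k‖⁻¹ • k, R.pol 0 k, R.pol 1 k] := by
  have h : ∀ᵐ k : E3, ‖k‖ ≠ R.Λ := by
    rw [ae_iff]
    have : {a : E3 | ¬‖a‖ ≠ R.Λ} = Metric.sphere 0 R.Λ := by ext; simp
    rw [this]
    exact Measure.addHaar_sphere _ _ _
  filter_upwards [ae_ne_zero, h, R.pol_orthonormal] with k h1 h2 h3 using ⟨h1, h2, h3⟩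

lemma abs_pol_le {k : E3} (h : Orthonormal ℝ ![‖k‖⁻¹ • k, R.pol 0 k, R.pol 1 k]) (γ : Fin 2)
    (j : Fin 3) : |R.pol γ k j| ≤ 1 := by
  have h1 : ‖R.pol γ k‖ = 1 := by
    have h0 := h.1 1
    have h2 := h.1 2
    simp only [Matrix.cons_val_one, Matrix.cons_val_zero, Matrix.cons_val] at h0 h2
    fin_cases γ
    · exact h0
    · exact h2
  exact (abs_coord_le _ j).trans h1.le

lemma Radiation.weight_sq_le {k : E3} (hk : k ≠ 0) : R.weight k ^ 2 ≤ ‖k‖⁻¹ := by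
  have hk' : 0 < ‖k‖ := norm_pos_iff.2 hk
  have h1 := R.χ_mem (‖k‖ / R.Λ) (div_pos hk' R.Λ_pos)
  have hpi := Real.pi_gt_three
  unfold Radiation.weight
  rw [div_pow, mul_pow, mul_pow, Real.sq_sqrt hk'.le, Real.sq_sqrt (by norm_num),
    div_le_iff₀ (by positivity)]
  have h2 : R.χ (‖k‖ / R.Λ) ^ 2 ≤ 1 := pow_le_one₀ h1.1 h1.2
  have h3 : ‖k‖⁻¹ * (2 * Real.pi ^ 2 * ‖k‖) = 2 * Real.pi ^ 2 := by field_simp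
  rw [h3]
  nlinarith

lemma Radiation.weight_eq_zero {k : E3} (hk : R.Λ < ‖k‖) : R.weight k = 0 := by
  unfold Radiation.weight
  rw [R.χ_zero _ (by rwa [one_lt_div R.Λ_pos]), zero_div]

lemma Radiation.aemeasurable_weight : AEMeasurable R.weight volume := by
  have h1 : AEMeasurable (fun k : E3 => R.χ (‖k‖ / R.Λ)) volume := by
    have hc : ContinuousOn (fun k : E3 => R.χ (‖k‖ / R.Λ)) {0}ᶜ := by
      refine R.χ_smooth.continuousOn.comp (by fun_prop) fun k hk => ?_
      exact div_pos (norm_pos_iff.2 hk) R.Λ_pos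
    have := hc.aemeasurable (μ := volume) (measurableSet_singleton (0 : E3)).compl
    rwa [restrict_compl_singleton] at this
  unfold Radiation.weight
  exact h1.div (by fun_prop)

lemma Radiation.aemeasurable_pol (j : Fin 3) :
    AEMeasurable (fun m : Mode => R.pol m.2 m.1 j) modeMeasure := by
  refine ⟨fun m => (R.pol_meas m.2).mk _ m.1 j, ?_, ?_⟩
  · refine measurable_from_prod_countable_left fun γ => ?_
    exact (measurable_coord j).comp (R.pol_meas γ).measurable_mk
  · have : ∀ᵐ k : E3, ∀ γ, R.pol γ k = (R.pol_meas γ).mk _ k :=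
      ae_all_iff.2 fun γ => (R.pol_meas γ).ae_eq_mk
    filter_upwards [ae_mode this] with m hm
    rw [hm]

lemma Radiation.aemeasurable_formFactor (y : ℝ) (j : Fin 3) :
    AEMeasurable (R.formFactor y j) wallModeMeasure := by
  have hp := (R.aemeasurable_pol j).mono_measure wallModeMeasure_le
  have hw : AEMeasurable (fun m : Mode => R.weight m.1) wallModeMeasure :=
    (R.aemeasurable_weight.comp_quasiMeasurePreserving
      Measure.quasiMeasurePreserving_fst).mono_measure wallModeMeasure_le
  have hc : Measurable fun m : Mode => m.1 0 * y :=
    ((measurable_coord 0).comp measurable_fst).mul_const y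
  unfold Radiation.formFactor
  by_cases hj : j = 0
  · simp only [hj, if_true]
    subst hj
    exact (hw.const_mul 2).mul (hp.mul (Real.measurable_cos.comp hc).aemeasurable)
  · simp only [hj, if_false]
    exact (hw.const_mul 2).mul (hp.mul (Real.measurable_sin.comp hc).aemeasurable).neg

lemma Radiation.formFactor_sq_le (y : ℝ) (j : Fin 3) {m : Mode}
    (h : Orthonormal ℝ ![‖m.1‖⁻¹ • m.1, R.pol 0 m.1, R.pol 1 m.1]) :
    R.formFactor y j m ^ 2 ≤ 4 * R.weight m.1 ^ 2 := by
  have h1 := abs_pol_le R h m.2 j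
  have h2 : ∀ t : ℝ, |t| ≤ 1 → (R.pol m.2 m.1 j * t) ^ 2 ≤ 1 := fun t ht => by
    rw [sq_le_one_iff_abs_le_one, abs_mul]
    exact mul_le_one₀ h1 (abs_nonneg _) ht
  unfold Radiation.formFactor
  split_ifs with hj
  · have := h2 _ (Real.abs_cos_le_one (m.1 0 * y))
    rw [mul_pow]
    nlinarith [sq_nonneg (R.weight m.1)]
  · have := h2 _ (Real.abs_sin_le_one (m.1 0 * y))
    rw [mul_pow, neg_sq]
    nlinarith [sq_nonneg (R.weight m.1)]

/-- Cut-off version of `|k|⁻¹`, bounding the form factors. -/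
def Radiation.envelope (k : E3) : ℝ := (Metric.closedBall (0 : E3) R.Λ).indicator (fun k => ‖k‖⁻¹) k

lemma Radiation.measurable_envelope : Measurable R.envelope :=
  measurable_norm.inv.indicator measurableSet_closedBall

lemma Radiation.envelope_nonneg (k : E3) : 0 ≤ R.envelope k :=
  indicator_nonneg (fun _ _ => by positivity) _

lemma Radiation.ae_formFactor_sq_le (y : ℝ) :
    ∀ᵐ m ∂wallModeMeasure, m.1 ≠ 0 ∧ ∀ j, R.formFactor y j m ^ 2 ≤ 4 * R.envelope m.1 := by
  filter_upwards [ae_wall (ae_mode R.ae_pol)] with m hm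
  refine ⟨hm.1, fun j => (R.formFactor_sq_le y j hm.2.2).trans ?_⟩
  by_cases h : ‖m.1‖ ≤ R.Λ
  · have : R.envelope m.1 = ‖m.1‖⁻¹ := by simp [Radiation.envelope, h]
    rw [this]
    linarith [R.weight_sq_le hm.1]
  · rw [R.weight_eq_zero (not_le.1 h)]
    have := R.envelope_nonneg m.1
    nlinarith

/-- The factor `2` counts the polarizations. -/
lemma lintegral_wall_fst_le {f : E3 → ENNReal} (hf : AEMeasurable f volume) :
    ∫⁻ m, f m.1 ∂wallModeMeasure ≤ 2 * ∫⁻ k, f k := by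
  unfold wallModeMeasure
  have h := lintegral_prod_mul (μ := (volume : Measure E3).restrict {k | 0 < k 0})
    (ν := (Measure.count : Measure (Fin 2))) (f := f) (g := fun _ => 1) hf.restrict aemeasurable_const
  simp only [mul_one] at h
  rw [h, lintegral_const, one_mul, Measure.count_univ, mul_comm]
  simp only [ENat.card_eq_coe_fintype_card, Fintype.card_fin]
  gcongr
  · norm_num
  · exact Measure.restrict_le_self

/-- Square integrability of superpositions `∑ⱼ λⱼ ⊗ Tⱼ(|k|)`. -/
lemma Radiation.memLp_superposition (y : ℝ) {T : Fin 3 → ℝ × E3 → ℂ} (hT : ∀ j, Measurable (T j))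
    {b : ℝ → ℝ} (hbm : Measurable b) (hb0 : ∀ t, 0 < t → 0 ≤ b t)
    (hb : ∀ s j, ∫⁻ x, ‖T j (s, x)‖ₑ ^ 2 ∂atomMeasure y ≤ ENNReal.ofReal (b (Real.exp s)))
    (hint : Integrable fun k : E3 => R.envelope k * b ‖k‖) :
    MemLp (fun p : E3 × Mode => ∑ j, (R.formFactor y j p.2 : ℂ) * T j (Real.log ‖p.2.1‖, p.1)) 2
      (jointMeasure y) ∧
    ∫ p : E3 × Mode, ‖∑ j, (R.formFactor y j p.2 : ℂ) * T j (Real.log ‖p.2.1‖, p.1)‖ ^ 2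
      ∂jointMeasure y ≤ 72 * ∫ k, R.envelope k * b ‖k‖ := by
  set g : E3 × Mode → ℂ := fun p => ∑ j, (R.formFactor y j p.2 : ℂ) * T j (Real.log ‖p.2.1‖, p.1)
    with hg
  have hTm : ∀ j, Measurable fun p : E3 × Mode => T j (Real.log ‖p.2.1‖, p.1) := fun j =>
    (hT j).comp ((Real.measurable_log.comp (measurable_fst.comp measurable_snd).norm).prodMk
      measurable_fst)
  have hgm : AEMeasurable g (jointMeasure y) := by
    refine Finset.aemeasurable_fun_sum _ fun j _ => ?_
    have h1 : AEMeasurable (fun p : E3 × Mode => (R.formFactor y j p.2 : ℂ)) (jointMeasure y) :=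
      Complex.measurable_ofReal.comp_aemeasurable
        ((R.aemeasurable_formFactor y j).comp_quasiMeasurePreserving
          Measure.quasiMeasurePreserving_snd)
    exact h1.mul (hTm j).aemeasurable
  have hI0 : 0 ≤ ∫ k, R.envelope k * b ‖k‖ := by
    refine integral_nonneg_of_ae ?_
    filter_upwards [ae_ne_zero] with k hk
    exact mul_nonneg (R.envelope_nonneg k) (hb0 _ (norm_pos_iff.2 hk))
  have hle : ∫⁻ p, ‖g p‖ₑ ^ 2 ∂jointMeasure y ≤
      ENNReal.ofReal (72 * ∫ k, R.envelope k * b ‖k‖) := by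
    unfold jointMeasure
    rw [lintegral_prod_symm _ (hgm.enorm.pow_const 2)]
    -- At a fixed mode: `3` from Cauchy–Schwarz over the components, `4` from the form factor bound
    -- and `3` from the sum over `j`. The two polarizations turn `36` into `72`.
    have h1 : ∀ᵐ m ∂wallModeMeasure, ∫⁻ x, ‖g (x, m)‖ₑ ^ 2 ∂atomMeasure y ≤
        36 * ENNReal.ofReal (R.envelope m.1 * b ‖m.1‖) := by
      filter_upwards [R.ae_formFactor_sq_le y] with m hm
      have hexp : Real.exp (Real.log ‖m.1‖) = ‖m.1‖ := Real.exp_log (norm_pos_iff.2 hm.1)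
      have h2 : ∀ x, ‖g (x, m)‖ₑ ^ 2 ≤ 3 * ∑ j, ENNReal.ofReal (4 * R.envelope m.1) *
          ‖T j (Real.log ‖m.1‖, x)‖ₑ ^ 2 := by
        intro x
        have h3 : ‖g (x, m)‖ ^ 2 ≤ 3 * ∑ j, (4 * R.envelope m.1) *
            ‖T j (Real.log ‖m.1‖, x)‖ ^ 2 := by
          have h4 : ‖g (x, m)‖ ≤ ∑ j, ‖(R.formFactor y j m : ℂ) * T j (Real.log ‖m.1‖, x)‖ :=
            norm_sum_le _ _
          calc ‖g (x, m)‖ ^ 2 ≤ (∑ j, ‖(R.formFactor y j m : ℂ) * T j (Real.log ‖m.1‖, x)‖) ^ 2 := by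
                gcongr
            _ ≤ 3 * ∑ j, ‖(R.formFactor y j m : ℂ) * T j (Real.log ‖m.1‖, x)‖ ^ 2 := by
                have := sq_sum_le_card_mul_sum_sq (s := (Finset.univ : Finset (Fin 3)))
                  (f := fun j => ‖(R.formFactor y j m : ℂ) * T j (Real.log ‖m.1‖, x)‖)
                simpa using this
            _ ≤ _ := by
                gcongr with j
                rw [norm_mul, mul_pow, Complex.norm_real, Real.norm_eq_abs, sq_abs]
                gcongr
                exact hm.2 j
        have h5 := ENNReal.ofReal_le_ofReal h3
        rw [ENNReal.ofReal_pow (norm_nonneg _), ofReal_norm, ENNReal.ofReal_mul (by norm_num),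
          ENNReal.ofReal_sum_of_nonneg fun j _ => mul_nonneg
            (mul_nonneg (by norm_num) (R.envelope_nonneg _)) (sq_nonneg _)] at h5
        refine h5.trans (le_of_eq ?_)
        congr 1
        · norm_num
        · refine Finset.sum_congr rfl fun j _ => ?_
          rw [ENNReal.ofReal_mul (mul_nonneg (by norm_num) (R.envelope_nonneg _)),
            ENNReal.ofReal_pow (norm_nonneg _), ofReal_norm]
      have hTx : ∀ j, Measurable fun x => ‖T j (Real.log ‖m.1‖, x)‖ₑ ^ 2 := fun j =>
        (((hT j).comp (measurable_const.prodMk measurable_id)).enorm.pow_const 2)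
      refine (lintegral_mono h2).trans ?_
      rw [lintegral_const_mul _ (Finset.measurable_fun_sum _ fun j _ => (hTx j).const_mul _),
        lintegral_finsetSum _ fun j _ => (hTx j).const_mul _]
      simp_rw [fun j => lintegral_const_mul (μ := atomMeasure y)
        (ENNReal.ofReal (4 * R.envelope m.1)) (hTx j)]
      calc 3 * ∑ j, ENNReal.ofReal (4 * R.envelope m.1) *
            ∫⁻ x, ‖T j (Real.log ‖m.1‖, x)‖ₑ ^ 2 ∂atomMeasure y
          ≤ 3 * ∑ _j : Fin 3, ENNReal.ofReal (4 * R.envelope m.1) * ENNReal.ofReal (b ‖m.1‖) := by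
            gcongr with j
            have := hb (Real.log ‖m.1‖) j
            rwa [hexp] at this
        _ = _ := by
            rw [Finset.sum_const, Finset.card_univ, Fintype.card_fin, nsmul_eq_mul,
              ENNReal.ofReal_mul (by norm_num : (0 : ℝ) ≤ 4),
              ENNReal.ofReal_mul (R.envelope_nonneg _)]
            norm_num
            ring
    refine (lintegral_mono_ae h1).trans ?_
    have hbm' : Measurable fun k : E3 => ENNReal.ofReal (R.envelope k * b ‖k‖) :=
      (R.measurable_envelope.mul (hbm.comp measurable_norm)).ennreal_ofReal
    rw [lintegral_const_mul (μ := wallModeMeasure) (f := fun m : Mode =>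
      ENNReal.ofReal (R.envelope m.1 * b ‖m.1‖)) 36 (hbm'.comp measurable_fst)]
    have h6 := lintegral_wall_fst_le hbm'.aemeasurable
    refine (mul_le_mul_right h6 36).trans (le_of_eq ?_)
    rw [← ofReal_integral_eq_lintegral_ofReal hint, ENNReal.ofReal_mul (by norm_num), ← mul_assoc]
    · norm_num
    · filter_upwards [ae_ne_zero] with k hk
      exact mul_nonneg (R.envelope_nonneg k) (hb0 _ (norm_pos_iff.2 hk))
  have hmem : MemLp g 2 (jointMeasure y) := by
    refine ⟨hgm.aestronglyMeasurable, ?_⟩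
    by_contra h
    rw [not_lt, top_le_iff] at h
    have h7 := eLpNorm_two_sq (μ := jointMeasure y) g
    rw [h] at h7
    rw [← h7, ENNReal.top_pow two_ne_zero, top_le_iff] at hle
    exact ENNReal.ofReal_ne_top hle
  refine ⟨hmem, ?_⟩
  have h8 := eLpNorm_two_sq_eq_ofReal hmem
  rw [eLpNorm_two_sq] at h8
  rw [h8] at hle
  exact (ENNReal.ofReal_le_ofReal_iff (by positivity)).1 hle

/-- The envelope integrated against `1 + 1/|k|`. -/
lemma Radiation.integrable_envelope_mul (c : ℝ) :
    Integrable fun k : E3 => R.envelope k * (c * (1 + ‖k‖⁻¹)) := by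
  refine integrable_of_bound_inv_sq (M := 2 * |c|) (ρ := R.Λ) ?_ (fun k hk _ => ?_) fun k _ hk => ?_
  · exact (R.measurable_envelope.mul ((measurable_norm.inv.const_add 1).const_mul c)).aestronglyMeasurable
  · have h1 : R.envelope k ≤ ‖k‖⁻¹ := by
      unfold Radiation.envelope
      exact indicator_le_self' (fun _ _ => by positivity) _
    have h2 : 0 ≤ ‖k‖⁻¹ := by positivity
    have h3 : (‖k‖ ^ 2)⁻¹ = ‖k‖⁻¹ ^ 2 := by rw [inv_pow]
    rw [norm_mul, norm_mul, Real.norm_of_nonneg (R.envelope_nonneg k), Real.norm_eq_abs,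
      Real.norm_of_nonneg (by positivity : 0 ≤ 1 + ‖k‖⁻¹)]
    have h4 := inv_norm_le k
    calc R.envelope k * (|c| * (1 + ‖k‖⁻¹)) ≤ ‖k‖⁻¹ * (|c| * (1 + ‖k‖⁻¹)) := by gcongr
      _ = |c| * (‖k‖⁻¹ + (‖k‖ ^ 2)⁻¹) := by rw [h3]; ring
      _ ≤ |c| * (2 * (1 + (‖k‖ ^ 2)⁻¹)) := by
          gcongr
          have : 0 ≤ (‖k‖ ^ 2)⁻¹ := by positivity
          linarith
      _ = _ := by ring
  · have : R.envelope k = 0 := by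
      simp [Radiation.envelope, not_le.2 hk]
    rw [this, zero_mul]

/-- The logarithmically divergent integral that governs `‖Φ_#‖²`. -/
lemma Radiation.envelope_log {β : ℝ} (hβ : 0 < β) :
    (Integrable fun k : E3 => R.envelope k * (β / (2 * ‖k‖ * (β + ‖k‖)))) ∧
    ∫ k : E3, R.envelope k * (β / (2 * ‖k‖ * (β + ‖k‖))) =
      2 * Real.pi * β * Real.log ((β + R.Λ) / β) := by
  set f : ℝ → ℝ := (Iic R.Λ).indicator fun r => r⁻¹ * (β / (2 * r * (β + r))) with hf
  have e : (fun k : E3 => R.envelope k * (β / (2 * ‖k‖ * (β + ‖k‖)))) = fun k => f ‖k‖ := by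
    ext k
    by_cases h : ‖k‖ ≤ R.Λ <;> simp [hf, Radiation.envelope, h]
  -- The polar weight `r²` cancels both factors `1/r`; what is left integrates to a logarithm.
  have e2 : ∀ r ∈ Ioi (0 : ℝ), r ^ 2 * f r = (Iic R.Λ).indicator (fun r => β / 2 * (β + r)⁻¹) r := by
    intro r hr
    have hr0 : (0 : ℝ) < r := hr
    by_cases h : r ≤ R.Λ
    · simp only [hf, indicator, mem_Iic, h, if_true]
      field_simp
    · simp [hf, h]
  have hset : Iic R.Λ ∩ Ioi 0 = Ioc 0 R.Λ := by ext; simp [and_comm]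
  have hpos : ∀ r ∈ uIcc 0 R.Λ, 0 < β + r := by
    intro r hr
    rw [uIcc_of_le R.Λ_pos.le] at hr
    linarith [hr.1]
  have hii : IntervalIntegrable (fun r => (β + r)⁻¹) volume 0 R.Λ := by
    refine ContinuousOn.intervalIntegrable ?_
    exact ContinuousOn.inv₀ (by fun_prop) fun r hr => (hpos r hr).ne'
  constructor
  · rw [e, integrable_radial_iff]
    refine IntegrableOn.congr_fun ?_ (fun r hr => (e2 r hr).symm) measurableSet_Ioi
    rw [IntegrableOn, integrable_indicator_iff measurableSet_Iic, IntegrableOn,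
      Measure.restrict_restrict measurableSet_Iic, hset]
    exact ((intervalIntegrable_iff_integrableOn_Ioc_of_le R.Λ_pos.le).1 hii).const_mul _
  · rw [e, integral_radial, setIntegral_congr_fun measurableSet_Ioi e2,
      setIntegral_indicator measurableSet_Iic, inter_comm, hset, integral_const_mul,
      ← intervalIntegral.integral_of_le R.Λ_pos.le]
    have h1 : ∫ r in (0 : ℝ)..R.Λ, (β + r)⁻¹ = Real.log (β + R.Λ) - Real.log (β + 0) := by
      refine intervalIntegral.integral_eq_sub_of_hasDerivAt (f := fun r => Real.log (β + r))
        (fun r hr => ?_) hii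
      have := ((hasDerivAt_id r).const_add β).log (hpos r hr).ne'
      simpa using this
    rw [h1, add_zero, Real.log_div (by linarith [R.Λ_pos]) hβ.ne']
    ring

end FormFactors

/-! ### The vector `Φ_#` -/

section SharpField

lemma IsH10.add {y : ℝ} {u v : E3 → ℂ} {G K : Fin 3 → E3 → ℂ} (h : IsH10 y u G)
    (h' : IsH10 y v K) : IsH10 y (fun x => u x + v x) fun j x => G j x + K j x := by
  obtain ⟨h1, h2, η, h3, h4, h5⟩ := h
  obtain ⟨k1, k2, ζ, k3, k4, k5⟩ := h'
  have key : ∀ {a b : E3 → ℂ} {p q : ℕ → E3 → ℂ},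
      (∀ n, AEStronglyMeasurable (fun x => a x - p n x) (atomMeasure y)) →
      (∀ n, AEStronglyMeasurable (fun x => b x - q n x) (atomMeasure y)) →
      Tendsto (fun n => eLpNorm (fun x => a x - p n x) 2 (atomMeasure y)) atTop (𝓝 0) →
      Tendsto (fun n => eLpNorm (fun x => b x - q n x) 2 (atomMeasure y)) atTop (𝓝 0) →
      Tendsto (fun n => eLpNorm (fun x => a x + b x - (p n x + q n x)) 2 (atomMeasure y)) atTop
        (𝓝 0) := by
    intro a b p q ha hb h h'
    refine tendsto_of_tendsto_of_tendsto_of_le_of_le tendsto_const_nhds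
      (by simpa using h.add h') (fun _ => zero_le) fun n => ?_
    have e : (fun x => a x + b x - (p n x + q n x)) =
        (fun x => a x - p n x) + fun x => b x - q n x := by
      ext x; simp only [Pi.add_apply]; ring
    rw [e]
    exact eLpNorm_add_le (ha n) (hb n) (by norm_num)
  refine ⟨h1.add k1, fun j => (h2 j).add (k2 j), fun n x => η n x + ζ n x,
    fun n => (h3 n).add (k3 n), key (fun n => (h1.sub (h3 n).memLp).1)
      (fun n => (k1.sub (k3 n).memLp).1) h4 k4, fun j => ?_⟩
  have := key (fun n => ((h2 j).sub ((h3 n).memLp_deriv (unitVec j))).1)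
      (fun n => ((k2 j).sub ((k3 n).memLp_deriv (unitVec j))).1) (h5 j) (k5 j)
  refine this.congr fun n => ?_
  congr 1
  ext x
  rw [fderiv_fun_add ((h3 n).differentiable x) ((k3 n).differentiable x)]
  rfl

lemma IsH10.const_mul {y : ℝ} {u : E3 → ℂ} {G : Fin 3 → E3 → ℂ} (h : IsH10 y u G) (c : ℂ) :
    IsH10 y (fun x => c * u x) fun j x => c * G j x := by
  obtain ⟨h1, h2, η, h3, h4, h5⟩ := h
  have key : ∀ {a : E3 → ℂ} {p : ℕ → E3 → ℂ},
      Tendsto (fun n => eLpNorm (fun x => a x - p n x) 2 (atomMeasure y)) atTop (𝓝 0) →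
      Tendsto (fun n => eLpNorm (fun x => c * a x - c * p n x) 2 (atomMeasure y)) atTop (𝓝 0) := by
    intro a p h
    have := ENNReal.Tendsto.const_mul (a := ‖c‖ₑ) h (Or.inr enorm_ne_top)
    rw [mul_zero] at this
    refine this.congr fun n => ?_
    rw [← eLpNorm_const_smul]
    congr 1
    ext x
    simp only [Pi.smul_apply, smul_eq_mul]
    ring
  refine ⟨h1.const_mul c, fun j => (h2 j).const_mul c, fun n x => c * η n x,
    fun n => (h3 n).const_mul c, key h4, fun j => (key (h5 j)).congr fun n => ?_⟩
  congr 1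
  ext x
  rw [fderiv_const_mul ((h3 n).differentiable x)]
  rfl

lemma IsDirichletLaplacian.add {y : ℝ} {u v : E3 → ℂ} {G K : Fin 3 → E3 → ℂ} {w z : E3 → ℂ}
    (h : IsDirichletLaplacian y u G w) (h' : IsDirichletLaplacian y v K z) :
    IsDirichletLaplacian y (fun x => u x + v x) (fun j x => G j x + K j x)
      fun x => w x + z x := by
  refine ⟨h.1.add h'.1, h.2.1.add h'.2.1, fun η hη => ?_⟩
  rw [integral_eq_add (integrable_mul_L2 h.2.1 hη.memLp) (integrable_mul_L2 h'.2.1 hη.memLp)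
    (fun x => by ring), ← h.2.2 η hη, ← h'.2.2 η hη, ← Finset.sum_add_distrib]
  exact Finset.sum_congr rfl fun j _ => integral_eq_add
    (integrable_mul_L2 (h.1.2.1 j) (hη.memLp_deriv _))
    (integrable_mul_L2 (h'.1.2.1 j) (hη.memLp_deriv _)) fun x => by ring

lemma IsDirichletLaplacian.const_mul {y : ℝ} {u : E3 → ℂ} {G : Fin 3 → E3 → ℂ} {w : E3 → ℂ}
    (h : IsDirichletLaplacian y u G w) (c : ℂ) :
    IsDirichletLaplacian y (fun x => c * u x) (fun j x => c * G j x) fun x => c * w x := by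
  refine ⟨h.1.const_mul c, h.2.1.const_mul c, fun η hη => ?_⟩
  simp_rw [mul_assoc, integral_const_mul, ← Finset.mul_sum]
  rw [h.2.2 η hη]

/-- The vector `2 α^{1/2} i ∑ⱼ λ_y^{(j)} ⊗ Tⱼ`, with `Tⱼ` depending on `log |k|`. -/
def Radiation.superpose (R : Radiation) (α y : ℝ) (T : Fin 3 → ℝ × E3 → ℂ) (p : E3 × Mode) : ℂ :=
  2 * (Real.sqrt α : ℝ) * Complex.I *
    ∑ j, (R.formFactor y j p.2 : ℂ) * T j (Real.log ‖p.2.1‖, p.1)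

/-- The prefactor has squared modulus `4 α`, which turns `72` into `288 α`. -/
lemma Radiation.memLp_superpose (R : Radiation) {α : ℝ} (hα : 0 ≤ α) (y : ℝ)
    {T : Fin 3 → ℝ × E3 → ℂ}
    (hT : ∀ j, Measurable (T j)) (hL : ∀ s j, MemLp (fun x => T j (s, x)) 2 (atomMeasure y))
    {b : ℝ → ℝ} (hbm : Measurable b) (hb0 : ∀ t, 0 < t → 0 ≤ b t)
    (hb : ∀ s j, ∫ x, ‖T j (s, x)‖ ^ 2 ∂atomMeasure y ≤ b (Real.exp s))
    (hint : Integrable fun k : E3 => R.envelope k * b ‖k‖) :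
    MemLp (R.superpose α y T) 2 (jointMeasure y) ∧
    ∫ p, ‖R.superpose α y T p‖ ^ 2 ∂jointMeasure y ≤ 288 * α * ∫ k, R.envelope k * b ‖k‖ := by
  obtain ⟨h1, h2⟩ := R.memLp_superposition y hT hbm hb0 (fun s j => by
    rw [← eLpNorm_two_sq, eLpNorm_two_sq_eq_ofReal (hL s j)]
    exact ENNReal.ofReal_le_ofReal (hb s j)) hint
  refine ⟨h1.const_mul _, ?_⟩
  unfold Radiation.superpose
  have e : ‖(2 * (Real.sqrt α : ℝ) * Complex.I : ℂ)‖ ^ 2 = 4 * α := by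
    rw [norm_mul, norm_mul, Complex.norm_I, Complex.norm_real, Real.norm_eq_abs,
      abs_of_nonneg (Real.sqrt_nonneg _), mul_one, mul_pow, Real.sq_sqrt hα]
    norm_num
  simp_rw [norm_mul (2 * ((Real.sqrt α : ℝ) : ℂ) * Complex.I), mul_pow, e]
  rw [integral_const_mul]
  nlinarith

/-- Domain properties of `Φ = Φ_#`. -/
structure Radiation.IsSharpField (R : Radiation) (α y : ℝ) (Φ : E3 × Mode → ℂ)
    (G : Fin 3 → E3 × Mode → ℂ) (w : E3 × Mode → ℂ) : Prop where
  lap : IsDirichletLaplacianTensor y Φ G w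
  memLp_freq : MemLp (fun p => (‖p.2.1‖ : ℂ) * Φ p) 2 (jointMeasure y)
  memLp_wall : MemLp (fun p => (((y - p.1 0)⁻¹ : ℝ) : ℂ) * Φ p) 2 (jointMeasure y)
  memLp_source : MemLp (R.sharpSource α y) 2 (jointMeasure y)
  eq : R.sharpSource α y =ᵐ[jointMeasure y] fun p =>
      w p + ((-(α / ‖p.1‖) - groundEnergy α + ‖p.2.1‖ : ℝ) : ℂ) * Φ p
  norm_le : ∫ p, ‖Φ p‖ ^ 2 ∂jointMeasure y ≤
    288 * α * (2 * Real.pi * α ^ 2 * Real.log ((α ^ 2 + R.Λ) / α ^ 2))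

/-- The source is itself a superposition, with fibres that do not depend on the photon energy, so
the same `L²` estimate covers it. -/
lemma Radiation.sharpSource_eq (R : Radiation) (α y : ℝ) : R.sharpSource α y =
    R.superpose α y fun j q => (fderiv ℝ (groundState α) q.2 (unitVec j) : ℂ) := by
  ext p
  simp only [Radiation.sharpSource, Radiation.superpose, momentumGroundState, Finset.mul_sum]
  exact Finset.sum_congr rfl fun j _ => by ring

lemma Radiation.integrable_envelope_const (R : Radiation) (c : ℝ) :
    Integrable fun k : E3 => R.envelope k * c := by
  refine (R.integrable_envelope_mul c).mono (R.measurable_envelope.mul_const c).aestronglyMeasurable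
    (Eventually.of_forall fun k => ?_)
  have h : 0 ≤ ‖k‖⁻¹ := by positivity
  rw [norm_mul, norm_mul, norm_mul]
  gcongr
  rw [Real.norm_of_nonneg (by positivity : 0 ≤ 1 + ‖k‖⁻¹)]
  exact le_mul_of_one_le_right (norm_nonneg _) (by linarith)

lemma Radiation.memLp_sharpSource (R : Radiation) {α : ℝ} (hα : 0 < α) (y : ℝ) :
    MemLp (R.sharpSource α y) 2 (jointMeasure y) ∧
    ∫ p, ‖R.sharpSource α y p‖ ^ 2 ∂jointMeasure y ≤
      72 * α ^ 3 * ∫ k, R.envelope k := by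
  rw [R.sharpSource_eq]
  obtain ⟨h1, h2⟩ := R.memLp_superpose hα.le y
    (T := fun j q => (fderiv ℝ (groundState α) q.2 (unitVec j) : ℂ)) (b := fun _ => α ^ 2 / 4)
    (fun j => Complex.measurable_ofReal.comp ((measurable_fderiv_groundState α j).comp
      measurable_snd)) (fun s j => memLp_fderiv_groundState hα (atomMeasure_le y) j)
    measurable_const (fun _ _ => by positivity)
    (fun s j => integral_fderiv_groundState_sq_le hα y j) (R.integrable_envelope_const _)
  refine ⟨h1, h2.trans (le_of_eq ?_)⟩
  rw [integral_mul_const]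
  ring

/-- Measurable weights and Hardy type bounds for fibre resolvents. -/
lemma IsFiberResolvent.gradient_le {α y : ℝ} (hα : 0 < α) {j : Fin 3} {U : ℝ × E3 → ℂ}
    {D : Fin 3 → ℝ × E3 → ℂ} (h : IsFiberResolvent α y j U D) (s : ℝ) (i : Fin 3) :
    ∫ x, ‖D i (s, x) - drift α i x * U (s, x)‖ ^ 2 ∂atomMeasure y ≤
      1 / 2 + α ^ 2 / 32 * (Real.exp s)⁻¹ := by
  have hU := (h.isH10 s).1
  have h1 : ∫ x, ‖D i (s, x)‖ ^ 2 ∂atomMeasure y ≤ 1 / 4 :=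
    (Finset.single_le_sum (f := fun i => ∫ x, ‖D i (s, x)‖ ^ 2 ∂atomMeasure y)
      (fun _ _ => by positivity) (Finset.mem_univ i)).trans (h.boundD s)
  have h2 : ∫ x, ‖U (s, x)‖ ^ 2 ∂atomMeasure y ≤ 1 / 16 * (Real.exp s)⁻¹ := by
    rw [← div_eq_mul_inv, le_div_iff₀ (Real.exp_pos s), mul_comm]
    exact h.bound s
  calc _ ≤ ∫ x, (2 * ‖D i (s, x)‖ ^ 2 + α ^ 2 / 2 * ‖U (s, x)‖ ^ 2) ∂atomMeasure y := by
        refine integral_mono (integrable_norm_sq ((h.memLpD s i).sub (memLp_drift_mul α hU i)))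
          (((integrable_norm_sq (h.memLpD s i)).const_mul 2).add
            ((integrable_norm_sq hU).const_mul _)) fun x => ?_
        have h3 : ‖drift α i x * U (s, x)‖ ≤ α / 2 * ‖U (s, x)‖ := by
          rw [norm_mul]
          gcongr
          rw [drift, Complex.norm_real, Real.norm_eq_abs, abs_mul, abs_of_pos (half_pos hα)]
          exact mul_le_of_le_one_right (half_pos hα).le (abs_direction_le x i)
        have h4 := norm_sub_le (D i (s, x)) (drift α i x * U (s, x))
        have h5 := norm_nonneg (D i (s, x) - drift α i x * U (s, x))
        have h6 := norm_nonneg (drift α i x * U (s, x))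
        simp only
        nlinarith [sq_nonneg (‖D i (s, x)‖ - ‖drift α i x * U (s, x)‖),
          pow_le_pow_left₀ h6 h3 2, pow_le_pow_left₀ h5 h4 2]
    _ = 2 * ∫ x, ‖D i (s, x)‖ ^ 2 ∂atomMeasure y + α ^ 2 / 2 * ∫ x, ‖U (s, x)‖ ^ 2 ∂atomMeasure y := by
        rw [integral_eq_add ((integrable_norm_sq (h.memLpD s i)).const_mul 2)
          ((integrable_norm_sq hU).const_mul _) fun x => rfl, integral_const_mul,
          integral_const_mul]
    _ ≤ 2 * (1 / 4) + α ^ 2 / 2 * (1 / 16 * (Real.exp s)⁻¹) := by gcongr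
    _ = _ := by ring

/-- The hypothesis `hw` is a Hardy inequality; it is used for `|x|⁻¹` and for the inverse distance
to the wall. -/
lemma IsFiberResolvent.weight_le {α y : ℝ} (hα : 0 < α) {j : Fin 3} {U : ℝ × E3 → ℂ}
    {D : Fin 3 → ℝ × E3 → ℂ} (h : IsFiberResolvent α y j U D) {ρ : E3 → ℝ} (hρ : Measurable ρ)
    (hw : ∀ (v : E3 → ℂ) (G : Fin 3 → E3 → ℂ), IsH10 y v G →
      eLpNorm (fun x => (ρ x : ℂ) * v x) 2 (atomMeasure y) ^ 2 ≤
      4 * ∑ j, eLpNorm (G j) 2 (atomMeasure y) ^ 2) (s : ℝ) :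
    MemLp (fun x => (ρ x : ℂ) * U (s, x)) 2 (atomMeasure y) ∧
    ∫ x, ‖(ρ x : ℂ) * U (s, x)‖ ^ 2 ∂atomMeasure y ≤
      (6 + α ^ 2) * (1 + (Real.exp s)⁻¹) := by
  have h1 := hw _ _ (h.isH10 s)
  have h2 := memLp_of_weight_le hρ (h.isH10 s).1 (h.isH10 s).2.1 h1
  refine ⟨h2, ?_⟩
  rw [eLpNorm_two_sq_eq_ofReal h2] at h1
  simp_rw [fun i => eLpNorm_two_sq_eq_ofReal ((h.isH10 s).2.1 i)] at h1
  rw [← ENNReal.ofReal_sum_of_nonneg fun _ _ => by positivity] at h1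
  have e4 : (4 : ENNReal) = ENNReal.ofReal 4 := by norm_num
  rw [e4, ← ENNReal.ofReal_mul (by norm_num), ENNReal.ofReal_le_ofReal_iff (by positivity)] at h1
  have h3 := Finset.sum_le_sum fun i (_ : i ∈ Finset.univ) => h.gradient_le hα s i
  rw [Finset.sum_const, Finset.card_univ, Fintype.card_fin, nsmul_eq_mul] at h3
  have h4 : 0 < (Real.exp s)⁻¹ := by positivity
  push_cast at h3
  nlinarith [sq_nonneg α, mul_pos h4 (pow_pos hα 2)]

/-- Add `α²` times the bound on `t ‖U‖²` to the bound on `t² ‖U‖²`, where `t = eˢ`. The first is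
good for `t` below `α²`, the second above; this crossover produces the logarithm in `‖Φ_#‖²`. -/
lemma IsFiberResolvent.norm_sq_le {α y : ℝ} (hα : 0 < α) {j : Fin 3} {U : ℝ × E3 → ℂ}
    {D : Fin 3 → ℝ × E3 → ℂ} (h : IsFiberResolvent α y j U D) (s : ℝ) :
    ∫ x, ‖U (s, x)‖ ^ 2 ∂atomMeasure y ≤
      α ^ 2 / (2 * Real.exp s * (α ^ 2 + Real.exp s)) := by
  have h0 := Real.exp_pos s
  rw [le_div_iff₀ (by positivity)]
  have h1 := h.bound s
  have h2 := h.bound' s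
  nlinarith [mul_le_mul_of_nonneg_left h1 (sq_nonneg α)]

lemma Radiation.exists_isSharpField (R : Radiation) {α : ℝ} (hα : 0 < α) (y : ℝ) :
    ∃ Φ G w, R.IsSharpField α y Φ G w := by
  choose U D h using exists_isFiberResolvent hα y
  set S : Fin 3 → ℝ × E3 → ℂ := fun j q => (fderiv ℝ (groundState α) q.2 (unitVec j) : ℂ) with hS
  have hbU : Measurable fun t : ℝ => α ^ 2 / (2 * t * (α ^ 2 + t)) := by fun_prop
  have hc : ∀ c : ℝ, Measurable fun t : ℝ => c * (1 + t⁻¹) := fun c => by fun_prop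
  have hΦ := R.memLp_superpose hα.le y (T := U) (fun j => (h j).meas) (fun s j => ((h j).isH10 s).1)
    hbU (fun t ht => by positivity) (fun s j => (h j).norm_sq_le hα s)
    (R.envelope_log (by positivity : 0 < α ^ 2)).1
  have hd : ∀ i, Measurable (drift α i) := fun i => by
    unfold drift
    exact Complex.measurable_ofReal.comp
      (((measurable_coord i).div measurable_norm).const_mul _)
  have hG := fun i => R.memLp_superpose hα.le y
    (T := fun j q => D j i q - drift α i q.2 * U j q)
    (fun j => ((h j).measD i).sub (((hd i).comp measurable_snd).mul (h j).meas))
    (fun s j => ((h j).isH10 s).2.1 i) (hc (1 + α ^ 2)) (fun t ht => by positivity)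
    (fun s j => ((h j).gradient_le hα s i).trans (by
      have : 0 < (Real.exp s)⁻¹ := by positivity
      nlinarith [sq_nonneg α, mul_pos this (pow_pos hα 2)]))
    (R.integrable_envelope_mul _)
  have hK := R.memLp_superpose hα.le y
    (T := fun j q => (Real.exp q.1 : ℂ) * U j q) (b := fun _ => α ^ 2 / 4)
    (fun j => (Complex.measurable_ofReal.comp (Real.measurable_exp.comp measurable_fst)).mul
      (h j).meas)
    (fun s j => ((h j).isH10 s).1.const_mul ((Real.exp s : ℝ) : ℂ)) measurable_const (fun t ht => by positivity)
    (fun s j => by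
      simp_rw [norm_mul, mul_pow, Complex.norm_real, Real.norm_eq_abs, sq_abs]
      rw [integral_const_mul]
      exact (h j).bound' s) (R.integrable_envelope_const _)
  have hW : ∀ ρ : E3 → ℝ, Measurable ρ → (∀ (v : E3 → ℂ) (G : Fin 3 → E3 → ℂ), IsH10 y v G →
      eLpNorm (fun x => (ρ x : ℂ) * v x) 2 (atomMeasure y) ^ 2 ≤
      4 * ∑ j, eLpNorm (G j) 2 (atomMeasure y) ^ 2) →
      MemLp (fun p => (ρ p.1 : ℂ) * R.superpose α y U p) 2 (jointMeasure y) := by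
    intro ρ hρ hw
    have := R.memLp_superpose hα.le y
      (T := fun j q => (ρ q.2 : ℂ) * U j q)
      (fun j => (Complex.measurable_ofReal.comp (hρ.comp measurable_snd)).mul (h j).meas)
      (fun s j => ((h j).weight_le hα hρ hw s).1) (hc (6 + α ^ 2)) (fun t ht => by positivity)
      (fun s j => ((h j).weight_le hα hρ hw s).2) (R.integrable_envelope_mul _)
    refine this.1.ae_eq (Eventually.of_forall fun p => ?_)
    simp only [Radiation.superpose, Finset.mul_sum]
    exact Finset.sum_congr rfl fun j _ => by ring
  have hdiv := hW (fun x => ‖x‖⁻¹) measurable_norm.inv fun v G hv => hv.hardy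
  have hwall := hW (fun x => (y - x 0)⁻¹) ((measurable_coord 0).const_sub y).inv
    fun v G hv => hv.hardy_wall
  have hsrc := (R.memLp_sharpSource hα y).1
  have hne : ∀ᵐ p ∂jointMeasure y, p.2.1 ≠ 0 := by
    have := ae_joint_snd (y := y) (R.ae_formFactor_sq_le y)
    filter_upwards [this] with p hp using hp.1
  have hfreq : MemLp (fun p => (‖p.2.1‖ : ℂ) * R.superpose α y U p) 2 (jointMeasure y) := by
    refine hK.1.ae_eq ?_
    filter_upwards [hne] with p hp
    simp only [Radiation.superpose, Real.exp_log (norm_pos_iff.2 hp), Finset.mul_sum]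
    exact Finset.sum_congr rfl fun j _ => by ring
  -- The value of `-Δ Φ` is read off from the equation. It is square integrable because `Φ/|x|` is,
  -- by Hardy, and `|k| Φ` is, by the bound on `t² ‖U‖²`.
  set w : E3 × Mode → ℂ := fun p => R.sharpSource α y p + (α : ℂ) *
    (((‖p.1‖⁻¹ : ℝ) : ℂ) * R.superpose α y U p) + (groundEnergy α : ℂ) * R.superpose α y U p
    - (‖p.2.1‖ : ℂ) * R.superpose α y U p with hw
  have hwL : MemLp w 2 (jointMeasure y) :=
    ((hsrc.add (hdiv.const_mul _)).add (hΦ.1.const_mul _)).sub hfreq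
  refine ⟨_, fun i => R.superpose α y fun j q => D j i q - drift α i q.2 * U j q, w,
    ⟨hΦ.1, fun i => (hG i).1, hwL, ?_⟩, hfreq, hwall, hsrc, ?_, ?_⟩
  · filter_upwards [R.ae_formFactor_sq_le y] with m hm
    have hexp : Real.exp (Real.log ‖m.1‖) = ‖m.1‖ := Real.exp_log (norm_pos_iff.2 hm.1)
    have hj : ∀ j, IsDirichletLaplacian y (fun x => U j (Real.log ‖m.1‖, x))
        (fun i x => D j i (Real.log ‖m.1‖, x) - drift α i x * U j (Real.log ‖m.1‖, x))
        (fun x => (fderiv ℝ (groundState α) x (unitVec j) : ℂ) +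
          ((α * ‖x‖⁻¹ + groundEnergy α - ‖m.1‖ : ℝ) : ℂ) * U j (Real.log ‖m.1‖, x)) := by
      intro j
      refine ⟨(h j).isH10 _, ?_, ?_⟩
      · have h1 := ((h j).isH10 (Real.log ‖m.1‖)).memLp_div_norm
        have h2 := ((memLp_fderiv_groundState hα (atomMeasure_le y) j).add
          (h1.const_mul (α : ℂ))).add
          (((h j).isH10 (Real.log ‖m.1‖)).1.const_mul ((groundEnergy α - ‖m.1‖ : ℝ) : ℂ))
        refine h2.ae_eq (Eventually.of_forall fun x => ?_)
        simp only [Pi.add_apply]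
        push_cast
        ring
      · have := (h j).weak (Real.log ‖m.1‖)
        rwa [hexp] at this
    -- At a fixed mode `Φ` is a combination of three fibre solutions with constant coefficients.
    have hsum := (((hj 0).const_mul (2 * (Real.sqrt α : ℝ) * Complex.I * R.formFactor y 0 m)).add
      ((hj 1).const_mul (2 * (Real.sqrt α : ℝ) * Complex.I * R.formFactor y 1 m))).add
      ((hj 2).const_mul (2 * (Real.sqrt α : ℝ) * Complex.I * R.formFactor y 2 m))
    convert hsum using 1
    · ext x
      simp only [Radiation.superpose, Fin.sum_univ_three]
      ring
    · ext i x
      simp only [Radiation.superpose, Fin.sum_univ_three]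
      ring
    · ext x
      simp only [hw, R.sharpSource_eq, Radiation.superpose, Fin.sum_univ_three]
      push_cast
      ring
  · filter_upwards with p
    simp only [hw]
    push_cast
    ring
  · refine hΦ.2.trans (le_of_eq ?_)
    rw [(R.envelope_log (by positivity : 0 < α ^ 2)).2]

lemma Radiation.IsSharpField.isPhiSharp {R : Radiation} {α y : ℝ} {Φ : E3 × Mode → ℂ}
    {G : Fin 3 → E3 × Mode → ℂ} {w : E3 × Mode → ℂ} (h : R.IsSharpField α y Φ G w) :
    R.IsPhiSharp α y Φ := ⟨G, w, h.lap, h.memLp_freq, h.memLp_source, h.eq⟩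

end SharpField

/-! ### The vector `Φ_*¹` vanishes -/

section PhiStar

variable (R : Radiation)

lemma Radiation.weight_sq_le_envelope {k : E3} (hk : k ≠ 0) : R.weight k ^ 2 ≤ R.envelope k := by
  by_cases h : ‖k‖ ≤ R.Λ
  · have : R.envelope k = ‖k‖⁻¹ := by simp [Radiation.envelope, h]
    rw [this]
    exact R.weight_sq_le hk
  · rw [R.weight_eq_zero (not_le.1 h)]
    simpa using R.envelope_nonneg k

lemma Radiation.integrable_envelope : Integrable R.envelope := by
  simpa using R.integrable_envelope_const 1

lemma Radiation.aemeasurable_freeFormFactor (j : Fin 3) :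
    AEMeasurable (R.freeFormFactor j) modeMeasure :=
  (R.aemeasurable_weight.comp_quasiMeasurePreserving
    Measure.quasiMeasurePreserving_fst).mul (R.aemeasurable_pol j)

lemma Radiation.integrable_freeFormFactor_mul (i j : Fin 3) {t : ℝ} (ht : 0 < t) :
    Integrable (fun q => R.freeFormFactor i q * R.freeFormFactor j q * (‖q.1‖ + t)⁻¹)
      modeMeasure := by
  have h1 : Integrable (fun q : Mode => R.envelope q.1 * t⁻¹) modeMeasure := by
    have := (R.integrable_envelope.mul_const t⁻¹).mul_prod
      (integrable_const (μ := (Measure.count : Measure (Fin 2))) (1 : ℝ))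
    simpa [modeMeasure] using this
  refine h1.mono' (((R.aemeasurable_freeFormFactor i).mul
    (R.aemeasurable_freeFormFactor j)).mul (by fun_prop)).aestronglyMeasurable ?_
  filter_upwards [ae_mode R.ae_pol] with q hq
  have hp := fun j => abs_pol_le R hq.2.2 q.2 j
  have e : R.freeFormFactor i q * R.freeFormFactor j q =
      R.weight q.1 ^ 2 * (R.pol q.2 q.1 i * R.pol q.2 q.1 j) := by
    unfold Radiation.freeFormFactor; ring
  have h0 := norm_nonneg q.1
  rw [e, norm_mul, norm_mul, Real.norm_of_nonneg (sq_nonneg _), Real.norm_eq_abs, abs_mul,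
    norm_inv, Real.norm_of_nonneg (by positivity)]
  have h2 : |R.pol q.2 q.1 i| * |R.pol q.2 q.1 j| ≤ 1 :=
    mul_le_one₀ (hp i) (abs_nonneg _) (hp j)
  have h3 : (‖q.1‖ + t)⁻¹ ≤ t⁻¹ := by
    apply inv_anti₀ ht; linarith
  have h4 : R.weight q.1 ^ 2 * (|R.pol q.2 q.1 i| * |R.pol q.2 q.1 j|) ≤ R.envelope q.1 :=
    (mul_le_of_le_one_right (sq_nonneg _) h2).trans (R.weight_sq_le_envelope hq.1)
  exact mul_le_mul h4 h3 (by positivity) (R.envelope_nonneg _)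

lemma inner_eq_sum (a b : E3) : inner ℝ a b = ∑ j, a j * b j := by
  simp [PiLp.inner_apply, mul_comm]

/-- Parseval for `⟨P, E⟩ = 0` in the basis `(k/|k|, e₁, e₂)`: the polarization part is minus the
longitudinal part. -/
lemma sum_pol_mul {k P E : E3} (h : Orthonormal ℝ ![‖k‖⁻¹ • k, R.pol 0 k, R.pol 1 k])
    (hPE : inner ℝ P E = 0) :
    ∑ γ, inner ℝ P (R.pol γ k) * inner ℝ E (R.pol γ k) =
      -((‖k‖⁻¹) ^ 2 * inner ℝ P k * inner ℝ E k) := by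
  have hc : Fintype.card (Fin 3) = Module.finrank ℝ E3 := by simp
  set b := (basisOfOrthonormalOfCardEqFinrank h hc).toOrthonormalBasis (by simpa using h)
  have hb : ∀ i, b i = ![‖k‖⁻¹ • k, R.pol 0 k, R.pol 1 k] i := fun i => by simp [b]
  have := b.sum_inner_mul_inner P E
  simp only [hb, hPE, Fin.sum_univ_three, Matrix.cons_val_zero, Matrix.cons_val_one,
    Matrix.cons_val, inner_smul_left, inner_smul_right, map_inv₀, conj_trivial] at this
  rw [Fin.sum_univ_two, real_inner_comm (R.pol 0 k) E, real_inner_comm (R.pol 1 k) E]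
  rw [real_inner_comm k E]
  linear_combination this

/-- The photon pair correlation is isotropic, hence vanishes on orthogonal directions. -/
lemma Radiation.integral_pair_eq_zero {P E : E3} (hPE : inner ℝ P E = 0) {t : ℝ}
    (ht : 0 < t) :
    ∫ q, (∑ j, P j * R.freeFormFactor j q) * (∑ i, E i * R.freeFormFactor i q) * (‖q.1‖ + t)⁻¹
      ∂modeMeasure = 0 := by
  have hint : Integrable (fun q => (∑ j, P j * R.freeFormFactor j q) *
      (∑ i, E i * R.freeFormFactor i q) * (‖q.1‖ + t)⁻¹) modeMeasure := by
    have : Integrable (fun q => ∑ j, ∑ i, (P j * E i) *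
        (R.freeFormFactor j q * R.freeFormFactor i q * (‖q.1‖ + t)⁻¹)) modeMeasure :=
      integrable_finsetSum _ fun j _ => integrable_finsetSum _ fun i _ =>
        (R.integrable_freeFormFactor_mul j i ht).const_mul _
    refine this.congr (Eventually.of_forall fun q => ?_)
    simp only [Fin.sum_univ_three]
    ring
  unfold modeMeasure at hint ⊢
  rw [integral_prod _ hint]
  set g : E3 → ℝ := fun k => -(R.weight k ^ 2 * (‖k‖⁻¹ ^ 2 * inner ℝ P k * inner ℝ E k) *
    (‖k‖ + t)⁻¹) with hg
  have h1 : ∀ᵐ k : E3, ∫ γ, (∑ j, P j * R.freeFormFactor j (k, γ)) *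
      (∑ i, E i * R.freeFormFactor i (k, γ)) * (‖k‖ + t)⁻¹ ∂Measure.count = g k := by
    filter_upwards [R.ae_pol] with k hk
    have e : ∀ (Q : E3) γ, ∑ j, Q j * R.freeFormFactor j (k, γ) =
        R.weight k * inner ℝ Q (R.pol γ k) := fun Q γ => by
      rw [inner_eq_sum, Finset.mul_sum]
      exact Finset.sum_congr rfl fun j _ => by unfold Radiation.freeFormFactor; ring
    simp_rw [e]
    rw [integral_count, ← Finset.sum_mul]
    have h2 : ∑ γ, R.weight k * inner ℝ P (R.pol γ k) * (R.weight k * inner ℝ E (R.pol γ k)) =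
        R.weight k ^ 2 * ∑ γ, inner ℝ P (R.pol γ k) * inner ℝ E (R.pol γ k) := by
      rw [Finset.mul_sum]
      exact Finset.sum_congr rfl fun j _ => by ring
    rw [h2, sum_pol_mul R hk.2.2 hPE]
    simp only [hg]
    ring
  rw [integral_congr_ae h1]
  -- This reflection fixes `P` and reverses `E`, so the integrand is odd under it. The
  -- polarizations, which need not transform well under rotations, have been summed out first.
  set T : E3 ≃ₗᵢ[ℝ] E3 := (ℝ ∙ E)ᗮ.reflection with hT
  have hTE : T E = -E := Submodule.reflection_orthogonalComplement_singleton_eq_neg E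
  have hTP : T P = P := by
    refine Submodule.reflection_mem_subspace_eq_self ?_
    rw [Submodule.mem_orthogonal_singleton_iff_inner_right, real_inner_comm]
    exact hPE
  have hTT : ∀ x, T (T x) = x := fun x => Submodule.reflection_reflection _ x
  have hodd : ∀ k, g (T k) = -g k := by
    intro k
    have e1 : inner ℝ P (T k) = inner ℝ P k := by
      rw [← T.inner_map_map, hTT, hTP]
    have e2 : inner ℝ E (T k) = -inner ℝ E k := by
      rw [← T.inner_map_map, hTT, hTE, inner_neg_left]
    have e3 : R.weight (T k) = R.weight k := by
      simp only [Radiation.weight, T.norm_map]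
    simp only [hg, e1, e2, e3, T.norm_map]
    ring
  have h3 : ∫ k, g (T k) = ∫ k, g k := T.measurePreserving.integral_comp
    T.toHomeomorph.measurableEmbedding g
  simp_rw [hodd] at h3
  rw [integral_neg] at h3
  linarith

/-! ### Explicit form and vanishing of `Φ_*¹` -/

lemma create_vacuum (f : Mode → ℂ) (m : Fin 1 → Mode) : create f vacuum m = f (m 0) := by
  change ((Real.sqrt ((0 : ℕ) + 1))⁻¹ : ℝ) * ∑ i : Fin 1, f (m i) * 1 = _
  simp

lemma create_one (f : Mode → ℂ) (Ψ : (Fin 1 → Mode) → ℂ) (m : Fin 2 → Mode) :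
    create f Ψ m = ((Real.sqrt 2)⁻¹ : ℝ) * (f (m 0) * Ψ (fun _ => m 1) + f (m 1) * Ψ fun _ => m 0) := by
  change ((Real.sqrt ((1 : ℕ) + 1))⁻¹ : ℝ) * ∑ i : Fin 2, f (m i) * Ψ (fun l : Fin 1 => m (i.succAbove l)) = _
  have e : ∀ z : Fin 1, (0 : Fin 2).succAbove z = 1 := fun z => by fin_cases z; rfl
  have e' : ∀ z : Fin 1, (1 : Fin 2).succAbove z = 0 := fun z => by fin_cases z; rfl
  rw [Fin.sum_univ_two]
  simp only [e, e']
  norm_num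

/-- The two orderings of the photons contribute equally, and `2/√2 = √2`. -/
lemma Radiation.twoPhoton_cons (q p : Mode) :
    R.twoPhoton (Fin.cons q fun _ => p) =
      ((Real.sqrt 2 * (∑ i, R.freeFormFactor i p * R.freeFormFactor i q) * (‖q.1‖ + ‖p.1‖)⁻¹ : ℝ)
        : ℂ) := by
  have hs : Real.sqrt 2 = (Real.sqrt 2)⁻¹ * 2 := by
    have h2 : Real.sqrt 2 ≠ 0 := by positivity
    field_simp
    rw [Real.sq_sqrt (by norm_num)]
  have e1 : (Fin.cons q (fun _ => p) : Fin 2 → Mode) 1 = p := rfl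
  simp only [Radiation.twoPhoton, fieldEnergyInv, create_one, create_vacuum, Fin.sum_univ_two,
    Fin.cons_zero, e1, Fin.sum_univ_three]
  have hs' := congrArg (fun t : ℝ => (t : ℂ)) hs
  push_cast at hs' ⊢
  linear_combination -((‖q.1‖ : ℂ) + ‖p.1‖)⁻¹ *
    (R.freeFormFactor 0 p * R.freeFormFactor 0 q + R.freeFormFactor 1 p * R.freeFormFactor 1 q +
      R.freeFormFactor 2 p * R.freeFormFactor 2 q) * hs'

lemma Radiation.phiStar_eq (p : Mode) :
    R.phiStar p = ((‖p.1‖⁻¹ * Real.sqrt 2 * ∑ j, p.1 j * ∫ q, Real.sqrt 2 * R.freeFormFactor j q *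
      (∑ i, R.freeFormFactor i p * R.freeFormFactor i q) * (‖q.1‖ + ‖p.1‖)⁻¹ ∂modeMeasure : ℝ)
        : ℂ) := by
  have e : ∀ j q, conj (R.freeFormFactor j q : ℂ) * R.twoPhoton (Fin.cons q fun _ => p) =
      ((Real.sqrt 2 * R.freeFormFactor j q *
      (∑ i, R.freeFormFactor i p * R.freeFormFactor i q) * (‖q.1‖ + ‖p.1‖)⁻¹ : ℝ) : ℂ) := by
    intro j q
    rw [R.twoPhoton_cons, Complex.conj_ofReal, ← Complex.ofReal_mul]
    congr 1
    ring
  have h : ∀ j, annihilate (fun q => (R.freeFormFactor j q : ℂ)) R.twoPhoton (fun _ => p) =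
      ((Real.sqrt 2 * ∫ q, Real.sqrt 2 * R.freeFormFactor j q *
      (∑ i, R.freeFormFactor i p * R.freeFormFactor i q) * (‖q.1‖ + ‖p.1‖)⁻¹ ∂modeMeasure : ℝ)
        : ℂ) := by
    intro j
    rw [Complex.ofReal_mul, ← integral_complex_ofReal]
    change ((Real.sqrt ((1 : ℕ) + 1) : ℝ) : ℂ) * _ = _
    simp_rw [e]
    norm_num
  simp only [Radiation.phiStar, fieldEnergyInv, fieldMomentum, h]
  push_cast
  simp only [Finset.univ_unique, Finset.sum_singleton, Finset.mul_sum]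
  exact Finset.sum_congr rfl fun j _ => by ring

/-- Up to a scalar, `Φ_*¹` is the pair integral in the directions `P = p` and `E = e_γ(p)`, which
are orthogonal. -/
lemma Radiation.phiStar_ae_eq_zero : ∀ᵐ p ∂modeMeasure, R.phiStar p = 0 := by
  filter_upwards [ae_mode R.ae_pol] with p hp
  have ht : 0 < ‖p.1‖ := norm_pos_iff.2 hp.1
  rw [R.phiStar_eq]
  have h2 : ∑ j, p.1 j * ∫ q, Real.sqrt 2 * R.freeFormFactor j q *
      (∑ i, R.freeFormFactor i p * R.freeFormFactor i q) * (‖q.1‖ + ‖p.1‖)⁻¹ ∂modeMeasure =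
      Real.sqrt 2 * R.weight p.1 * ∫ q, (∑ j, p.1 j * R.freeFormFactor j q) *
        (∑ i, R.pol p.2 p.1 i * R.freeFormFactor i q) * (‖q.1‖ + ‖p.1‖)⁻¹ ∂modeMeasure := by
    simp_rw [← integral_const_mul]
    rw [← integral_finsetSum]
    · refine integral_congr_ae (Eventually.of_forall fun q => ?_)
      simp only [Radiation.freeFormFactor, Fin.sum_univ_three]
      ring
    · intro j _
      have : Integrable (fun q => ∑ i, (p.1 j * Real.sqrt 2 * R.freeFormFactor i p) *
          (R.freeFormFactor j q * R.freeFormFactor i q * (‖q.1‖ + ‖p.1‖)⁻¹)) modeMeasure :=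
        integrable_finsetSum _ fun i _ => (R.integrable_freeFormFactor_mul j i ht).const_mul _
      refine this.congr (Eventually.of_forall fun q => ?_)
      simp only [Fin.sum_univ_three]
      ring
  have horth : inner ℝ p.1 (R.pol p.2 p.1) = 0 := by
    have h0 := hp.2.2.2 (show (0 : Fin 3) ≠ 1 by decide)
    have h1 := hp.2.2.2 (show (0 : Fin 3) ≠ 2 by decide)
    simp only [Matrix.cons_val_zero, Matrix.cons_val_one, Matrix.cons_val, inner_smul_left,
      map_inv₀, conj_trivial, mul_eq_zero, inv_eq_zero, ht.ne', false_or] at h0 h1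
    generalize p.2 = γ
    fin_cases γ
    · exact h0
    · exact h1
  rw [h2, R.integral_pair_eq_zero horth ht]
  simp

lemma Radiation.phiStarNormSq_eq_zero : R.phiStarNormSq = 0 := by
  refine integral_eq_zero_of_ae ?_
  filter_upwards [R.phiStar_ae_eq_zero] with p hp
  simp [hp]

/-- The one-photon component of the trial vector is `Φ`, fibre by fibre. -/
lemma Radiation.trial_snd (θ : ℝ → ℝ) (α y : ℝ) (Φ : E3 × Mode → ℂ) :
    ∀ᵐ m ∂wallModeMeasure, ∀ x, (R.trial θ α y Φ).2 (x, m) = Φ (x, m) := by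
  filter_upwards [ae_wall R.phiStar_ae_eq_zero] with m hm x
  simp [Radiation.trial, Radiation.phiStarWall, hm]

end PhiStar

/-! ### The localized ground state -/

section Localization

lemma tendsto_eLpNorm_of_dominated {X : Type*} [MeasurableSpace X] {μ : Measure X}
    {f : ℕ → X → ℂ} {g : X → ℂ} (hf : ∀ n, AEStronglyMeasurable (f n) μ) (hg : MemLp g 2 μ)
    (hle : ∀ n, ∀ᵐ x ∂μ, ‖f n x‖ ≤ ‖g x‖)
    (hlim : ∀ᵐ x ∂μ, Tendsto (fun n => f n x) atTop (𝓝 0)) :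
    Tendsto (fun n => eLpNorm (f n) 2 μ) atTop (𝓝 0) := by
  have h1 : Tendsto (fun n => ∫⁻ x, ‖f n x‖ₑ ^ 2 ∂μ) atTop (𝓝 (∫⁻ _, 0 ∂μ)) := by
    refine tendsto_lintegral_of_dominated_convergence' (fun x => ‖g x‖ₑ ^ 2)
      (fun n => (hf n).enorm.pow_const 2) (fun n => ?_) ?_ ?_
    · filter_upwards [hle n] with x hx
      gcongr
      exact enorm_le_iff_norm_le.2 hx
    · rw [← eLpNorm_two_sq]
      exact ENNReal.pow_ne_top hg.2.ne
    · filter_upwards [hlim] with x hx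
      simpa using ENNReal.Tendsto.pow (n := 2) hx.enorm
  rw [lintegral_zero] at h1
  simp_rw [← eLpNorm_two_sq] at h1
  have h2 := h1.ennrpow_const (1 / 2 : ℝ)
  simp_rw [← ENNReal.rpow_natCast, ← ENNReal.rpow_mul] at h2
  simpa using h2

/-- The spatial cut-off `χ_y`. -/
def cutoff (θ : ℝ → ℝ) (y : ℝ) (x : E3) : ℝ := θ (‖x‖ / y)

variable {θ : ℝ → ℝ}

/-- The norm is not smooth at the origin only, and near the origin `θ` is constant. -/
lemma IsLocalizer.contDiff_norm (hθ : IsLocalizer θ) : ContDiff ℝ ∞ fun x : E3 => θ ‖x‖ := by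
  rw [contDiff_iff_contDiffAt]
  intro x
  by_cases hx : x = 0
  · subst hx
    have : (fun x : E3 => θ ‖x‖) =ᶠ[𝓝 0] fun _ => 1 := by
      filter_upwards [Metric.ball_mem_nhds (0 : E3) (show (0 : ℝ) < 1 / 4 by norm_num)] with x hx
      exact hθ.one _ (by simpa using (mem_ball_zero_iff.1 hx).le)
    exact contDiffAt_const.congr_of_eventuallyEq this
  · exact hθ.smooth.contDiffAt.comp x (contDiffAt_norm ℝ hx)

lemma cutoff_eq {y : ℝ} (hy : 0 < y) : cutoff θ y = fun x : E3 => (fun z : E3 => θ ‖z‖) (y⁻¹ • x) := by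
  ext x
  simp only [cutoff, norm_smul, norm_inv, Real.norm_of_nonneg hy.le]
  rw [div_eq_inv_mul]

variable {y : ℝ}

lemma IsLocalizer.contDiff_cutoff (hθ : IsLocalizer θ) (hy : 0 < y) : ContDiff ℝ ∞ (cutoff θ y) := by
  rw [cutoff_eq hy]
  exact hθ.contDiff_norm.comp (contDiff_id.const_smul _)

lemma IsLocalizer.cutoff_one (hθ : IsLocalizer θ) (hy : 0 < y) {x : E3} (hx : ‖x‖ ≤ y / 4) :
    cutoff θ y x = 1 := hθ.one _ (by rw [div_le_iff₀ hy]; linarith)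

lemma IsLocalizer.cutoff_zero (hθ : IsLocalizer θ) (hy : 0 < y) {x : E3} (hx : y / 3 ≤ ‖x‖) :
    cutoff θ y x = 0 := hθ.zero _ (by rw [le_div_iff₀ hy]; linarith)

lemma IsLocalizer.cutoff_mem (hθ : IsLocalizer θ) (y : ℝ) (x : E3) :
    0 ≤ cutoff θ y x ∧ cutoff θ y x ≤ 1 := hθ.mem _

/-- First and second derivatives of the cut-off. -/
def cutoffDeriv (θ : ℝ → ℝ) (y : ℝ) (j : Fin 3) (x : E3) : ℝ := fderiv ℝ (cutoff θ y) x (unitVec j)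

def cutoffDeriv₂ (θ : ℝ → ℝ) (y : ℝ) (j : Fin 3) (x : E3) : ℝ :=
  fderiv ℝ (cutoffDeriv θ y j) x (unitVec j)

lemma IsLocalizer.contDiff_cutoffDeriv (hθ : IsLocalizer θ) (hy : 0 < y) (j : Fin 3) :
    ContDiff ℝ ∞ (cutoffDeriv θ y j) :=
  ((hθ.contDiff_cutoff hy).fderiv_right (m := ∞) (by simp)).clm_apply contDiff_const

lemma IsLocalizer.continuous_cutoffDeriv₂ (hθ : IsLocalizer θ) (hy : 0 < y) (j : Fin 3) :
    Continuous (cutoffDeriv₂ θ y j) :=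
  (((hθ.contDiff_cutoffDeriv hy j).fderiv_right (m := ∞) (by simp)).clm_apply
    contDiff_const).continuous

lemma IsLocalizer.cutoffDeriv_eq_zero (hθ : IsLocalizer θ) (hy : 0 < y) (j : Fin 3) {x : E3}
    (hx : ‖x‖ < y / 4) : cutoffDeriv θ y j x = 0 := by
  have : cutoff θ y =ᶠ[𝓝 x] fun _ => 1 := by
    filter_upwards [Metric.isOpen_ball.mem_nhds (mem_ball_zero_iff.2 hx)] with z hz
    exact hθ.cutoff_one hy (mem_ball_zero_iff.1 hz).le
  simp [cutoffDeriv, this.fderiv_eq]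

lemma IsLocalizer.cutoffDeriv₂_eq_zero (hθ : IsLocalizer θ) (hy : 0 < y) (j : Fin 3) {x : E3}
    (hx : ‖x‖ < y / 4) : cutoffDeriv₂ θ y j x = 0 := by
  have : cutoffDeriv θ y j =ᶠ[𝓝 x] fun _ => 0 := by
    filter_upwards [Metric.isOpen_ball.mem_nhds (mem_ball_zero_iff.2 hx)] with z hz
    exact hθ.cutoffDeriv_eq_zero hy j (mem_ball_zero_iff.1 hz)
  simp [cutoffDeriv₂, this.fderiv_eq]

/-- Scaling: `χ_y` is a fixed compactly supported profile evaluated at `x/y`, so each derivative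
costs `1/y`. -/
lemma IsLocalizer.exists_bound (hθ : IsLocalizer θ) : ∃ M : ℝ, 0 ≤ M ∧ ∀ y : ℝ, 0 < y → ∀ j x,
    |cutoffDeriv θ y j x| ≤ M / y ∧ |cutoffDeriv₂ θ y j x| ≤ M / y ^ 2 := by
  set Θ : E3 → ℝ := fun z => θ ‖z‖ with hΘ
  have hc : ContDiff ℝ ∞ Θ := hθ.contDiff_norm
  have hs : HasCompactSupport Θ := by
    refine HasCompactSupport.of_support_subset_isCompact (isCompact_closedBall (0 : E3) (1 / 3))
      fun x hx => ?_
    by_contra h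
    rw [mem_closedBall_zero_iff, not_le] at h
    exact hx (hθ.zero _ h.le)
  have hc1 : ∀ j, ContDiff ℝ ∞ fun z => fderiv ℝ Θ z (unitVec j) := fun j =>
    (hc.fderiv_right (m := ∞) (by simp)).clm_apply contDiff_const
  have hs1 : ∀ j, HasCompactSupport fun z => fderiv ℝ Θ z (unitVec j) := fun j =>
    hs.fderiv_apply ℝ _
  have hb := fun j => exists_bound_of_contDiff ((hc1 j).of_le (by simp)) (hs1 j)
  choose M ρ hM _ hb1 hb2 _ _ using hb
  refine ⟨∑ j, M j, Finset.sum_nonneg fun j _ => hM j, fun y hy j x => ?_⟩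
  have hMj : M j ≤ ∑ j, M j := Finset.single_le_sum (fun j _ => hM j) (Finset.mem_univ j)
  have e1 : cutoffDeriv θ y j = fun x => y⁻¹ * fderiv ℝ Θ (y⁻¹ • x) (unitVec j) := by
    ext x
    have := fderiv_comp_smul (𝕜 := ℝ) (f := Θ) (x := x) y⁻¹
    rw [cutoffDeriv, cutoff_eq hy]
    change fderiv ℝ (fun x => Θ (y⁻¹ • x)) x _ = _
    rw [this]
    rfl
  have e2 : cutoffDeriv₂ θ y j x =
      y⁻¹ * (y⁻¹ * fderiv ℝ (fun z => fderiv ℝ Θ z (unitVec j)) (y⁻¹ • x) (unitVec j)) := by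
    rw [cutoffDeriv₂, e1, fderiv_const_mul]
    · have := fderiv_comp_smul (𝕜 := ℝ) (f := fun z => fderiv ℝ Θ z (unitVec j)) (x := x) y⁻¹
      rw [this]
      rfl
    · exact (((hc1 j).comp (contDiff_id.const_smul y⁻¹)).differentiable (by simp)) x
  constructor
  · rw [e1, abs_mul, abs_of_pos (by positivity : 0 < y⁻¹), div_eq_inv_mul]
    gcongr
    exact (hb1 j _).trans hMj
  · rw [e2, abs_mul, abs_mul, abs_of_pos (by positivity : 0 < y⁻¹), ← mul_assoc, div_eq_inv_mul,
      ← mul_inv, ← sq]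
    gcongr
    have := (fderiv ℝ (fun z => fderiv ℝ Θ z (unitVec j)) (y⁻¹ • x)).le_opNorm (unitVec j)
    rw [norm_unitVec, mul_one] at this
    exact (this.trans (hb2 j _)).trans hMj

/-- The localized ground state and its gradient. -/
def localGround (θ : ℝ → ℝ) (α y : ℝ) (x : E3) : ℂ := ((θ (‖x‖ / y) * groundState α x : ℝ) : ℂ)

def localGradient (θ : ℝ → ℝ) (α y : ℝ) (j : Fin 3) (x : E3) : ℂ :=
  ((cutoff θ y x * fderiv ℝ (groundState α) x (unitVec j) +
    cutoffDeriv θ y j x * groundState α x : ℝ) : ℂ)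

/-- The localization error in `-Δ(χ_y u_α)`. -/
def localError (θ : ℝ → ℝ) (α y : ℝ) (x : E3) : ℝ :=
  -∑ j, (2 * (cutoffDeriv θ y j x * fderiv ℝ (groundState α) x (unitVec j)) +
    cutoffDeriv₂ θ y j x * groundState α x)

lemma cutoff_test (hθ : IsLocalizer θ) (hy : 0 < y) {g : E3 → ℝ} (hg : ContDiff ℝ ∞ g) :
    IsTest y fun x => ((cutoff θ y x * g x : ℝ) : ℂ) := by
  have hsub : Function.support (fun x => ((cutoff θ y x * g x : ℝ) : ℂ)) ⊆
      Metric.closedBall (0 : E3) (y / 3) := by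
    intro x hx
    by_contra h
    rw [mem_closedBall_zero_iff, not_le] at h
    exact hx (by simp [hθ.cutoff_zero hy h.le])
  refine ⟨Complex.ofRealCLM.contDiff.comp ((hθ.contDiff_cutoff hy).mul hg),
    HasCompactSupport.of_support_subset_isCompact (isCompact_closedBall _ _) hsub, ?_⟩
  refine (closure_minimal hsub Metric.isClosed_closedBall).trans fun x hx => ?_
  have h1 := abs_coord_le x 0
  rw [mem_closedBall_zero_iff] at hx
  have := le_abs_self (x 0)
  change x 0 < y
  linarith

lemma fderiv_cutoff_mul (hθ : IsLocalizer θ) (hy : 0 < y) {g : E3 → ℝ} {x : E3}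
    (hg : DifferentiableAt ℝ g x) (j : Fin 3) :
    fderiv ℝ (fun x => ((cutoff θ y x * g x : ℝ) : ℂ)) x (unitVec j) =
      ((cutoff θ y x * fderiv ℝ g x (unitVec j) + cutoffDeriv θ y j x * g x : ℝ) : ℂ) := by
  have hc : DifferentiableAt ℝ (cutoff θ y) x := (hθ.contDiff_cutoff hy).differentiable (by simp) x
  have h1 := (Complex.ofRealCLM.hasFDerivAt.comp x (hc.hasFDerivAt.mul hg.hasFDerivAt)).fderiv
  have h2 : (fun x => ((cutoff θ y x * g x : ℝ) : ℂ)) = Complex.ofRealCLM ∘ (cutoff θ y * g) := by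
    ext; simp
  rw [h2, h1]
  simp [cutoffDeriv]
  ring

lemma memLp_mul_groundState {α : ℝ} (hα : 0 < α) {μ : Measure E3} (hμ : μ ≤ volume) {g : E3 → ℝ}
    (hm : AEStronglyMeasurable g μ) {c : ℝ} (hb : ∀ᵐ x ∂μ, |g x| ≤ c * groundState α x) :
    MemLp (fun x => (g x : ℂ)) 2 μ := by
  refine ((memLp_groundState hα μ hμ).const_mul (c : ℂ)).mono
    (Complex.continuous_ofReal.comp_aestronglyMeasurable hm) ?_
  filter_upwards [hb] with x hx
  rw [norm_mul, Complex.norm_real, Complex.norm_real, Complex.norm_real, Real.norm_eq_abs,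
    Real.norm_eq_abs, Real.norm_eq_abs, abs_of_nonneg (groundState_nonneg hα.le x)]
  exact hx.trans (by gcongr; exacts [groundState_nonneg hα.le x, le_abs_self c])

/-- The approximating test functions are `χ_y` times the smoothed ground states; both convergences
are dominated by multiples of `u_α`. -/
lemma isH10_localGround (hθ : IsLocalizer θ) {α : ℝ} (hα : 0 < α) (hy : 0 < y) :
    IsH10 y (localGround θ α y) (localGradient θ α y) := by
  obtain ⟨M, hM, hb⟩ := hθ.exists_bound
  have hu := memLp_groundState hα _ (atomMeasure_le y)
  have hK := (hθ.contDiff_cutoff hy).continuous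
  have hdK := fun j => (hθ.contDiff_cutoffDeriv hy j).continuous
  have hu0 := groundState_nonneg hα.le
  have hgm : ∀ j, Measurable fun x => cutoff θ y x * fderiv ℝ (groundState α) x (unitVec j) +
    cutoffDeriv θ y j x * groundState α x := fun j =>
    (hK.measurable.mul (measurable_fderiv_groundState α j)).add
      ((hdK j).measurable.mul (continuous_groundState α).measurable)
  have h1 : MemLp (localGround θ α y) 2 (atomMeasure y) := by
    refine memLp_mul_groundState hα (atomMeasure_le y) (c := 1)
      (hK.mul (continuous_groundState α)).aestronglyMeasurable (Eventually.of_forall fun x => ?_)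
    rw [abs_mul, abs_of_nonneg (hu0 x), abs_of_nonneg (hθ.mem _).1]
    gcongr
    · exact hu0 x
    · exact (hθ.mem _).2
  have h2 : ∀ j, MemLp (localGradient θ α y j) 2 (atomMeasure y) := fun j => by
    refine memLp_mul_groundState hα (atomMeasure_le y) (c := α / 2 + M / y)
      (hgm j).aestronglyMeasurable ?_
    filter_upwards [ae_atomMeasure_ne_zero y] with x hx
    refine (abs_add_le _ _).trans ?_
    rw [abs_mul, abs_mul, abs_of_nonneg (hθ.cutoff_mem y x).1, abs_of_nonneg (hu0 x), add_mul]
    exact add_le_add ((mul_le_of_le_one_left (abs_nonneg _) (hθ.cutoff_mem y x).2).trans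
      (abs_fderiv_groundState_le hα.le hx j)) (mul_le_mul_of_nonneg_right (hb y hy j x).1 (hu0 x))
  set ε : ℕ → ℝ := fun n => 1 / ((n : ℝ) + 1) with hε
  have hε0 : ∀ n, ε n ≠ 0 := fun n => by positivity
  have hεl : Tendsto ε atTop (𝓝 0) := tendsto_one_div_add_atTop_nhds_zero_nat
  have htest := fun n => cutoff_test hθ hy (contDiff_smoothGround α (hε0 n))
  refine ⟨h1, h2, fun n x => ((cutoff θ y x * smoothGround α (ε n) x : ℝ) : ℂ), htest, ?_, fun j => ?_⟩
  · refine tendsto_eLpNorm_of_dominated (fun n => (h1.sub (htest n).memLp).1)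
      (hu.const_mul (2 : ℂ)) (fun n => Eventually.of_forall fun x => ?_)
      (Eventually.of_forall fun x => ?_)
    · have e : localGround θ α y x - ((cutoff θ y x * smoothGround α (ε n) x : ℝ) : ℂ) =
          ((cutoff θ y x * (groundState α x - smoothGround α (ε n) x) : ℝ) : ℂ) := by
        simp only [localGround, cutoff]; push_cast; ring
      rw [e, norm_mul, Complex.norm_real, Complex.norm_real, Real.norm_eq_abs, Real.norm_eq_abs,
        abs_mul, abs_of_nonneg (hθ.cutoff_mem y x).1, abs_of_nonneg (hu0 x),
        abs_of_nonneg (sub_nonneg.2 (smoothGround_le hα.le _ x))]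
      have := smoothGround_nonneg hα.le (ε n) x
      have h3 := smoothGround_le hα.le (ε n) x
      have h4 := mul_le_of_le_one_left (sub_nonneg.2 h3) (hθ.cutoff_mem y x).2
      norm_num
      linarith [hu0 x]
    · have h3 := (((tendsto_smoothGround α hεl x).const_mul (cutoff θ y x)).const_sub
        (cutoff θ y x * groundState α x))
      rw [sub_self] at h3
      have h4 := (Complex.continuous_ofReal.tendsto 0).comp h3
      rw [Complex.ofReal_zero] at h4
      refine h4.congr fun n => ?_
      simp only [localGround, cutoff, Function.comp]
      push_cast
      ring
  · have e := fun n (x : E3) => fderiv_cutoff_mul (y := y) hθ hy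
      ((contDiff_smoothGround α (hε0 n)).differentiable (by simp) x) j
    refine tendsto_eLpNorm_of_dominated (fun n => ((h2 j).sub ((htest n).memLp_deriv _)).1)
      (hu.const_mul ((α + 2 * (M / y) : ℝ) : ℂ)) (fun n => ?_) ?_
    · filter_upwards [ae_atomMeasure_ne_zero y] with x hx
      have hx2 : ‖x‖ ^ 2 + ε n ^ 2 ≠ 0 := by
        have := norm_pos_iff.2 hx
        positivity
      rw [e, localGradient, ← Complex.ofReal_sub, norm_mul, Complex.norm_real, Complex.norm_real,
        Complex.norm_real, Real.norm_eq_abs, Real.norm_eq_abs, Real.norm_eq_abs,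
        abs_of_nonneg (hu0 x), abs_of_nonneg (by positivity : 0 ≤ α + 2 * (M / y))]
      have d1 := abs_fderiv_groundState_le hα.le hx j
      have d2 := abs_fderiv_smoothGround_le hα.le (ε n) hx2 j
      have d3 := (hb y hy j x).1
      have d4 := smoothGround_nonneg hα.le (ε n) x
      have d5 := smoothGround_le hα.le (ε n) x
      have d6 := hθ.cutoff_mem y x
      have t1 : |cutoff θ y x * (fderiv ℝ (groundState α) x (unitVec j) -
          fderiv ℝ (smoothGround α (ε n)) x (unitVec j))| ≤ α * groundState α x := by
        rw [abs_mul, abs_of_nonneg d6.1]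
        refine (mul_le_of_le_one_left (abs_nonneg _) d6.2).trans ((abs_sub _ _).trans ?_)
        linarith
      have t2 : |cutoffDeriv θ y j x * (groundState α x - smoothGround α (ε n) x)| ≤
          2 * (M / y) * groundState α x := by
        rw [abs_mul, abs_of_nonneg (sub_nonneg.2 d5)]
        have : 0 ≤ M / y := by positivity
        have hh : groundState α x - smoothGround α (ε n) x ≤ groundState α x := by linarith
        nlinarith [mul_le_mul d3 hh (sub_nonneg.2 d5) this, hu0 x, mul_nonneg this (hu0 x)]
      have t3 : cutoff θ y x * fderiv ℝ (groundState α) x (unitVec j) +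
          cutoffDeriv θ y j x * groundState α x -
          (cutoff θ y x * fderiv ℝ (smoothGround α (ε n)) x (unitVec j) +
          cutoffDeriv θ y j x * smoothGround α (ε n) x) =
          cutoff θ y x * (fderiv ℝ (groundState α) x (unitVec j) -
          fderiv ℝ (smoothGround α (ε n)) x (unitVec j)) +
          cutoffDeriv θ y j x * (groundState α x - smoothGround α (ε n) x) := by ring
      rw [t3]
      refine (abs_add_le _ _).trans ?_
      linarith
    · filter_upwards [ae_atomMeasure_ne_zero y] with x hx
      have h3 := ((((tendsto_fderiv_smoothGround α hεl hx j).const_mul (cutoff θ y x)).add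
        ((tendsto_smoothGround α hεl x).const_mul (cutoffDeriv θ y j x))).const_sub
          (cutoff θ y x * fderiv ℝ (groundState α) x (unitVec j) +
            cutoffDeriv θ y j x * groundState α x))
      rw [sub_self] at h3
      have h4 := (Complex.continuous_ofReal.tendsto 0).comp h3
      rw [Complex.ofReal_zero] at h4
      refine h4.congr fun n => ?_
      rw [e, localGradient, ← Complex.ofReal_sub]
      rfl

/-! ### The localization error -/

lemma abs_localError_le {M : ℝ} {α : ℝ} (hα : 0 < α)
    (hb : ∀ j x, |cutoffDeriv θ y j x| ≤ M / y ∧ |cutoffDeriv₂ θ y j x| ≤ M / y ^ 2) {x : E3}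
    (hx : x ≠ 0) : |localError θ α y x| ≤ 3 * (α * (M / y) + M / y ^ 2) * groundState α x := by
  have hu0 := groundState_nonneg hα.le x
  rw [localError, abs_neg]
  refine (Finset.abs_sum_le_sum_abs _ _).trans ?_
  have h1 : ∀ j : Fin 3, |2 * (cutoffDeriv θ y j x * fderiv ℝ (groundState α) x (unitVec j)) +
      cutoffDeriv₂ θ y j x * groundState α x| ≤ (α * (M / y) + M / y ^ 2) * groundState α x := by
    intro j
    refine (abs_add_le _ _).trans ?_
    have h2 := mul_le_mul (hb j x).1 (abs_fderiv_groundState_le hα.le hx j) (abs_nonneg _)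
      ((abs_nonneg _).trans (hb j x).1)
    have h3 := mul_le_mul_of_nonneg_right (hb j x).2 hu0
    rw [abs_mul, abs_mul, abs_mul, abs_two, abs_of_nonneg hu0]
    linarith
  refine (Finset.sum_le_sum fun j _ => h1 j).trans (le_of_eq ?_)
  simp
  ring

lemma IsLocalizer.localError_eq_zero (hθ : IsLocalizer θ) (α : ℝ) (hy : 0 < y) {x : E3}
    (hx : ‖x‖ < y / 4) : localError θ α y x = 0 := by
  simp [localError, hθ.cutoffDeriv_eq_zero hy _ hx, hθ.cutoffDeriv₂_eq_zero hy _ hx]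

lemma measurable_localError (hθ : IsLocalizer θ) (α : ℝ) (hy : 0 < y) :
    Measurable (localError θ α y) := by
  unfold localError
  refine (Finset.measurable_fun_sum _ fun j _ => ?_).neg
  exact (((hθ.contDiff_cutoffDeriv hy j).continuous.measurable.mul
    (measurable_fderiv_groundState α j)).const_mul 2).add
    ((hθ.continuous_cutoffDeriv₂ hy j).measurable.mul (continuous_groundState α).measurable)

/-- Since `D u_α = 0`, one has `D (χ_y u_α) = (∇χ_y) u_α`, and the twisted form reduces to `⟨D η,
(∇χ_y) u_α⟩`. One integration by parts against `u_α` then gives the error, and no second derivative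
of `u_α` is needed. -/
lemma isDirichletLaplacian_localGround (hθ : IsLocalizer θ) {α : ℝ} (hα : 0 < α) (hy : 0 < y) :
    IsDirichletLaplacian y (localGround θ α y) (localGradient θ α y) fun x =>
      ((α * ‖x‖⁻¹ + groundEnergy α : ℝ) : ℂ) * localGround θ α y x + (localError θ α y x : ℂ) := by
  obtain ⟨M, hM, hb⟩ := hθ.exists_bound
  have hH := isH10_localGround hθ hα hy
  have hdiv := hH.memLp_div_norm
  have herr : MemLp (fun x => (localError θ α y x : ℂ)) 2 (atomMeasure y) := by
    refine memLp_mul_groundState hα (atomMeasure_le y) (c := 3 * (α * (M / y) + M / y ^ 2))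
      (measurable_localError hθ α hy).aestronglyMeasurable ?_
    filter_upwards [ae_atomMeasure_ne_zero y] with x hx
    exact abs_localError_le hα (hb y hy) hx
  have hw : MemLp (fun x => ((α * ‖x‖⁻¹ + groundEnergy α : ℝ) : ℂ) * localGround θ α y x)
      2 (atomMeasure y) := by
    refine ((hdiv.const_mul (α : ℂ)).add (hH.1.const_mul (groundEnergy α : ℂ))).ae_eq
      (Eventually.of_forall fun x => ?_)
    simp only [Pi.add_apply]
    push_cast
    ring
  refine ⟨hH, hw.add herr, fun η hη => ?_⟩
  have hu := memLp_groundState hα _ (atomMeasure_le y)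
  have hdu := fun j => memLp_fderiv_groundState hα (atomMeasure_le y) j
  have hC : ∀ j, ContDiff ℝ ∞ fun x => (cutoffDeriv θ y j x : ℂ) := fun j =>
    Complex.ofRealCLM.contDiff.comp (hθ.contDiff_cutoffDeriv hy j)
  have ht := fun j => hη.mul_left (hC j)
  have hd : ∀ j x, fderiv ℝ (fun x => (cutoffDeriv θ y j x : ℂ) * η x) x (unitVec j) =
      (cutoffDeriv θ y j x : ℂ) * fderiv ℝ η x (unitVec j) + (cutoffDeriv₂ θ y j x : ℂ) * η x := by
    intro j x
    have hdj : DifferentiableAt ℝ (cutoffDeriv θ y j) x :=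
      (hθ.contDiff_cutoffDeriv hy j).differentiable (by simp) x
    have h1 := Complex.ofRealCLM.hasFDerivAt.comp x hdj.hasFDerivAt
    have h2 := (h1.mul (hη.differentiable x).hasFDerivAt).fderiv
    have h3 : (fun x => (cutoffDeriv θ y j x : ℂ) * η x) =
      (Complex.ofRealCLM ∘ cutoffDeriv θ y j) * η := by ext; simp
    rw [h3, h2]
    simp [cutoffDeriv₂]
    ring
  have hibp := fun j => (ht j).integral_groundState_mul hα j
  simp_rw [hd] at hibp
  have htw := hH.twisted_form hη α
  have hdr : ∀ᵐ x ∂atomMeasure y, ∀ j, localGradient θ α y j x + drift α j x * localGround θ α y x =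
      (cutoffDeriv θ y j x : ℂ) * groundState α x := by
    filter_upwards [ae_atomMeasure_ne_zero y] with x hx j
    simp only [localGradient, localGround, drift, fderiv_groundState α hx, cutoff]
    push_cast
    ring
  have hcd : ∀ j {v : E3 → ℂ}, MemLp v 2 (atomMeasure y) →
      MemLp (fun x => (cutoffDeriv θ y j x : ℂ) * v x) 2 (atomMeasure y) := by
    intro j v hv
    refine (hv.const_mul ((M / y : ℝ) : ℂ)).mono
      ((hC j).continuous.aestronglyMeasurable.mul hv.1) (Eventually.of_forall fun x => ?_)
    rw [norm_mul, norm_mul, Complex.norm_real, Complex.norm_real]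
    gcongr
    exact ((hb y hy j x).1).trans (le_abs_self _)
  have hcd2 : ∀ j {v : E3 → ℂ}, MemLp v 2 (atomMeasure y) →
      MemLp (fun x => (cutoffDeriv₂ θ y j x : ℂ) * v x) 2 (atomMeasure y) := by
    intro j v hv
    refine (hv.const_mul ((M / y ^ 2 : ℝ) : ℂ)).mono
      ((Complex.continuous_ofReal.comp (hθ.continuous_cutoffDeriv₂ hy j)).aestronglyMeasurable.mul
        hv.1) (Eventually.of_forall fun x => ?_)
    rw [norm_mul, norm_mul, Complex.norm_real, Complex.norm_real]
    gcongr
    exact ((hb y hy j x).2).trans (le_abs_self _)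
  have hmain : ∀ j, ∫ x, (fderiv ℝ η x (unitVec j) + drift α j x * η x) *
      (localGradient θ α y j x + drift α j x * localGround θ α y x) ∂atomMeasure y =
      ∫ x, -((2 * (cutoffDeriv θ y j x * fderiv ℝ (groundState α) x (unitVec j)) +
        cutoffDeriv₂ θ y j x * groundState α x : ℝ) : ℂ) * η x ∂atomMeasure y := by
    intro j
    have i1 : Integrable (fun x => (groundState α x : ℂ) * ((cutoffDeriv θ y j x : ℂ) *
        fderiv ℝ η x (unitVec j) + (cutoffDeriv₂ θ y j x : ℂ) * η x)) (atomMeasure y) :=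
      integrable_mul_L2 hu ((hcd j (hη.memLp_deriv (unitVec j))).add (hcd2 j hη.memLp))
    have i2 := integrable_mul_L2 (hdu j) (hcd j hη.memLp)
    have i3 := integrable_mul_L2 (hcd2 j hu) hη.memLp
    -- Integration by parts with the test function `(∂ⱼχ_y) η`. Subtracting this null integral
    -- trades the derivative of `η` for derivatives of `χ_y` and `u_α`.
    have hz : ∫ x, ((groundState α x : ℂ) * ((cutoffDeriv θ y j x : ℂ) * fderiv ℝ η x (unitVec j) +
        (cutoffDeriv₂ θ y j x : ℂ) * η x)) + (fderiv ℝ (groundState α) x (unitVec j) : ℂ) *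
        ((cutoffDeriv θ y j x : ℂ) * η x) ∂atomMeasure y = 0 := by
      rw [integral_eq_add i1 i2 fun x => rfl]
      have := hibp j
      rw [eq_neg_iff_add_eq_zero] at this
      exact this
    have i4 : Integrable (fun x => -((2 * (cutoffDeriv θ y j x *
        fderiv ℝ (groundState α) x (unitVec j)) +
        cutoffDeriv₂ θ y j x * groundState α x : ℝ) : ℂ) * η x) (atomMeasure y) := by
      refine ((i2.const_mul (-2)).sub i3).congr (Eventually.of_forall fun x => ?_)
      simp only [Pi.sub_apply]
      push_cast
      ring
    rw [integral_eq_add_ae (i1.add i2) i4 (h := fun x => (fderiv ℝ η x (unitVec j) +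
      drift α j x * η x) * (localGradient θ α y j x + drift α j x * localGround θ α y x))]
    · have := hz
      simp only [Pi.add_apply] at this ⊢
      rw [this, zero_add]
    · filter_upwards [hdr, ae_atomMeasure_ne_zero y] with x hx hx0
      rw [hx]
      simp only [Pi.add_apply, drift, fderiv_groundState α hx0]
      push_cast
      ring
  simp_rw [hmain] at htw
  have ierr : ∀ j, Integrable (fun x => -((2 * (cutoffDeriv θ y j x *
      fderiv ℝ (groundState α) x (unitVec j)) +
      cutoffDeriv₂ θ y j x * groundState α x : ℝ) : ℂ) * η x) (atomMeasure y) := by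
    intro j
    refine ((integrable_mul_L2 (hcd j (hdu j)) hη.memLp).const_mul (-2)|>.sub
      (integrable_mul_L2 (hcd2 j hu) hη.memLp)).congr (Eventually.of_forall fun x => ?_)
    simp only [Pi.sub_apply]
    push_cast
    ring
  rw [← integral_finsetSum _ fun j _ => ierr j] at htw
  have e1 : ∫ x, ∑ j, -((2 * (cutoffDeriv θ y j x * fderiv ℝ (groundState α) x (unitVec j)) +
      cutoffDeriv₂ θ y j x * groundState α x : ℝ) : ℂ) * η x ∂atomMeasure y =
      ∫ x, (localError θ α y x : ℂ) * η x ∂atomMeasure y := by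
    congr 1
    ext x
    simp only [localError, Complex.ofReal_neg, Complex.ofReal_sum, neg_mul, Finset.sum_mul,
      Finset.sum_neg_distrib]
  rw [e1] at htw
  have e2 : ∫ x, (((α * ‖x‖⁻¹ + groundEnergy α : ℝ) : ℂ) * localGround θ α y x +
      (localError θ α y x : ℂ)) * η x ∂atomMeasure y =
      (α * ∫ x, ((‖x‖⁻¹ : ℝ) : ℂ) * η x * localGround θ α y x ∂atomMeasure y
      - (α ^ 2 / 4 : ℝ) * ∫ x, η x * localGround θ α y x ∂atomMeasure y) +
      ∫ x, (localError θ α y x : ℂ) * η x ∂atomMeasure y := by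
    rw [integral_eq_add (integrable_mul_L2 hw hη.memLp) (integrable_mul_L2 herr hη.memLp)
      (fun x => by ring)]
    congr 1
    have j1 : Integrable (fun x => ((‖x‖⁻¹ : ℝ) : ℂ) * η x * localGround θ α y x)
        (atomMeasure y) := (integrable_mul_L2 hdiv hη.memLp).congr
          (Eventually.of_forall fun x => by ring)
    rw [integral_eq_add (j1.const_mul (α : ℂ))
      ((integrable_mul_L2 hη.memLp hH.1).const_mul (-(α ^ 2 / 4 : ℝ) : ℂ)), integral_const_mul,
      integral_const_mul]
    · push_cast; ring
    · intro x
      simp only [groundEnergy]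
      push_cast
      ring
  rw [e2, htw]
  have e3 : ∀ j, ∫ x, localGradient θ α y j x * fderiv ℝ η x (unitVec j) ∂atomMeasure y =
      ∫ x, fderiv ℝ η x (unitVec j) * localGradient θ α y j x ∂atomMeasure y := fun j => by
    simp_rw [mul_comm]
  simp_rw [e3]
  ring

end Localization

/-! ### Scalar products -/

section Brakets

variable {X : Type*} [MeasurableSpace X] {μ : Measure X} {f g h : X → ℂ}

lemma memLp_conj (hf : MemLp f 2 μ) : MemLp (fun x => conj (f x)) 2 μ := by
  refine hf.congr_norm (Complex.continuous_conj.comp_aestronglyMeasurable hf.1)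
    (Eventually.of_forall fun x => ?_)
  simp

lemma memLp_add (hf : MemLp f 2 μ) (hg : MemLp g 2 μ) : MemLp (fun x => f x + g x) 2 μ := hf.add hg

lemma integrable_braket (hf : MemLp f 2 μ) (hg : MemLp g 2 μ) :
    Integrable (fun x => conj (f x) * g x) μ := integrable_mul_L2 (memLp_conj hf) hg

lemma braket_add (hf : MemLp f 2 μ) (hg : MemLp g 2 μ) (hh : MemLp h 2 μ) :
    braket μ f (fun x => g x + h x) = braket μ f g + braket μ f h :=
  integral_eq_add (integrable_braket hf hg) (integrable_braket hf hh) fun x => by ring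

lemma braket_const_mul (c : ℂ) : braket μ f (fun x => c * g x) = c * braket μ f g := by
  unfold braket
  rw [← integral_const_mul]
  congr 1
  ext x
  ring

lemma braket_sum {g : Fin 3 → X → ℂ} (hf : MemLp f 2 μ) (hg : ∀ j, MemLp (g j) 2 μ) :
    braket μ f (fun x => ∑ j, g j x) = ∑ j, braket μ f (g j) := by
  unfold braket
  rw [← integral_finsetSum _ fun j _ => integrable_braket hf (hg j)]
  simp_rw [Finset.mul_sum]

lemma braket_real_mul (V : X → ℝ) :
    braket μ f (fun x => (V x : ℂ) * f x) = ((∫ x, V x * ‖f x‖ ^ 2 ∂μ : ℝ) : ℂ) := by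
  rw [← integral_complex_ofReal]
  unfold braket
  congr 1
  ext x
  rw [mul_left_comm, Complex.conj_mul']
  push_cast
  ring

lemma braket_self : braket μ f f = ((∫ x, ‖f x‖ ^ 2 ∂μ : ℝ) : ℂ) := by
  simpa using braket_real_mul (μ := μ) (f := f) fun _ => 1

lemma norm_integral_mul_sq_le (hf : MemLp f 2 μ) (hg : MemLp g 2 μ) :
    ‖∫ x, f x * g x ∂μ‖ ^ 2 ≤ (∫ x, ‖f x‖ ^ 2 ∂μ) * ∫ x, ‖g x‖ ^ 2 ∂μ := by
  have h1 : ‖∫ x, f x * g x ∂μ‖ ≤ ∫ x, ‖f x‖ * ‖g x‖ ∂μ := by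
    refine (norm_integral_le_integral_norm _).trans (le_of_eq ?_)
    simp_rw [norm_mul]
  have h2 := integral_mul_norm_le_Lp_mul_Lq (f := f) (g := g) (μ := μ) (p := 2) (q := 2)
    ⟨by norm_num, by norm_num, by norm_num⟩ (by simpa using hf) (by simpa using hg)
  have h3 := pow_le_pow_left₀ (norm_nonneg _) (h1.trans h2) 2
  refine h3.trans (le_of_eq ?_)
  have hs : ∀ a : ℝ, 0 ≤ a → (a ^ (1 / 2 : ℝ)) ^ 2 = a := fun a ha => by
    rw [← Real.rpow_natCast, ← Real.rpow_mul ha]; norm_num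
  rw [mul_pow, hs _ (by positivity), hs _ (by positivity)]
  simp

/-- `-2 Re ⟨f, g⟩ ≤ c ‖f‖² + ‖g‖² / c`. -/
lemma braket_young (hf : MemLp f 2 μ) (hg : MemLp g 2 μ) {c : ℝ} (hc : 0 < c) :
    -2 * (braket μ f g).re ≤ c * ∫ x, ‖f x‖ ^ 2 ∂μ + c⁻¹ * ∫ x, ‖g x‖ ^ 2 ∂μ := by
  have h1 : ‖braket μ f g‖ ≤ ∫ x, ‖f x‖ * ‖g x‖ ∂μ := by
    refine (norm_integral_le_integral_norm _).trans (le_of_eq ?_)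
    simp_rw [norm_mul, RCLike.norm_conj]
  have h2 : 2 * ∫ x, ‖f x‖ * ‖g x‖ ∂μ ≤ c * ∫ x, ‖f x‖ ^ 2 ∂μ + c⁻¹ * ∫ x, ‖g x‖ ^ 2 ∂μ := by
    rw [← integral_const_mul, ← integral_const_mul, ← integral_const_mul,
      ← integral_add ((integrable_norm_sq hf).const_mul _) ((integrable_norm_sq hg).const_mul _)]
    refine integral_mono ((hf.norm.integrable_mul hg.norm).const_mul 2)
      (((integrable_norm_sq hf).const_mul _).add ((integrable_norm_sq hg).const_mul _)) fun x => ?_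
    simp only
    have h3 : c * ‖f x‖ ^ 2 + c⁻¹ * ‖g x‖ ^ 2 - 2 * (‖f x‖ * ‖g x‖) =
        c⁻¹ * (c * ‖f x‖ - ‖g x‖) ^ 2 := by field_simp; ring
    have h4 : 0 ≤ c⁻¹ * (c * ‖f x‖ - ‖g x‖) ^ 2 := by positivity
    linarith
  have h5 := (Complex.abs_re_le_norm (braket μ f g)).trans h1
  have h6 := neg_abs_le (braket μ f g).re
  linarith

end Brakets

/-! ### Creation and annihilation with the wall -/

section Ladder

variable (R : Radiation) {y : ℝ}

lemma Radiation.memLp_formFactor (y : ℝ) (j : Fin 3) :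
    MemLp (fun m => (R.formFactor y j m : ℂ)) 2 wallModeMeasure ∧
    ∫ m, R.formFactor y j m ^ 2 ∂wallModeMeasure ≤ 8 * ∫ k, R.envelope k := by
  have hm := R.aemeasurable_formFactor y j
  have hae := R.ae_formFactor_sq_le y
  have henv : Integrable (fun m : Mode => 4 * R.envelope m.1) wallModeMeasure := by
    have := ((R.integrable_envelope.const_mul 4).restrict (s := {k | 0 < k 0})).mul_prod
      (integrable_const (μ := (Measure.count : Measure (Fin 2))) (1 : ℝ))
    simpa [wallModeMeasure] using this
  have hi : Integrable (fun m => R.formFactor y j m ^ 2) wallModeMeasure := by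
    refine henv.mono' (hm.pow_const 2).aestronglyMeasurable ?_
    filter_upwards [hae] with m h
    rw [Real.norm_of_nonneg (sq_nonneg _)]
    exact h.2 j
  refine ⟨?_, ?_⟩
  · refine (memLp_two_iff_integrable_sq_norm
      (Complex.measurable_ofReal.comp_aemeasurable hm).aestronglyMeasurable).2 ?_
    simpa using hi
  · have h1 : ∫ m, 4 * R.envelope m.1 ∂wallModeMeasure ≤ 8 * ∫ k, R.envelope k := by
      have e : ENNReal.ofReal (∫ m, 4 * R.envelope m.1 ∂wallModeMeasure) ≤
          ENNReal.ofReal (8 * ∫ k, R.envelope k) := by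
        rw [ofReal_integral_eq_lintegral_ofReal henv (Eventually.of_forall fun m =>
          mul_nonneg (by norm_num) (R.envelope_nonneg _))]
        refine (lintegral_wall_fst_le (f := fun k => ENNReal.ofReal (4 * R.envelope k))
          (R.measurable_envelope.const_mul 4).ennreal_ofReal.aemeasurable).trans (le_of_eq ?_)
        rw [← ofReal_integral_eq_lintegral_ofReal (R.integrable_envelope.const_mul 4)
          (Eventually.of_forall fun m => mul_nonneg (by norm_num) (R.envelope_nonneg _)),
          integral_const_mul]
        have h8 : 8 * ∫ k, R.envelope k = 2 * (4 * ∫ k, R.envelope k) := by ring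
        rw [h8, ENNReal.ofReal_mul (p := 2) (by norm_num)]
        norm_num
      rwa [ENNReal.ofReal_le_ofReal_iff] at e
      exact mul_nonneg (by norm_num) (integral_nonneg R.envelope_nonneg)
    refine (integral_mono_ae hi henv ?_).trans h1
    filter_upwards [hae] with m h using h.2 j

lemma Radiation.formFactorNormSq_nonneg (y : ℝ) : 0 ≤ R.formFactorNormSq y :=
  Finset.sum_nonneg fun j _ => by positivity

lemma Radiation.formFactorNormSq_le (y : ℝ) : R.formFactorNormSq y ≤ 24 * ∫ k, R.envelope k := by
  refine (Finset.sum_le_sum fun j _ => (R.memLp_formFactor y j).2).trans (le_of_eq ?_)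
  simp
  ring

lemma Radiation.memLp_raise (j : Fin 3) {f : E3 → ℂ} (hf : MemLp f 2 (atomMeasure y)) :
    MemLp (R.raise y j f) 2 (jointMeasure y) := by
  have hl := (R.memLp_formFactor y j).1
  have hm : AEStronglyMeasurable (R.raise y j f) (jointMeasure y) :=
    (hl.1.comp_snd (μ := atomMeasure y)).mul (hf.1.comp_fst (ν := wallModeMeasure))
  refine (memLp_two_iff_integrable_sq_norm hm).2 ?_
  have := (integrable_norm_sq hf).mul_prod (integrable_norm_sq hl)
  refine this.congr (Eventually.of_forall fun p => ?_)
  simp only [Radiation.raise, norm_mul]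
  ring

lemma Radiation.lower_eq (j : Fin 3) (g : E3 × Mode → ℂ) (x : E3) :
    R.lower y j g x = ∫ m, (R.formFactor y j m : ℂ) * g (x, m) ∂wallModeMeasure := by
  simp [Radiation.lower]

lemma ae_memLp_slice {g : E3 × Mode → ℂ} (hg : MemLp g 2 (jointMeasure y)) :
    ∀ᵐ x ∂atomMeasure y, MemLp (fun m => g (x, m)) 2 wallModeMeasure := by
  filter_upwards [(integrable_norm_sq hg).prod_right_ae, hg.1.prodMk_left] with x h1 h2
  exact (memLp_two_iff_integrable_sq_norm h2).2 h1

/-- Cauchy–Schwarz in the mode variable, for almost every position. -/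
lemma Radiation.memLp_lower (j : Fin 3) {g : E3 × Mode → ℂ} (hg : MemLp g 2 (jointMeasure y)) :
    MemLp (R.lower y j g) 2 (atomMeasure y) ∧ ∫ x, ‖R.lower y j g x‖ ^ 2 ∂atomMeasure y ≤
      (∫ m, R.formFactor y j m ^ 2 ∂wallModeMeasure) * ∫ p, ‖g p‖ ^ 2 ∂jointMeasure y := by
  have hl := (R.memLp_formFactor y j).1
  have hm : AEStronglyMeasurable (R.lower y j g) (atomMeasure y) := by
    have : AEStronglyMeasurable (fun p : E3 × Mode => (R.formFactor y j p.2 : ℂ) * g p)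
      ((atomMeasure y).prod wallModeMeasure) := (hl.1.comp_snd (μ := atomMeasure y)).mul hg.1
    refine this.integral_prod_right'.congr (Eventually.of_forall fun x => ?_)
    simp only [R.lower_eq]
  have hi := (integrable_norm_sq hg).integral_prod_left
  have hle : ∀ᵐ x ∂atomMeasure y, ‖R.lower y j g x‖ ^ 2 ≤
      (∫ m, R.formFactor y j m ^ 2 ∂wallModeMeasure) *
        ∫ m, ‖g (x, m)‖ ^ 2 ∂wallModeMeasure := by
    filter_upwards [ae_memLp_slice hg] with x hx
    rw [R.lower_eq]
    refine (norm_integral_mul_sq_le hl hx).trans (le_of_eq ?_)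
    simp
  have hsq : Integrable (fun x => ‖R.lower y j g x‖ ^ 2) (atomMeasure y) := by
    refine (hi.const_mul (∫ m, R.formFactor y j m ^ 2 ∂wallModeMeasure)).mono'
      (hm.norm.pow 2) ?_
    filter_upwards [hle] with x hx
    rwa [Real.norm_of_nonneg (sq_nonneg _)]
  refine ⟨(memLp_two_iff_integrable_sq_norm hm).2 hsq, ?_⟩
  refine (integral_mono_ae hsq (hi.const_mul _) hle).trans (le_of_eq ?_)
  rw [integral_const_mul, jointMeasure, integral_prod _ (integrable_norm_sq hg)]

/-- `⟨g, A⁺ f⟩ = ⟨A⁻ g, f⟩`. -/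
lemma Radiation.braket_raise (j : Fin 3) {f : E3 → ℂ} {g : E3 × Mode → ℂ}
    (hf : MemLp f 2 (atomMeasure y)) (hg : MemLp g 2 (jointMeasure y)) :
    braket (jointMeasure y) g (R.raise y j f) = braket (atomMeasure y) (R.lower y j g) f := by
  have hi := integrable_braket hg (R.memLp_raise j hf)
  unfold braket
  rw [jointMeasure, integral_prod _ hi]
  congr 1
  ext x
  rw [R.lower_eq, ← integral_conj, ← integral_mul_const]
  congr 1
  ext m
  simp only [Radiation.raise, map_mul, Complex.conj_ofReal]
  ring

end Ladder

/-! ### The Hamiltonian on the trial state -/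

section Hamiltonian

variable {R : Radiation} {y : ℝ}

lemma norm_sub_mirror_center {x : E3} : ‖mirror y x‖ = ‖x - !₂[2 * y, 0, 0]‖ := by
  rw [EuclideanSpace.norm_eq, EuclideanSpace.norm_eq]
  congr 1
  simp only [Fin.sum_univ_three, mirror, Real.norm_eq_abs, sq_abs]
  simp
  ring

lemma norm_mirror_sub {x : E3} (hx : x 0 < y) : ‖mirror y x - x‖ = 2 * (y - x 0) := by
  rw [EuclideanSpace.norm_eq, Real.sqrt_eq_iff_mul_self_eq (by positivity) (by linarith)]
  simp only [Fin.sum_univ_three, mirror, Real.norm_eq_abs, sq_abs]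
  simp
  ring

/-- The mirror image of `x` has the same norm as `x - (2y, 0, 0)`, so the two repulsive terms
coincide. -/
lemma wallPotential_eq (hy : 0 < y) {x : E3} (hx : x 0 < y) :
    wallPotential y x =
      -(4 * y)⁻¹ + ‖x - !₂[2 * y, 0, 0]‖⁻¹ - 1 / 4 * (y - x 0)⁻¹ := by
  have h : (y - x 0) ≠ 0 := by linarith
  rw [wallPotential, norm_mirror_sub hx, norm_sub_mirror_center, abs_of_pos hy]
  simp only [one_div, mul_inv]
  ring

lemma inv_norm_sub_le (hy : 0 < y) {x : E3} (hx : x 0 < y) : ‖x - !₂[2 * y, 0, 0]‖⁻¹ ≤ y⁻¹ := by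
  apply inv_anti₀ hy
  have := abs_coord_le (x - !₂[2 * y, 0, 0]) 0
  simp at this
  have h2 := neg_abs_le (x 0 - 2 * y)
  linarith

/-- The singularity at the wall is attractive, so it can be dropped from an upper bound on the
energy; Hardy at the wall is needed only for `V_y Φ` to be square integrable. -/
lemma wallPotential_le (hy : 0 < y) {x : E3} (hx : x 0 < y) : wallPotential y x ≤ y⁻¹ := by
  rw [wallPotential_eq hy hx]
  have h1 := inv_norm_sub_le hy hx
  have h2 : 0 < (4 * y)⁻¹ := by positivity
  have h3 : 0 < (y - x 0)⁻¹ := inv_pos.2 (by linarith)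
  linarith

lemma ae_lt_wall (y : ℝ) : ∀ᵐ x ∂atomMeasure y, x 0 < y :=
  ae_restrict_mem (measurableSet_lt (measurable_coord 0) measurable_const)

section Potential

variable {X : Type*} [MeasurableSpace X] {μ : Measure X} {π : X → E3} {v : X → ℂ}

/-- The map `π` extracts the position, so that both sectors are covered. -/
lemma memLp_wallPotential_mul (hy : 0 < y) (hπ : Measurable π) (hlt : ∀ᵐ p ∂μ, π p 0 < y)
    (hv : MemLp v 2 μ) (hw : MemLp (fun p => (((y - π p 0)⁻¹ : ℝ) : ℂ) * v p) 2 μ) :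
    MemLp (fun p => (wallPotential y (π p) : ℂ) * v p) 2 μ := by
  have h1 : MemLp (fun p => ((‖π p - !₂[2 * y, 0, 0]‖⁻¹ : ℝ) : ℂ) * v p) 2 μ := by
    refine (hv.const_mul ((y⁻¹ : ℝ) : ℂ)).mono ?_ ?_
    · exact ((Complex.measurable_ofReal.comp
        (hπ.sub_const _).norm.inv).aestronglyMeasurable).mul hv.1
    · filter_upwards [hlt] with p hp
      rw [norm_mul, norm_mul, Complex.norm_real, Complex.norm_real, norm_inv, norm_norm, norm_inv,
        Real.norm_of_nonneg hy.le]
      exact mul_le_mul_of_nonneg_right (inv_norm_sub_le hy hp) (norm_nonneg _)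
  refine (((hv.const_mul ((-(4 * y)⁻¹ : ℝ) : ℂ)).add h1).sub (hw.const_mul (1 / 4))).ae_eq ?_
  filter_upwards [hlt] with p hp
  simp only [Pi.add_apply, Pi.sub_apply, wallPotential_eq hy hp]
  push_cast
  ring

end Potential

/-- Agreement at every `x` for almost every mode makes the slices equal as functions, so the
fibrewise Laplacian transfers without change. -/
lemma Radiation.HasHamiltonianValue.congr {α : ℝ} {f : E3 → ℂ} {g g' : E3 × Mode → ℂ} {η : State}
    (h : R.HasHamiltonianValue α y (f, g) η)
    (he : ∀ᵐ m ∂wallModeMeasure, ∀ x, g' (x, m) = g (x, m)) :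
    R.HasHamiltonianValue α y (f, g') η := by
  obtain ⟨G₀, w₀, G₁, w₁, h1, h2, h3, h4, h5, h6, h7⟩ := h
  have hj : g =ᵐ[jointMeasure y] g' := by
    filter_upwards [ae_joint_snd he] with p hp using (hp p.1).symm
  refine ⟨G₀, w₀, G₁, w₁, h1, ⟨h2.1.ae_eq hj, h2.2.1, h2.2.2.1, ?_⟩, ?_, h4, h5, h6, ?_⟩
  · filter_upwards [h2.2.2.2, he] with m hm hm'
    simpa only [hm'] using hm
  · refine h3.ae_eq ?_
    filter_upwards [hj] with p hp
    simp only [hp]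
  · have hl : ∀ j, R.lower y j g' = R.lower y j g := fun j => by
      ext x
      refine integral_congr_ae ?_
      filter_upwards [he] with m hm
      simp only [hm]
    filter_upwards [h7, hj] with p hp hp'
    simp only [hl]
    rw [hp]
    simp only [hp']

/-- The source `2 α^{1/2} P (χ_y u_α) ⊗ A_y⁺ Ω` of the localized ground state. -/
def Radiation.localSource (R : Radiation) (θ : ℝ → ℝ) (α y : ℝ) (p : E3 × Mode) : ℂ :=
  2 * (Real.sqrt α : ℝ) * ∑ j, R.raise y j (fun x => Complex.I * localGradient θ α y j x) p

variable {θ : ℝ → ℝ} {α : ℝ} {Φ : E3 × Mode → ℂ} {G : Fin 3 → E3 × Mode → ℂ} {w : E3 × Mode → ℂ}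

/-- The value of `H_y` on `(χ_y u_α, Φ)`. -/
def Radiation.hamiltonianValue (R : Radiation) (θ : ℝ → ℝ) (α y : ℝ) (Φ : E3 × Mode → ℂ)
    (G : Fin 3 → E3 × Mode → ℂ) : State :=
  (fun x => ((groundEnergy α + α * R.formFactorNormSq y : ℝ) : ℂ) * localGround θ α y x +
      (localError θ α y x : ℂ) + (α : ℂ) * ((wallPotential y x : ℂ) * localGround θ α y x) +
      -(2 * (Real.sqrt α : ℝ)) * ∑ j, R.lower y j (fun p => Complex.I * G j p) x,
    fun p => R.sharpSource α y p + ((groundEnergy α + α * R.formFactorNormSq y : ℝ) : ℂ) * Φ p +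
      (α : ℂ) * ((wallPotential y p.1 : ℂ) * Φ p) + -1 * R.localSource θ α y p +
      2 * (α : ℂ) * ∑ j, R.raise y j (R.lower y j Φ) p)

/-- The `L²` memberships by which scalar products with `Radiation.hamiltonianValue` may be expanded
term by term. -/
structure Radiation.Components (R : Radiation) (θ : ℝ → ℝ) (α y : ℝ) (Φ : E3 × Mode → ℂ)
    (G : Fin 3 → E3 × Mode → ℂ) : Prop where
  ground : MemLp (localGround θ α y) 2 (atomMeasure y)
  error : MemLp (fun x => (localError θ α y x : ℂ)) 2 (atomMeasure y)
  wallGround : MemLp (fun x => (wallPotential y x : ℂ) * localGround θ α y x) 2 (atomMeasure y)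
  lowerGrad : ∀ j, MemLp (R.lower y j (fun p => Complex.I * G j p)) 2 (atomMeasure y)
  source : MemLp (R.sharpSource α y) 2 (jointMeasure y)
  field : MemLp Φ 2 (jointMeasure y)
  wallField : MemLp (fun p => (wallPotential y p.1 : ℂ) * Φ p) 2 (jointMeasure y)
  raiseGrad : ∀ j, MemLp (R.raise y j (fun x => Complex.I * localGradient θ α y j x)) 2
    (jointMeasure y)
  lowerField : ∀ j, MemLp (R.lower y j Φ) 2 (atomMeasure y)

lemma Radiation.IsSharpField.components (h : R.IsSharpField α y Φ G w) (hθ : IsLocalizer θ)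
    (hα : 0 < α) (hy : 0 < y) : R.Components θ α y Φ G := by
  have hH := isH10_localGround hθ hα hy
  obtain ⟨M, hM, hb⟩ := hθ.exists_bound
  refine ⟨hH.1, ?_, ?_, fun j => (R.memLp_lower j ((h.lap.2.1 j).const_mul _)).1, h.memLp_source,
    h.lap.1, ?_, fun j => R.memLp_raise j ((hH.2.1 j).const_mul _),
    fun j => (R.memLp_lower j h.lap.1).1⟩
  · refine memLp_mul_groundState hα (atomMeasure_le y) (c := 3 * (α * (M / y) + M / y ^ 2))
      (measurable_localError hθ α hy).aestronglyMeasurable ?_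
    filter_upwards [ae_atomMeasure_ne_zero y] with x hx
    exact abs_localError_le hα (hb y hy) hx
  · exact memLp_wallPotential_mul hy measurable_id (ae_lt_wall y) hH.1
      (memLp_of_weight_le ((measurable_coord 0).const_sub y).inv hH.1 hH.2.1 hH.hardy_wall)
  · exact memLp_wallPotential_mul hy measurable_fst (ae_joint_fst (ae_lt_wall y)) h.lap.1
      h.memLp_wall

lemma memLp_fin_sum {X : Type*} [MeasurableSpace X] {μ : Measure X} {g : Fin 3 → X → ℂ}
    (hg : ∀ j, MemLp (g j) 2 μ) : MemLp (fun x => ∑ j, g j x) 2 μ :=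
  memLp_finsetSum _ fun j _ => hg j

lemma Radiation.Components.memLp_localSource (h : R.Components θ α y Φ G) :
    MemLp (R.localSource θ α y) 2 (jointMeasure y) := (memLp_fin_sum h.raiseGrad).const_mul _

lemma Radiation.Components.memLp_value (h : R.Components θ α y Φ G) :
    MemLp (R.hamiltonianValue θ α y Φ G).1 2 (atomMeasure y) ∧
    MemLp (R.hamiltonianValue θ α y Φ G).2 2 (jointMeasure y) :=
  ⟨(((h.ground.const_mul _).add h.error).add (h.wallGround.const_mul _)).add
      ((memLp_fin_sum h.lowerGrad).const_mul _),
    (((h.source.add (h.field.const_mul _)).add (h.wallField.const_mul _)).add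
      (h.memLp_localSource.const_mul _)).add
      ((memLp_fin_sum fun j => R.memLp_raise j (h.lowerField j)).const_mul _)⟩

/-- In the vacuum sector the Coulomb term cancels against `-Δ (χ_y u_α)`; in the photon sector the
equation for `Φ_#` replaces `(h_α + H_f⁺) Φ` by the source plus `e_α Φ`. -/
lemma Radiation.IsSharpField.hasHamiltonianValue (h : R.IsSharpField α y Φ G w)
    (hθ : IsLocalizer θ) (hα : 0 < α) (hy : 0 < y) :
    R.HasHamiltonianValue α y (localGround θ α y, Φ) (R.hamiltonianValue θ α y Φ G) := by
  have hv := (h.components hθ hα hy).memLp_value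
  refine ⟨_, _, G, w, isDirichletLaplacian_localGround hθ hα hy, h.lap, h.memLp_freq, hv.1, hv.2,
    Eventually.of_forall fun x => ?_, ?_⟩
  · simp only [Radiation.hamiltonianValue, Radiation.potential, div_eq_mul_inv]
    push_cast
    ring
  · filter_upwards [h.eq] with p hp
    simp only [Radiation.hamiltonianValue, Radiation.potential, Radiation.localSource]
    rw [hp]
    push_cast
    ring

lemma conj_localGround (x : E3) : conj (localGround θ α y x) = localGround θ α y x :=
  Complex.conj_ofReal _

lemma conj_localGradient (j : Fin 3) (x : E3) :
    conj (localGradient θ α y j x) = localGradient θ α y j x := Complex.conj_ofReal _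

/-- The momentum operator is symmetric between the two sectors. -/
lemma Radiation.IsSharpField.braket_lower (h : R.IsSharpField α y Φ G w)
    (hθ : IsLocalizer θ) (hα : 0 < α) (hy : 0 < y) (j : Fin 3) :
    braket (atomMeasure y) (localGround θ α y) (R.lower y j fun p => Complex.I * G j p) =
      conj (braket (jointMeasure y) Φ
        (R.raise y j fun x => Complex.I * localGradient θ α y j x)) := by
  have hH := isH10_localGround hθ hα hy
  have hf := R.memLp_raise j hH.1
  have hG := h.lap.2.1 j
  have hr := R.memLp_raise j ((hH.2.1 j).const_mul Complex.I)
  have e1 : braket (atomMeasure y) (localGround θ α y) (R.lower y j fun p => Complex.I * G j p) =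
      ∫ p, R.raise y j (localGround θ α y) p * (Complex.I * G j p) ∂jointMeasure y := by
    rw [jointMeasure, integral_prod _ (integrable_mul_L2 hf (hG.const_mul _))]
    unfold braket
    congr 1
    ext x
    rw [R.lower_eq, ← integral_const_mul, conj_localGround]
    congr 1
    ext m
    simp only [Radiation.raise]
    ring
  have e2 : conj (braket (jointMeasure y) Φ
      (R.raise y j fun x => Complex.I * localGradient θ α y j x)) =
      ∫ p, Φ p * conj (R.raise y j (fun x => Complex.I * localGradient θ α y j x) p)
        ∂jointMeasure y := by
    unfold braket
    rw [← integral_conj]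
    simp
  rw [e1, e2, jointMeasure, integral_prod_symm _ (integrable_mul_L2 hf (hG.const_mul _)),
    integral_prod_symm _ (integrable_mul_L2 h.lap.1 (memLp_conj hr))]
  refine integral_congr_ae ?_
  -- For almost every mode `Φ(·, m)` lies in `H¹₀`, as does `χ_y u_α`, so integration by parts
  -- leaves no boundary term.
  filter_upwards [h.lap.2.2.2] with m hm
  have e3 : ∫ x, R.raise y j (localGround θ α y) (x, m) * (Complex.I * G j (x, m)) ∂atomMeasure y =
      (R.formFactor y j m * Complex.I) * ∫ x, localGround θ α y x * G j (x, m) ∂atomMeasure y := by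
    rw [← integral_const_mul]
    congr 1
    ext x
    simp only [Radiation.raise]
    ring
  have e4 : ∫ x, Φ (x, m) * conj (R.raise y j (fun x => Complex.I * localGradient θ α y j x) (x, m))
      ∂atomMeasure y = (R.formFactor y j m * Complex.I) *
        -∫ x, localGradient θ α y j x * Φ (x, m) ∂atomMeasure y := by
    rw [← integral_neg, ← integral_const_mul]
    congr 1
    ext x
    simp only [Radiation.raise, map_mul, conj_localGradient, Complex.conj_ofReal, Complex.conj_I]
    ring
  rw [e3, e4, hH.integral_mul hm.1 j]

/-- The energy identity for the trial state. -/
lemma Radiation.IsSharpField.energy_eq (h : R.IsSharpField α y Φ G w)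
    (hθ : IsLocalizer θ) (hα : 0 < α) (hy : 0 < y) :
    (stateInner y (localGround θ α y, Φ) (R.hamiltonianValue θ α y Φ G)).re =
      (groundEnergy α + α * R.formFactorNormSq y) * stateNormSq y (localGround θ α y, Φ) +
      (braket (atomMeasure y) (localGround θ α y) fun x => (localError θ α y x : ℂ)).re +
      α * ∫ x, wallPotential y x * ‖localGround θ α y x‖ ^ 2 ∂atomMeasure y +
      R.phiSharpNormSq α y Φ +
      α * ∫ p, wallPotential y p.1 * ‖Φ p‖ ^ 2 ∂jointMeasure y
      - 2 * (braket (jointMeasure y) Φ (R.localSource θ α y)).re +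
      2 * α * ∑ j, ∫ x, ‖R.lower y j Φ x‖ ^ 2 ∂atomMeasure y := by
  have c := h.components hθ hα hy
  have h1 : braket (atomMeasure y) (localGround θ α y) (R.hamiltonianValue θ α y Φ G).1 =
      ((groundEnergy α + α * R.formFactorNormSq y : ℝ) : ℂ) *
        ((∫ x, ‖localGround θ α y x‖ ^ 2 ∂atomMeasure y : ℝ) : ℂ) +
      braket (atomMeasure y) (localGround θ α y) (fun x => (localError θ α y x : ℂ)) +
      (α : ℂ) * ((∫ x, wallPotential y x * ‖localGround θ α y x‖ ^ 2 ∂atomMeasure y : ℝ) : ℂ) +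
      -conj (braket (jointMeasure y) Φ (R.localSource θ α y)) := by
    -- The two off-diagonal contributions are complex conjugates of each other; their real parts add
    -- up to the factor `-2`.
    have e : conj (braket (jointMeasure y) Φ (R.localSource θ α y)) =
        2 * (Real.sqrt α : ℝ) * ∑ j, braket (atomMeasure y) (localGround θ α y)
          (R.lower y j fun p => Complex.I * G j p) := by
      unfold Radiation.localSource
      rw [braket_const_mul, braket_sum c.field c.raiseGrad]
      simp only [map_mul, map_sum, Complex.conj_ofReal, ← h.braket_lower hθ hα hy, Complex.conj_ofNat]
    simp only [Radiation.hamiltonianValue]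
    rw [braket_add c.ground (memLp_add (memLp_add (c.ground.const_mul _) c.error)
      (c.wallGround.const_mul _)) ((memLp_fin_sum c.lowerGrad).const_mul _),
      braket_add c.ground (memLp_add (c.ground.const_mul _) c.error) (c.wallGround.const_mul _),
      braket_add c.ground (c.ground.const_mul _) c.error, braket_const_mul, braket_const_mul,
      braket_const_mul, braket_self, braket_real_mul, braket_sum c.ground c.lowerGrad, e]
    ring
  have hr := fun j => R.memLp_raise j (c.lowerField j)
  have h2 : braket (jointMeasure y) Φ (R.hamiltonianValue θ α y Φ G).2 =
      braket (jointMeasure y) Φ (R.sharpSource α y) +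
      ((groundEnergy α + α * R.formFactorNormSq y : ℝ) : ℂ) *
        ((∫ p, ‖Φ p‖ ^ 2 ∂jointMeasure y : ℝ) : ℂ) +
      (α : ℂ) * ((∫ p, wallPotential y p.1 * ‖Φ p‖ ^ 2 ∂jointMeasure y : ℝ) : ℂ) +
      -braket (jointMeasure y) Φ (R.localSource θ α y) +
      2 * (α : ℂ) * ((∑ j, ∫ x, ‖R.lower y j Φ x‖ ^ 2 ∂atomMeasure y : ℝ) : ℂ) := by
    simp only [Radiation.hamiltonianValue]
    have m1 := memLp_add c.source (c.field.const_mul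
      ((groundEnergy α + α * R.formFactorNormSq y : ℝ) : ℂ))
    have m2 := memLp_add m1 (c.wallField.const_mul (α : ℂ))
    have m3 := memLp_add m2 (c.memLp_localSource.const_mul (-1))
    rw [braket_add c.field m3 ((memLp_fin_sum hr).const_mul _),
      braket_add c.field m2 (c.memLp_localSource.const_mul _),
      braket_add c.field m1 (c.wallField.const_mul _),
      braket_add c.field c.source (c.field.const_mul _), braket_const_mul, braket_const_mul,
      braket_const_mul, braket_const_mul, braket_self,
      braket_real_mul (fun p : E3 × Mode => wallPotential y p.1),
      braket_sum c.field hr]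
    simp_rw [fun j => R.braket_raise j (c.lowerField j) c.field, braket_self]
    push_cast
    ring
  simp only [stateInner, stateNormSq, Radiation.phiSharpNormSq]
  rw [h1, h2]
  simp only [Complex.add_re, Complex.neg_re, Complex.conj_re, Complex.re_ofReal_mul,
    Complex.ofReal_re]
  have e5 : (2 * (α : ℂ) * ((∑ j, ∫ x, ‖R.lower y j Φ x‖ ^ 2 ∂atomMeasure y : ℝ) : ℂ)).re =
      2 * α * ∑ j, ∫ x, ‖R.lower y j Φ x‖ ^ 2 ∂atomMeasure y := by
    rw [← Complex.ofReal_ofNat, ← Complex.ofReal_mul, ← Complex.ofReal_mul, Complex.ofReal_re]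
  rw [e5]
  ring

/-- Replacing the localized source by the full one turns `+‖Φ_#‖²_# - 2 Re ⟨Φ_#, ·⟩` into
`-‖Φ_#‖²_#`. Young with weight `α` splits the difference so that `α ‖Φ_#‖²` is of order `α⁴ log α⁻¹`
and the other part of order `α²/L⁵`. -/
lemma Radiation.IsSharpField.energy_le (h : R.IsSharpField α y Φ G w)
    (hθ : IsLocalizer θ) (hα : 0 < α) (hy : 0 < y) :
    (stateInner y (localGround θ α y, Φ) (R.hamiltonianValue θ α y Φ G)).re ≤
      (groundEnergy α + α * R.formFactorNormSq y) * stateNormSq y (localGround θ α y, Φ) +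
      (braket (atomMeasure y) (localGround θ α y) fun x => (localError θ α y x : ℂ)).re +
      α * ∫ x, wallPotential y x * ‖localGround θ α y x‖ ^ 2 ∂atomMeasure y
      - R.phiSharpNormSq α y Φ +
      α * (y⁻¹ + 1 + 2 * R.formFactorNormSq y) * ∫ p, ‖Φ p‖ ^ 2 ∂jointMeasure y +
      α⁻¹ * ∫ p, ‖R.localSource θ α y p - R.sharpSource α y p‖ ^ 2 ∂jointMeasure y := by
  have c := h.components hθ hα hy
  rw [h.energy_eq hθ hα hy]
  set A := ∫ p, ‖Φ p‖ ^ 2 ∂jointMeasure y with hA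
  have hA0 : 0 ≤ A := by positivity
  have h1 : ∫ p, wallPotential y p.1 * ‖Φ p‖ ^ 2 ∂jointMeasure y ≤ y⁻¹ * A := by
    rw [hA, ← integral_const_mul]
    refine integral_mono_ae ?_ ((integrable_norm_sq c.field).const_mul _) ?_
    · refine ((integrable_braket c.field c.wallField).re).congr (Eventually.of_forall fun p => ?_)
      simp only [mul_left_comm, Complex.conj_mul', RCLike.re_to_complex]
      rw [Complex.re_ofReal_mul, ← Complex.ofReal_pow, Complex.ofReal_re]
    · filter_upwards [ae_joint_fst (ae_lt_wall y)] with p hp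
      exact mul_le_mul_of_nonneg_right (wallPotential_le hy hp) (sq_nonneg _)
  have h2 : ∑ j, ∫ x, ‖R.lower y j Φ x‖ ^ 2 ∂atomMeasure y ≤ R.formFactorNormSq y * A := by
    rw [Radiation.formFactorNormSq, Finset.sum_mul]
    exact Finset.sum_le_sum fun j _ => (R.memLp_lower j c.field).2
  have h3 : braket (jointMeasure y) Φ (R.localSource θ α y) =
      braket (jointMeasure y) Φ (R.sharpSource α y) +
      braket (jointMeasure y) Φ (fun p => R.localSource θ α y p - R.sharpSource α y p) := by
    have hs : MemLp (fun p => R.localSource θ α y p - R.sharpSource α y p) 2 (jointMeasure y) :=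
      c.memLp_localSource.sub c.source
    rw [← braket_add c.field c.source hs]
    congr 1
    ext p
    ring
  have h4 := braket_young c.field (c.memLp_localSource.sub c.source) hα
  have h5 : (braket (jointMeasure y) Φ (R.localSource θ α y)).re = R.phiSharpNormSq α y Φ +
      (braket (jointMeasure y) Φ (R.localSource θ α y - R.sharpSource α y)).re := by
    rw [h3, Complex.add_re]
    rfl
  rw [h5]
  simp only [Pi.sub_apply] at h4
  nlinarith [mul_le_mul_of_nonneg_left h1 hα.le, mul_le_mul_of_nonneg_left h2 hα.le]

end Hamiltonian

/-! ### Tails of the ground state -/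

section Tails

variable {θ : ℝ → ℝ} {α y : ℝ}

/-- Chebyshev: where `g` can be positive, `4|x|/y ≥ 1`, and the `n`-th power of this factor brings
in the `n`-th moment. -/
lemma integral_tail_le (hα : 0 < α) (hy : 0 < y) {μ : Measure E3} (hμ : μ ≤ volume) {g : E3 → ℝ}
    (n : ℕ) {c : ℝ} (hc : 0 ≤ c) (h0 : ∀ᵐ x ∂μ, 0 ≤ g x)
    (hle : ∀ᵐ x ∂μ, g x ≤ c * groundState α x ^ 2)
    (hz : ∀ x, ‖x‖ < y / 4 → g x ≤ 0) :
    ∫ x, g x ∂μ ≤ c * (4 ^ n * ((n + 2).factorial / 2)) / (α * y) ^ n := by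
  have hi : Integrable (fun x : E3 => c * (4 / y) ^ n * (‖x‖ ^ n * groundState α x ^ 2)) volume :=
    (integrable_moment hα n).const_mul _
  calc ∫ x, g x ∂μ ≤ ∫ x, c * (4 / y) ^ n * (‖x‖ ^ n * groundState α x ^ 2) ∂μ := by
        refine integral_mono_of_nonneg h0 (hi.mono_measure hμ) ?_
        filter_upwards [hle] with x hx
        by_cases hxy : ‖x‖ < y / 4
        · exact (hz x hxy).trans (by positivity)
        · refine hx.trans ?_
          have h1 : 1 ≤ (4 / y * ‖x‖) ^ n := by
            apply one_le_pow₀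
            rw [div_mul_eq_mul_div, le_div_iff₀ hy]
            linarith [not_lt.1 hxy]
          rw [mul_pow] at h1
          have h2 : 0 ≤ c * groundState α x ^ 2 := by positivity
          nlinarith
    _ ≤ ∫ x, c * (4 / y) ^ n * (‖x‖ ^ n * groundState α x ^ 2) :=
        integral_mono_measure hμ (Eventually.of_forall fun x => by positivity) hi
    _ = _ := by
        rw [integral_const_mul, integral_moment hα, div_pow, mul_pow]
        field_simp

lemma localGround_norm_sq (θ : ℝ → ℝ) (α y : ℝ) (x : E3) :
    ‖localGround θ α y x‖ ^ 2 = cutoff θ y x ^ 2 * groundState α x ^ 2 := by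
  rw [localGround, Complex.norm_real, Real.norm_eq_abs, sq_abs, mul_pow]
  rfl

lemma localGround_eq_zero (hθ : IsLocalizer θ) (hy : 0 < y) {x : E3} (hx : y / 3 ≤ ‖x‖) :
    localGround θ α y x = 0 := by
  have := hθ.cutoff_zero hy hx
  simp only [cutoff] at this
  simp [localGround, this]

lemma norm_lt_of_mem (hy : 0 < y) {x : E3} (hx : x ∉ atomRegion y) : y / 3 ≤ ‖x‖ := by
  have h1 := (le_abs_self (x 0)).trans (abs_coord_le x 0)
  have h2 : ¬ x 0 < y := hx
  linarith [not_lt.1 h2]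

lemma cutoff_sq_le (hθ : IsLocalizer θ) (y : ℝ) (x : E3) : cutoff θ y x ^ 2 ≤ 1 :=
  pow_le_one₀ (hθ.cutoff_mem y x).1 (hθ.cutoff_mem y x).2

lemma integrable_cutoff_moment (hθ : IsLocalizer θ) (hα : 0 < α) (hy : 0 < y) (n : ℕ) :
    Integrable fun x : E3 => ‖x‖ ^ n * (cutoff θ y x ^ 2 * groundState α x ^ 2) := by
  refine (integrable_moment hα n).mono' ?_ (Eventually.of_forall fun x => ?_)
  · exact ((continuous_norm.pow n).mul (((hθ.contDiff_cutoff hy).continuous.pow 2).mul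
      ((continuous_groundState α).pow 2))).aestronglyMeasurable
  · rw [Real.norm_of_nonneg (by positivity)]
    gcongr
    exact mul_le_of_le_one_left (sq_nonneg _) (cutoff_sq_le hθ y x)

lemma integral_localGround_sq (hθ : IsLocalizer θ) (hy : 0 < y) :
    ∫ x, ‖localGround θ α y x‖ ^ 2 ∂atomMeasure y = ∫ x, cutoff θ y x ^ 2 * groundState α x ^ 2 := by
  rw [IsTest.setIntegral_eq]
  · simp_rw [localGround_norm_sq]
  · intro x hx
    rw [localGround_eq_zero hθ hy (norm_lt_of_mem hy hx)]
    simp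

/-- The same device applied to the mass removed by the cut-off, with `k` extra powers of `4|x|/y`.
-/
lemma localGround_moment_ge (hθ : IsLocalizer θ) (hα : 0 < α) (hy : 0 < y) (n k : ℕ) :
    (∫ x : E3, ‖x‖ ^ n * groundState α x ^ 2) -
      ∫ x : E3, ‖x‖ ^ n * (cutoff θ y x ^ 2 * groundState α x ^ 2) ≤
      (4 / y) ^ k * ∫ x : E3, ‖x‖ ^ (n + k) * groundState α x ^ 2 := by
  rw [← integral_sub (integrable_moment hα n) (integrable_cutoff_moment hθ hα hy n),
    ← integral_const_mul]
  refine integral_mono ((integrable_moment hα n).sub (integrable_cutoff_moment hθ hα hy n))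
    ((integrable_moment hα (n + k)).const_mul _) fun x => ?_
  simp only
  by_cases hxy : ‖x‖ ≤ y / 4
  · rw [hθ.cutoff_one hy hxy]
    have : 0 ≤ (4 / y) ^ k * (‖x‖ ^ (n + k) * groundState α x ^ 2) := by positivity
    linarith
  · have h1 : 1 ≤ (4 / y * ‖x‖) ^ k := by
      apply one_le_pow₀
      rw [div_mul_eq_mul_div, le_div_iff₀ hy]
      linarith [not_le.1 hxy]
    rw [mul_pow] at h1
    have h2 : 0 ≤ ‖x‖ ^ n * groundState α x ^ 2 := by positivity
    have h3 : 0 ≤ ‖x‖ ^ n * (cutoff θ y x ^ 2 * groundState α x ^ 2) := by positivity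
    have h4 := mul_le_mul_of_nonneg_right h1 h2
    rw [pow_add]
    linarith

lemma localGround_norm_le (hθ : IsLocalizer θ) (hα : 0 < α) (hy : 0 < y) :
    ∫ x, ‖localGround θ α y x‖ ^ 2 ∂atomMeasure y ≤ 1 := by
  rw [integral_localGround_sq hθ hy, ← integral_groundState_sq hα]
  refine integral_mono (by simpa using integrable_cutoff_moment hθ hα hy 0)
    (by simpa using integrable_moment hα 0) fun x =>
    mul_le_of_le_one_left (sq_nonneg _) (cutoff_sq_le hθ y x)

/-- The constant is `4⁵ · 7!/2`, from the fifth moment. -/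
lemma one_sub_localGround_norm_le (hθ : IsLocalizer θ) (hα : 0 < α) (hy : 0 < y) :
    1 - ∫ x, ‖localGround θ α y x‖ ^ 2 ∂atomMeasure y ≤ 2580480 / (α * y) ^ 5 := by
  have h := localGround_moment_ge hθ hα hy 0 5
  simp only [pow_zero, one_mul, zero_add] at h
  rw [integral_groundState_sq hα, integral_moment hα, ← integral_localGround_sq hθ hy] at h
  refine h.trans (le_of_eq ?_)
  norm_num [Nat.factorial]
  field_simp
  norm_num

/-- On the ball of radius `1/(4α)` the cut-off is `1` and the density is at least `e^{-1/4}
α³/(8π)`. This keeps the norm away from zero uniformly, also for `L` near `1`. -/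
lemma localGround_norm_ge (hθ : IsLocalizer θ) (hα : 0 < α) (hy : α⁻¹ ≤ y) :
    Real.exp (-1 / 4) / 384 ≤ ∫ x, ‖localGround θ α y x‖ ^ 2 ∂atomMeasure y := by
  have hy0 : 0 < y := (inv_pos.2 hα).trans_le hy
  rw [integral_localGround_sq hθ hy0]
  have hint : Integrable fun x : E3 => cutoff θ y x ^ 2 * groundState α x ^ 2 := by
    simpa using integrable_cutoff_moment hθ hα hy0 0
  set B := Metric.ball (0 : E3) (4 * α)⁻¹ with hB
  have hpi := Real.pi_pos
  have hval : (volume B).toReal = (4 * α)⁻¹ ^ 3 * (Real.pi * 4 / 3) := by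
    rw [hB, EuclideanSpace.volume_ball_fin_three, ENNReal.toReal_mul, ENNReal.toReal_pow,
      ENNReal.toReal_ofReal (by positivity), ENNReal.toReal_ofReal (by positivity)]
  calc Real.exp (-1 / 4) / 384 = ∫ x in B, Real.exp (-1 / 4) * (α ^ 3 / (8 * Real.pi)) := by
        rw [setIntegral_const, measureReal_def, hval, smul_eq_mul]
        field_simp
        norm_num
    _ ≤ ∫ x in B, cutoff θ y x ^ 2 * groundState α x ^ 2 := by
        refine setIntegral_mono_on ?_ hint.integrableOn Metric.isOpen_ball.measurableSet
          fun x hx => ?_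
        · exact integrableOn_const (by rw [hB]; exact measure_ball_lt_top.ne)
        · rw [hB, mem_ball_zero_iff] at hx
          have h1 : ‖x‖ * (4 * α) ≤ 1 := by
            rw [← le_div_iff₀ (by positivity), one_div]
            exact hx.le
          have h2 : ‖x‖ ≤ y / 4 := by
            have : (4 * α)⁻¹ = α⁻¹ / 4 := by rw [mul_inv]; ring
            linarith
          rw [hθ.cutoff_one hy0 h2, one_pow, one_mul, groundState, mul_pow, div_pow,
            Real.sq_sqrt (by positivity), ← Real.exp_nat_mul, ← Real.rpow_natCast (α ^ (3 / 2 : ℝ)),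
            ← Real.rpow_mul hα.le]
          have e : α ^ (3 / 2 * ((2 : ℕ) : ℝ)) = α ^ 3 := by
            rw [← Real.rpow_natCast]; norm_num
          rw [e, mul_comm]
          gcongr
          push_cast
          linarith
    _ ≤ _ := setIntegral_le_integral hint (Eventually.of_forall fun x => by positivity)

/-- The localization error is of order `α² / L⁵`. -/
lemma IsLocalizer.exists_error_bound (hθ : IsLocalizer θ) : ∃ C : ℝ, 0 ≤ C ∧ ∀ α y : ℝ, 0 < α →
    α⁻¹ ≤ y →
    (braket (atomMeasure y) (localGround θ α y) fun x => (localError θ α y x : ℂ)).re ≤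
      C * (α ^ 2 / (α * y) ^ 5) := by
  obtain ⟨M, hM, hb⟩ := hθ.exists_bound
  refine ⟨6 * M * (4 ^ 5 * ((5 + 2).factorial / 2)), by positivity, fun α y hα hαy => ?_⟩
  have hy : 0 < y := (inv_pos.2 hα).trans_le hαy
  have hyi : y⁻¹ ≤ α := by rw [← inv_inv α]; exact inv_anti₀ (inv_pos.2 hα) hαy
  have h1 : (braket (atomMeasure y) (localGround θ α y) fun x => (localError θ α y x : ℂ)).re ≤
      ∫ x, groundState α x * |localError θ α y x| ∂atomMeasure y := by
    refine (Complex.re_le_norm _).trans ((norm_integral_le_integral_norm _).trans ?_)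
    refine integral_mono_of_nonneg (Eventually.of_forall fun x => norm_nonneg _) ?_
      (Eventually.of_forall fun x => ?_)
    · have hi : Integrable (fun x : E3 => 3 * (α * (M / y) + M / y ^ 2) * groundState α x ^ 2)
          (atomMeasure y) := by
        simpa using ((integrable_moment hα 0).const_mul
          (3 * (α * (M / y) + M / y ^ 2))).mono_measure (atomMeasure_le y)
      refine hi.mono' ((continuous_groundState α).measurable.mul
        (measurable_localError hθ α hy).abs).aestronglyMeasurable ?_
      filter_upwards [ae_atomMeasure_ne_zero y] with x hx
      have hu := groundState_nonneg hα.le x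
      rw [Real.norm_of_nonneg (by positivity)]
      have := mul_le_mul_of_nonneg_left (abs_localError_le hα (hb y hy) hx) hu
      linarith
    · have hu := groundState_nonneg hα.le x
      simp only [norm_mul, RCLike.norm_conj, Complex.norm_real, Real.norm_eq_abs, localGround]
      rw [abs_of_nonneg hu, abs_of_nonneg (hθ.mem _).1]
      gcongr
      exact mul_le_of_le_one_left hu (hθ.mem _).2
  have h2 := integral_tail_le hα hy (atomMeasure_le y)
    (g := fun x => groundState α x * |localError θ α y x|) 5
    (c := 3 * (α * (M / y) + M / y ^ 2)) (by positivity)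
    (Eventually.of_forall fun x => mul_nonneg (groundState_nonneg hα.le x) (abs_nonneg _))
    (by
      filter_upwards [ae_atomMeasure_ne_zero y] with x hx
      have := mul_le_mul_of_nonneg_left (abs_localError_le hα (hb y hy) hx)
        (groundState_nonneg hα.le x)
      linarith)
    (fun x hx => by simp [hθ.localError_eq_zero α hy hx])
  refine h1.trans (h2.trans ?_)
  -- Since `1/y ≤ α`, each derivative of the cut-off costs at most a factor of order `α`.
  have h3 : 3 * (α * (M / y) + M / y ^ 2) ≤ 6 * M * α ^ 2 := by
    have e : 3 * (α * (M / y) + M / y ^ 2) = 3 * M * (α * y⁻¹ + y⁻¹ * y⁻¹) := by field_simp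
    rw [e]
    have h4 : α * y⁻¹ + y⁻¹ * y⁻¹ ≤ 2 * α ^ 2 := by
      have : 0 < y⁻¹ := by positivity
      nlinarith
    nlinarith
  rw [mul_div_assoc]
  calc _ ≤ 6 * M * α ^ 2 * (4 ^ 5 * ((5 + 2).factorial / 2) / (α * y) ^ 5) := by gcongr
    _ = _ := by ring

/-- The error made by localizing the source of `Φ_#`. -/
lemma Radiation.exists_localSource_bound (R : Radiation) (hθ : IsLocalizer θ) :
    ∃ C : ℝ, 0 ≤ C ∧ ∀ α y : ℝ, 0 < α → α⁻¹ ≤ y →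
    α⁻¹ * ∫ p, ‖R.localSource θ α y p - R.sharpSource α y p‖ ^ 2 ∂jointMeasure y ≤
      C * (α ^ 2 / (α * y) ^ 5) := by
  obtain ⟨M, hM, hb⟩ := hθ.exists_bound
  have hE : 0 ≤ ∫ k, R.envelope k := integral_nonneg R.envelope_nonneg
  refine ⟨288 * ((1 + M) ^ 2 * (4 ^ 5 * ((5 + 2).factorial / 2))) * ∫ k, R.envelope k,
    by positivity, fun α y hα hαy => ?_⟩
  have hy : 0 < y := (inv_pos.2 hα).trans_le hαy
  have hyi : y⁻¹ ≤ α := by rw [← inv_inv α]; exact inv_anti₀ (inv_pos.2 hα) hαy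
  -- The difference of the sources is a superposition as well; its fibres vanish for `|x| < y/4` and
  -- are bounded by `(1 + M) α u_α`.
  set T : Fin 3 → ℝ × E3 → ℂ := fun j q =>
    localGradient θ α y j q.2 - (fderiv ℝ (groundState α) q.2 (unitVec j) : ℂ) with hT
  have e : (fun p => R.localSource θ α y p - R.sharpSource α y p) = R.superpose α y T := by
    ext p
    rw [R.sharpSource_eq]
    simp only [Radiation.localSource, Radiation.superpose, Radiation.raise, hT, Fin.sum_univ_three]
    ring
  have hTle : ∀ s j, ∀ᵐ x ∂atomMeasure y, ‖T j (s, x)‖ ^ 2 ≤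
      ((1 + M) * α) ^ 2 * groundState α x ^ 2 := by
    intro s j
    filter_upwards [ae_atomMeasure_ne_zero y] with x hx
    have hu := groundState_nonneg hα.le x
    rw [← mul_pow]
    gcongr
    have h1 : T j (s, x) = (((cutoff θ y x - 1) * fderiv ℝ (groundState α) x (unitVec j) +
        cutoffDeriv θ y j x * groundState α x : ℝ) : ℂ) := by
      simp only [hT, localGradient]
      push_cast
      ring
    rw [h1, Complex.norm_real, Real.norm_eq_abs]
    refine (abs_add_le _ _).trans ?_
    have h2 : |cutoff θ y x - 1| ≤ 1 := by
      have := hθ.cutoff_mem y x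
      rw [abs_le]; constructor <;> linarith
    have h3 := abs_fderiv_groundState_le hα.le hx j
    have h4 : |cutoffDeriv θ y j x| ≤ M * α := by
      refine (hb y hy j x).1.trans ?_
      rw [div_eq_mul_inv]
      gcongr
    rw [abs_mul, abs_mul, abs_of_nonneg hu]
    have h5 := mul_le_of_le_one_left (abs_nonneg (fderiv ℝ (groundState α) x (unitVec j))) h2
    have h6 := mul_le_mul_of_nonneg_right h4 hu
    have h7 : 0 ≤ α * groundState α x := by positivity
    linarith
  have hTL : ∀ s j, MemLp (fun x => T j (s, x)) 2 (atomMeasure y) := fun s j =>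
    ((isH10_localGround hθ hα hy).2.1 j).sub (memLp_fderiv_groundState hα (atomMeasure_le y) j)
  have hTb : ∀ s j, ∫ x, ‖T j (s, x)‖ ^ 2 ∂atomMeasure y ≤
      ((1 + M) * α) ^ 2 * (4 ^ 5 * ((5 + 2).factorial / 2)) / (α * y) ^ 5 := fun s j =>
    integral_tail_le hα hy (atomMeasure_le y) 5 (by positivity)
      (Eventually.of_forall fun x => by positivity) (hTle s j) fun x hx => by
        have h1 : T j (s, x) = 0 := by
          simp [hT, localGradient, hθ.cutoff_one hy hx.le, hθ.cutoffDeriv_eq_zero hy j hx]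
        simp [h1]
  have hTm : ∀ j, Measurable (T j) := fun j => by
    refine Measurable.sub ?_ (Complex.measurable_ofReal.comp
      ((measurable_fderiv_groundState α j).comp measurable_snd))
    have : Measurable (localGradient θ α y j) := Complex.measurable_ofReal.comp
      (((hθ.contDiff_cutoff hy).continuous.measurable.mul (measurable_fderiv_groundState α j)).add
        ((hθ.contDiff_cutoffDeriv hy j).continuous.measurable.mul
          (continuous_groundState α).measurable))
    exact this.comp measurable_snd
  have h := (R.memLp_superpose hα.le y hTm hTL measurable_const (fun _ _ => by positivity) hTb
    (R.integrable_envelope_const _)).2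
  rw [integral_mul_const] at h
  simp_rw [← e] at h
  refine (mul_le_mul_of_nonneg_left h (by positivity)).trans (le_of_eq ?_)
  field_simp

end Tails

/-! ### The electrostatic interaction with the wall -/

section Wall

variable {θ : ℝ → ℝ} {α y : ℝ}

/-- The Taylor polynomial of degree three with a generous fourth-order term: its square times `1 +
w` exceeds `1` by `w⁴` times a polynomial that is nonnegative on this range. -/
lemma inv_sqrt_one_add_le {w : ℝ} (hw : |w| ≤ 2 / 5) :
    (Real.sqrt (1 + w))⁻¹ ≤ 1 - w / 2 + 3 / 8 * w ^ 2 - 5 / 16 * w ^ 3 + w ^ 4 := by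
  obtain ⟨h1, h2⟩ := abs_le.1 hw
  have h3 : w ^ 2 ≤ 4 / 25 := by nlinarith
  have h4 : |w ^ 3| ≤ 8 / 125 := by
    rw [abs_pow]; calc |w| ^ 3 ≤ (2 / 5) ^ 3 := by gcongr
      _ = _ := by norm_num
  have h5 : |w ^ 5| ≤ 32 / 3125 := by
    rw [abs_pow]; calc |w| ^ 5 ≤ (2 / 5) ^ 5 := by gcongr
      _ = _ := by norm_num
  have h4' := abs_le.1 h4
  have h5' := abs_le.1 h5
  have h6 : 0 ≤ w ^ 4 := by positivity
  have h7 : 0 ≤ w ^ 2 := by positivity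
  rw [← Real.sqrt_inv]
  refine Real.sqrt_le_iff.2 ⟨by linarith, ?_⟩
  rw [inv_le_iff_one_le_mul₀ (by linarith)]
  have hq : 0 ≤ 93 / 64 + 78 / 64 * w - 99 / 256 * w ^ 2 + 57 / 256 * w ^ 3 + 3 / 8 * w ^ 4 + w ^ 5 := by
    linarith
  have := mul_nonneg h6 hq
  linear_combination this

/-- Odd powers of `z` cancel in the sum. The terms of higher order are either negative or, by `z² ≤
s`, covered by `18 s²`. -/
lemma inv_sqrt_symm_le {s z : ℝ} (hs : s ≤ 1 / 36) (hz : z ^ 2 ≤ s) :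
    (Real.sqrt (1 + (s - 2 * z)))⁻¹ + (Real.sqrt (1 + (s + 2 * z)))⁻¹ ≤
      2 * (1 - s / 2 + 3 / 2 * z ^ 2 + 18 * s ^ 2) := by
  have hs0 : 0 ≤ s := (sq_nonneg z).trans hz
  have hz6 : |z| ≤ 1 / 6 := by
    apply abs_le_of_sq_le_sq _ (by norm_num)
    linarith
  obtain ⟨z1, z2⟩ := abs_le.1 hz6
  have h1 := inv_sqrt_one_add_le (w := s - 2 * z) (abs_le.2 ⟨by linarith, by linarith⟩)
  have h2 := inv_sqrt_one_add_le (w := s + 2 * z) (abs_le.2 ⟨by linarith, by linarith⟩)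
  have e1 : z ^ 4 ≤ s ^ 2 := by nlinarith [sq_nonneg z]
  have e2 : s ^ 2 * z ^ 2 ≤ s ^ 2 / 36 := by nlinarith [sq_nonneg s]
  have e3 : s ^ 4 ≤ s ^ 2 / 36 := by
    have : s ^ 2 ≤ 1 / 36 := by nlinarith
    nlinarith [sq_nonneg s]
  have e4 : 0 ≤ s ^ 3 := by positivity
  have e5 : 0 ≤ s * z ^ 2 := by positivity
  refine (add_le_add h1 h2).trans ?_
  have e6 : 1 - (s - 2 * z) / 2 + 3 / 8 * (s - 2 * z) ^ 2 - 5 / 16 * (s - 2 * z) ^ 3 +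
      (s - 2 * z) ^ 4 + (1 - (s + 2 * z) / 2 + 3 / 8 * (s + 2 * z) ^ 2 -
      5 / 16 * (s + 2 * z) ^ 3 + (s + 2 * z) ^ 4) =
      2 * (1 - s / 2 + 3 / 8 * (s ^ 2 + 4 * z ^ 2) - 5 / 16 * (s ^ 3 + 12 * (s * z ^ 2)) +
        (s ^ 4 + 24 * (s ^ 2 * z ^ 2) + 16 * z ^ 4)) := by ring
  rw [e6]
  linarith [sq_nonneg s]

lemma norm_sub_center (hy : 0 < y) (x : E3) : ‖x - !₂[2 * y, 0, 0]‖ =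
    2 * y * Real.sqrt (1 + (‖x‖ ^ 2 / (4 * y ^ 2) - 2 * (x 0 / (2 * y)))) := by
  have h : ‖x - !₂[2 * y, 0, 0]‖ ^ 2 =
      (2 * y) ^ 2 * (1 + (‖x‖ ^ 2 / (4 * y ^ 2) - 2 * (x 0 / (2 * y)))) := by
    rw [norm_sq_eq_sum, norm_sq_eq_sum]
    simp [Fin.sum_univ_three]
    field_simp
    ring
  rw [← Real.sqrt_sq (norm_nonneg _), h, Real.sqrt_mul (sq_nonneg _), Real.sqrt_sq (by positivity)]

/-- In the unit `2y`, with `s = |x|²/(4y²)` and `z = x₁/(2y)`, the constants cancel; the expansion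
around the image charge contributes `-s/2 + 3z²/2` and the electron's own image `-2z²`, in all `-(s
+ z²)/2`. -/
lemma wallPotential_symm_le (hy : 0 < y) {x : E3} (hx : ‖x‖ ≤ y / 3) :
    wallPotential y x + wallPotential y (-x) ≤
      -(8 * y ^ 3)⁻¹ * ‖x‖ ^ 2 - (8 * y ^ 3)⁻¹ * x 0 ^ 2 + 9 / 8 * (y ^ 5)⁻¹ * ‖x‖ ^ 4 := by
  obtain ⟨a1, a2⟩ := abs_le.1 (abs_coord_le x 0)
  have hneg : (-x) 0 = -x 0 := rfl
  set s := ‖x‖ ^ 2 / (4 * y ^ 2) with hs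
  set z := x 0 / (2 * y) with hz
  have ex : x 0 = 2 * y * z := by rw [hz]; field_simp
  have er : ‖x‖ ^ 2 = 4 * y ^ 2 * s := by rw [hs]; field_simp
  have hs36 : s ≤ 1 / 36 := by
    rw [hs, div_le_iff₀ (by positivity)]
    nlinarith [norm_nonneg x]
  have hzs : z ^ 2 ≤ s := by
    have h1 : x 0 ^ 2 ≤ ‖x‖ ^ 2 := by rw [← sq_abs (x 0)]; gcongr; exact abs_coord_le x 0
    rw [ex, er] at h1
    have : 0 < 4 * y ^ 2 := by positivity
    nlinarith
  have hz4 : 4 * z ^ 2 < 1 := by linarith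
  have hzb : |2 * z| < 1 := by
    rw [← sq_lt_one_iff_abs_lt_one]; linarith [mul_pow 2 z 2]
  obtain ⟨z1, z2⟩ := abs_lt.1 hzb
  have h := inv_sqrt_symm_le hs36 hzs
  rw [wallPotential_eq hy (by linarith : x 0 < y),
    wallPotential_eq hy (by rw [hneg]; linarith : (-x) 0 < y), norm_sub_center hy,
    norm_sub_center hy, norm_neg, hneg]
  have e1 : 1 + (s - 2 * (-x 0 / (2 * y))) = 1 + (s + 2 * z) := by rw [hz]; ring
  rw [← hs, ← hz, e1]
  have e2 : (y - x 0)⁻¹ + (y - -x 0)⁻¹ ≥ y⁻¹ * (2 * (1 + 4 * z ^ 2)) := by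
    have f1 : (y - x 0)⁻¹ = y⁻¹ * (1 - 2 * z)⁻¹ := by rw [ex, ← mul_inv]; congr 1; ring
    have f2 : (y - -x 0)⁻¹ = y⁻¹ * (1 + 2 * z)⁻¹ := by rw [ex, ← mul_inv]; congr 1; ring
    rw [f1, f2, ← mul_add]
    gcongr
    have f3 : (1 - 2 * z)⁻¹ + (1 + 2 * z)⁻¹ = 2 / (1 - 4 * z ^ 2) := by
      have g1 : 1 - 2 * z ≠ 0 := by linarith
      have g2 : 1 + 2 * z ≠ 0 := by linarith
      rw [show 1 - 4 * z ^ 2 = (1 - 2 * z) * (1 + 2 * z) by ring]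
      field_simp
      ring
    rw [f3, le_div_iff₀ (by linarith)]
    nlinarith [sq_nonneg (z ^ 2)]
  have e3 := mul_le_mul_of_nonneg_left h (inv_nonneg.2 hy.le)
  have e4 : (8 * y ^ 3)⁻¹ * ‖x‖ ^ 2 = y⁻¹ * (s / 2) := by rw [er]; field_simp; ring
  have e5 : (8 * y ^ 3)⁻¹ * x 0 ^ 2 = y⁻¹ * (z ^ 2 / 2) := by rw [ex]; field_simp; ring
  have e6 : 9 / 8 * (y ^ 5)⁻¹ * ‖x‖ ^ 4 = y⁻¹ * (18 * s ^ 2) := by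
    rw [show ‖x‖ ^ 4 = (‖x‖ ^ 2) ^ 2 by ring, er]; field_simp; ring
  have e7 : (4 * y)⁻¹ = y⁻¹ * (1 / 4) := by rw [mul_inv]; ring
  have e8 : ∀ t, (2 * y * t)⁻¹ = y⁻¹ * (1 / 2 * t⁻¹) := fun t => by rw [mul_inv, mul_inv]; ring
  rw [neg_mul, e4, e5, e6, e7, e8, e8]
  linarith

/-- Radial densities weigh the coordinates equally. -/
lemma integral_coord_sq_radial (g : ℝ → ℝ)
    (hi : Integrable fun x : E3 => ‖x‖ ^ 2 * g ‖x‖) (hg : Measurable g) :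
    Integrable (fun x : E3 => x 0 ^ 2 * g ‖x‖) ∧
    ∫ x : E3, x 0 ^ 2 * g ‖x‖ = 1 / 3 * ∫ x : E3, ‖x‖ ^ 2 * g ‖x‖ := by
  have hint : ∀ j, Integrable fun x : E3 => x j ^ 2 * g ‖x‖ := fun j => by
    refine hi.mono (((measurable_coord j).pow_const 2).mul
      (hg.comp measurable_norm)).aestronglyMeasurable (Eventually.of_forall fun x => ?_)
    rw [norm_mul, norm_mul, norm_pow, norm_pow, norm_norm]
    gcongr
    exact abs_coord_le x j
  have hswap : ∀ j, ∫ x : E3, x j ^ 2 * g ‖x‖ = ∫ x : E3, x 0 ^ 2 * g ‖x‖ := by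
    intro j
    set T : E3 ≃ₗᵢ[ℝ] E3 := LinearIsometryEquiv.piLpCongrLeft 2 ℝ ℝ (Equiv.swap 0 j) with hT
    have h := T.measurePreserving.integral_comp T.toHomeomorph.measurableEmbedding
      fun x : E3 => x 0 ^ 2 * g ‖x‖
    rw [← h]
    congr 1
    ext x
    have e : T x 0 = x j := by simp [hT, LinearIsometryEquiv.piLpCongrLeft_apply, Equiv.piCongrLeft']
    rw [T.norm_map, e]
  refine ⟨hint 0, ?_⟩
  have h1 : ∫ x : E3, ‖x‖ ^ 2 * g ‖x‖ = ∑ j, ∫ x : E3, x j ^ 2 * g ‖x‖ := by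
    rw [← integral_finsetSum _ fun j _ => hint j]
    congr 1
    ext x
    rw [norm_sq_eq_sum, Finset.sum_mul]
  rw [h1]
  simp_rw [hswap]
  simp

/-- The density is even, so `V_y` may be averaged with its reflection, and `x₁²` averages to
`|x|²/3`; with the second moment `12/α²` the quadratic term is exactly `-α²/L³`. The cut-off in the
second moment and the quartic remainder add up to `(960 + 405)/2 < 683`. -/
lemma integral_wallPotential_le (hθ : IsLocalizer θ) (hα : 0 < α) (hy : 0 < y)
    (hV : MemLp (fun x => (wallPotential y x : ℂ) * localGround θ α y x) 2 (atomMeasure y)) :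
    α * ∫ x, wallPotential y x * ‖localGround θ α y x‖ ^ 2 ∂atomMeasure y ≤
      -(α ^ 2 / (α * y) ^ 3) + 683 * (α ^ 2 / (α * y) ^ 5) := by
  set f : E3 → ℝ := fun x => cutoff θ y x ^ 2 * groundState α x ^ 2 with hf
  have hf0 : ∀ x, 0 ≤ f x := fun x => by positivity
  have hout : ∀ x, y / 3 ≤ ‖x‖ → f x = 0 := fun x hx => by simp [hf, hθ.cutoff_zero hy hx]
  have hfV : ∀ x, wallPotential y x * ‖localGround θ α y x‖ ^ 2 = wallPotential y x * f x :=
    fun x => by rw [localGround_norm_sq]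
  have hzero : ∀ x, x ∉ atomRegion y → wallPotential y x * f x = 0 := fun x hx => by
    rw [hout x (norm_lt_of_mem hy hx), mul_zero]
  have hint : Integrable fun x => wallPotential y x * f x := by
    have h1 : IntegrableOn (fun x => wallPotential y x * f x) (atomRegion y) := by
      have h2 := (integrable_braket (isH10_localGround hθ hα hy).1 hV).re
      refine h2.congr (Eventually.of_forall fun x => ?_)
      simp only [mul_left_comm, Complex.conj_mul', RCLike.re_to_complex, ← hfV]
      rw [Complex.re_ofReal_mul, ← Complex.ofReal_pow, Complex.ofReal_re]
    refine (integrableOn_iff_integrable_of_support_subset fun x hx => ?_).1 h1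
    by_contra h
    exact hx (hzero x h)
  have hfneg : ∀ x, f (-x) = f x := fun x => by
    simp [hf, cutoff, groundState]
  have hint' : Integrable fun x => wallPotential y (-x) * f x := by
    have := hint.comp_neg
    simpa only [hfneg] using this
  have hsymm : ∫ x, wallPotential y (-x) * f x = ∫ x, wallPotential y x * f x := by
    rw [← integral_neg_eq_self (fun x => wallPotential y x * f x)]
    simp only [hfneg]
  have hm : ∀ n, Integrable fun x => ‖x‖ ^ n * f x := integrable_cutoff_moment hθ hα hy
  set g : ℝ → ℝ := fun r => θ (r / y) ^ 2 *
    (α ^ (3 / 2 : ℝ) / Real.sqrt (8 * Real.pi) * Real.exp (-(α * r / 2))) ^ 2 with hg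
  have hgm : Measurable g := by
    have := hθ.smooth.continuous.measurable
    fun_prop
  obtain ⟨hc1, hc2⟩ := integral_coord_sq_radial g (hm 2) hgm
  change Integrable (fun x : E3 => x 0 ^ 2 * f x) at hc1
  change ∫ x : E3, x 0 ^ 2 * f x = 1 / 3 * ∫ x : E3, ‖x‖ ^ 2 * f x at hc2
  set m2 := ∫ x : E3, ‖x‖ ^ 2 * f x with hm2
  set m4 := ∫ x : E3, ‖x‖ ^ 4 * f x with hm4
  have hpt : ∀ x, (wallPotential y x + wallPotential y (-x)) * f x ≤
      -(8 * y ^ 3)⁻¹ * (‖x‖ ^ 2 * f x) + -(8 * y ^ 3)⁻¹ * (x 0 ^ 2 * f x) +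
        9 / 8 * (y ^ 5)⁻¹ * (‖x‖ ^ 4 * f x) := by
    intro x
    by_cases hx : ‖x‖ ≤ y / 3
    · have := mul_le_mul_of_nonneg_right (wallPotential_symm_le hy hx) (hf0 x)
      linarith
    · rw [hout x (not_le.1 hx).le]
      simp
  have h2 : 2 * ∫ x, wallPotential y x * f x ≤
      -(8 * y ^ 3)⁻¹ * m2 + -(8 * y ^ 3)⁻¹ * (1 / 3 * m2) + 9 / 8 * (y ^ 5)⁻¹ * m4 := by
    have i1 := (hm 2).const_mul (-(8 * y ^ 3)⁻¹)
    have i2 := hc1.const_mul (-(8 * y ^ 3)⁻¹)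
    have i3 := (hm 4).const_mul (9 / 8 * (y ^ 5)⁻¹)
    have h3 : ∫ x, (wallPotential y x * f x + wallPotential y (-x) * f x) ≤
        ∫ x, (-(8 * y ^ 3)⁻¹ * (‖x‖ ^ 2 * f x) + -(8 * y ^ 3)⁻¹ * (x 0 ^ 2 * f x) +
          9 / 8 * (y ^ 5)⁻¹ * (‖x‖ ^ 4 * f x)) :=
      integral_mono (hint.add hint') ((i1.add i2).add i3) fun x => by
        have := hpt x
        simp only
        linarith
    have i12 : Integrable fun x => -(8 * y ^ 3)⁻¹ * (‖x‖ ^ 2 * f x) +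
        -(8 * y ^ 3)⁻¹ * (x 0 ^ 2 * f x) := i1.add i2
    rw [integral_eq_add hint hint' fun x => rfl, integral_eq_add i12 i3 fun x => rfl,
      integral_eq_add i1 i2 fun x => rfl, integral_const_mul, integral_const_mul,
      integral_const_mul, hsymm, hc2] at h3
    linarith
  have k2 := localGround_moment_ge hθ hα hy 2 2
  have k4 : m4 ≤ 360 / α ^ 4 := by
    have : ∫ x : E3, ‖x‖ ^ 4 * groundState α x ^ 2 = 360 / α ^ 4 := by
      rw [integral_moment hα]; norm_num [Nat.factorial]
    rw [← this]
    refine integral_mono (hm 4) (integrable_moment hα 4) fun x => ?_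
    have := mul_le_of_le_one_left (sq_nonneg (groundState α x)) (cutoff_sq_le hθ y x)
    simp only [hf]
    gcongr
  rw [integral_moment hα, integral_moment hα] at k2
  change _ - m2 ≤ _ at k2
  norm_num [Nat.factorial] at k2
  have hV' : ∫ x, wallPotential y x * ‖localGround θ α y x‖ ^ 2 ∂atomMeasure y =
      ∫ x, wallPotential y x * f x := by
    simp_rw [hfV]
    exact IsTest.setIntegral_eq hzero
  rw [hV']
  have h4 : (8 * y ^ 3)⁻¹ * m2 ≥ (8 * y ^ 3)⁻¹ * (12 / α ^ 2 - (4 / y) ^ 2 * (360 / α ^ 4)) := by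
    gcongr
    linarith
  have h5 : 9 / 8 * (y ^ 5)⁻¹ * m4 ≤ 9 / 8 * (y ^ 5)⁻¹ * (360 / α ^ 4) := by gcongr
  have h6 : 2 * ∫ x, wallPotential y x * f x ≤
      -(4 / 3 * ((8 * y ^ 3)⁻¹ * (12 / α ^ 2 - (4 / y) ^ 2 * (360 / α ^ 4)))) +
        9 / 8 * (y ^ 5)⁻¹ * (360 / α ^ 4) := by linarith
  have h7 : α * ∫ x, wallPotential y x * f x ≤ α / 2 *
      (-(4 / 3 * ((8 * y ^ 3)⁻¹ * (12 / α ^ 2 - (4 / y) ^ 2 * (360 / α ^ 4)))) +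
        9 / 8 * (y ^ 5)⁻¹ * (360 / α ^ 4)) := by
    have := mul_le_mul_of_nonneg_left h6 (half_pos hα).le
    linarith
  refine h7.trans ?_
  have e : α / 2 *
      (-(4 / 3 * ((8 * y ^ 3)⁻¹ * (12 / α ^ 2 - (4 / y) ^ 2 * (360 / α ^ 4)))) +
        9 / 8 * (y ^ 5)⁻¹ * (360 / α ^ 4)) =
      -(α ^ 2 / (α * y) ^ 3) + 1365 / 2 * (α ^ 2 / (α * y) ^ 5) := by
    field_simp
    ring
  rw [e]
  have : 0 ≤ α ^ 2 / (α * y) ^ 5 := by positivity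
  linarith

end Wall

/-! ### The energy estimate -/

section Energy

variable {R : Radiation} {θ : ℝ → ℝ} {α y : ℝ} {Φ : E3 × Mode → ℂ} {G : Fin 3 → E3 × Mode → ℂ}
  {w : E3 × Mode → ℂ}

/-- From `x/N = x + x (1 - N)/N`: the correction `x` survives normalization with coefficient one,
and the crude lower bound `c` enters only the remainder. -/
lemma div_le_of_le_add {a e x δ c N κ ν : ℝ} (h : a ≤ e * N + x + δ) (hδ : 0 ≤ δ) (hc : 0 < c)
    (hN : c ≤ N) (hx : |x| ≤ κ) (hν : |1 - N| ≤ ν) : a / N ≤ e + x + (κ * ν + δ) / c := by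
  have hN0 : 0 < N := hc.trans_le hN
  have h1 : a / N ≤ e + x + (x * (1 - N) + δ) / N := by
    rw [div_le_iff₀ hN0, add_mul, div_mul_cancel₀ _ hN0.ne']
    linarith
  have h2 : x * (1 - N) ≤ κ * ν := (le_abs_self _).trans (by
    rw [abs_mul]
    exact mul_le_mul hx hν (abs_nonneg _) ((abs_nonneg _).trans hx))
  have h3 : 0 ≤ κ * ν := mul_nonneg ((abs_nonneg _).trans hx) ((abs_nonneg _).trans hν)
  have h4 : (x * (1 - N) + δ) / N ≤ (κ * ν + δ) / c :=
    (div_le_div_of_nonneg_right (by linarith) hN0.le).trans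
      (div_le_div_of_nonneg_left (by linarith) hc hN)
  linarith

/-- For `α ≤ 1/2` one has `log α⁻¹ ≥ log 2`, which absorbs the constant `log (1 + Λ)`. -/
lemma Radiation.exists_norm_bound (R : Radiation) : ∃ C : ℝ, 0 ≤ C ∧ ∀ {α y : ℝ} {Φ G w}, 0 < α →
    α ≤ 1 / 2 → R.IsSharpField α y Φ G w →
    ∫ p, ‖Φ p‖ ^ 2 ∂jointMeasure y ≤ C * (α ^ 3 * Real.log α⁻¹) := by
  have hl2 : 0 < Real.log 2 := Real.log_pos (by norm_num)
  have hΛ := R.Λ_pos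
  have hlΛ : 0 ≤ Real.log (1 + R.Λ) := Real.log_nonneg (by linarith)
  have hpi := Real.pi_pos
  refine ⟨576 * Real.pi * (Real.log (1 + R.Λ) / Real.log 2 + 2), by positivity,
    fun {α y Φ G w} hα hα2 h => h.norm_le.trans ?_⟩
  have hlog2 : Real.log 2 ≤ Real.log α⁻¹ := by
    apply Real.log_le_log (by norm_num)
    rw [le_inv_comm₀ (by norm_num) hα]
    linarith
  have h1 : Real.log ((α ^ 2 + R.Λ) / α ^ 2) ≤ (Real.log (1 + R.Λ) / Real.log 2 + 2) *
      Real.log α⁻¹ := by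
    rw [Real.log_div (by positivity) (by positivity), Real.log_pow, Real.log_inv]
    rw [Real.log_inv] at hlog2
    have h2 : Real.log (α ^ 2 + R.Λ) ≤ Real.log (1 + R.Λ) := by
      apply Real.log_le_log (by positivity)
      nlinarith
    have h3 : Real.log (1 + R.Λ) ≤ Real.log (1 + R.Λ) / Real.log 2 * -Real.log α := by
      rw [div_mul_eq_mul_div, le_div_iff₀ hl2]
      gcongr
    push_cast
    linarith
  have h4 : 0 ≤ 576 * Real.pi * α ^ 3 := by positivity
  have := mul_le_mul_of_nonneg_left h1 h4
  linarith

lemma Radiation.IsSharpField.abs_phiSharpNormSq_le (h : R.IsSharpField α y Φ G w) (hα : 0 < α) :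
    |R.phiSharpNormSq α y Φ| ≤ ∫ p, ‖Φ p‖ ^ 2 ∂jointMeasure y + 72 * α ^ 3 * ∫ k, R.envelope k := by
  have hS := (R.memLp_sharpSource hα y).2
  have h1 := braket_young h.lap.1 h.memLp_source one_pos
  have h2 := braket_young h.lap.1 (h.memLp_source.const_mul (-1)) one_pos
  rw [braket_const_mul] at h2
  simp only [norm_neg, one_mul, neg_mul, Complex.neg_re, inv_one] at h1 h2
  have hA : 0 ≤ ∫ p, ‖Φ p‖ ^ 2 ∂jointMeasure y := by positivity
  have hB : 0 ≤ ∫ p, ‖R.sharpSource α y p‖ ^ 2 ∂jointMeasure y := by positivity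
  unfold Radiation.phiSharpNormSq
  rw [abs_le]
  constructor <;> linarith

lemma Radiation.exists_energy_bound (R : Radiation) (hθ : IsLocalizer θ) :
    ∃ C : ℝ, 0 ≤ C ∧ ∀ α, 0 < α → α ≤ 1 / 2 → ∀ L : ℝ, 1 < L → ∀ Φ G w,
    R.IsSharpField α (L / α) Φ G w →
    0 < stateNormSq (L / α) (localGround θ α (L / α), Φ) ∧
    (stateInner (L / α) (localGround θ α (L / α), Φ)
        (R.hamiltonianValue θ α (L / α) Φ G)).re /
      stateNormSq (L / α) (localGround θ α (L / α), Φ) ≤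
    groundEnergy α - α ^ 2 / L ^ 3 + α * R.formFactorNormSq (L / α) -
      R.phiSharpNormSq α (L / α) Φ + C * (α ^ 2 / L ^ 5 + α ^ 4 * Real.log α⁻¹) := by
  obtain ⟨C₁, hC₁, h₁⟩ := hθ.exists_error_bound
  obtain ⟨C₂, hC₂, h₂⟩ := R.exists_localSource_bound hθ
  obtain ⟨C₃, hC₃, h₃⟩ := R.exists_norm_bound
  set E := ∫ k, R.envelope k with hE
  have hE0 : 0 ≤ E := integral_nonneg R.envelope_nonneg
  set c : ℝ := Real.exp (-1 / 4) / 384 with hc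
  have hc0 : 0 < c := by positivity
  set K := C₃ + 72 * E + 1 with hK
  have hK0 : 0 ≤ K := by positivity
  refine ⟨(K * (2580480 + C₃) + (C₁ + 683 + C₂) + (2 + 48 * E) * C₃) / c, by positivity,
    fun α hα hα2 L hL Φ G w h => ?_⟩
  set y := L / α with hy'
  have hαy : α * y = L := by rw [hy']; field_simp
  have hy : 0 < y := by positivity
  have hiy : α⁻¹ ≤ y := by
    rw [hy', inv_eq_one_div]
    gcongr
  have hyi : y⁻¹ ≤ 1 := by
    have : y⁻¹ ≤ α := by rw [← inv_inv α]; exact inv_anti₀ (inv_pos.2 hα) hiy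
    linarith
  set ℓ := Real.log α⁻¹ with hℓ
  have hℓ0 : 0 ≤ ℓ := Real.log_nonneg ((one_le_inv₀ hα).2 (by linarith))
  have hαℓ : α * ℓ ≤ 1 := by
    have := Real.log_le_self (inv_pos.2 hα).le
    calc α * ℓ ≤ α * α⁻¹ := by gcongr
      _ = 1 := mul_inv_cancel₀ hα.ne'
  have k1 := h₁ α y hα hiy
  have k2 := h₂ α y hα hiy
  have k3 := h₃ hα hα2 h
  have k4 := integral_wallPotential_le hθ hα hy (h.components hθ hα hy).wallGround
  have k5 := h.energy_le hθ hα hy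
  have k6 := h.abs_phiSharpNormSq_le hα
  have k7 := localGround_norm_le hθ hα hy
  have k8 := one_sub_localGround_norm_le hθ hα hy
  have k9 := localGround_norm_ge hθ hα hiy
  have k10 := R.formFactorNormSq_le y
  have k11 := R.formFactorNormSq_nonneg y
  rw [hαy] at k1 k2 k4 k8
  set A := ∫ p, ‖Φ p‖ ^ 2 ∂jointMeasure y with hA
  have hA0 : 0 ≤ A := by positivity
  set F := ∫ x, ‖localGround θ α y x‖ ^ 2 ∂atomMeasure y with hF
  have hN : stateNormSq y (localGround θ α y, Φ) = F + A := rfl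
  rw [hN] at k5 ⊢
  refine ⟨by linarith, ?_⟩
  set q := α ^ 2 / L ^ 5 with hq
  have hq0 : 0 ≤ q := by positivity
  set r := α ^ 4 * ℓ with hr
  have hr0 : 0 ≤ r := by positivity
  have hα3 : α ^ 3 * ℓ ≤ α ^ 2 := by
    calc α ^ 3 * ℓ = α ^ 2 * (α * ℓ) := by ring
      _ ≤ α ^ 2 * 1 := by gcongr
      _ = _ := mul_one _
  have hδA : α * (y⁻¹ + 1 + 2 * R.formFactorNormSq y) * A ≤ (2 + 48 * E) * C₃ * r := by
    have hb : y⁻¹ + 1 + 2 * R.formFactorNormSq y ≤ 2 + 48 * E := by linarith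
    calc α * (y⁻¹ + 1 + 2 * R.formFactorNormSq y) * A
        ≤ α * (2 + 48 * E) * (C₃ * (α ^ 3 * ℓ)) :=
          mul_le_mul (mul_le_mul_of_nonneg_left hb hα.le) k3 hA0 (by positivity)
      _ = _ := by rw [hr]; ring
  -- Both corrections are of order `α²`, so their product with `|1 - N|` fits into the error.
  have hx : |-(α ^ 2 / L ^ 3) - R.phiSharpNormSq α y Φ| ≤ K * α ^ 2 := by
    have e1 : α ^ 2 / L ^ 3 ≤ α ^ 2 := div_le_self (sq_nonneg _) (one_le_pow₀ hL.le)
    have e2 : 0 ≤ α ^ 2 / L ^ 3 := by positivity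
    have e3 : A ≤ C₃ * α ^ 2 := k3.trans (by gcongr)
    have e4 : 72 * α ^ 3 * E ≤ 72 * E * α ^ 2 := by
      have : α ^ 3 ≤ α ^ 2 := pow_le_pow_of_le_one hα.le (by linarith) (by norm_num)
      nlinarith
    refine (abs_sub _ _).trans ?_
    rw [abs_neg, abs_of_nonneg e2, hK]
    linarith
  have hν : |1 - (F + A)| ≤ 2580480 / L ^ 5 + C₃ * (α ^ 3 * ℓ) := by
    have : 0 ≤ 2580480 / L ^ 5 := by positivity
    rw [abs_le]
    constructor <;> linarith
  -- The part `e_α + α ‖λ_y‖²` multiplies the squared norm exactly and is not affected by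
  -- normalization; it need not be small.
  have hmain := div_le_of_le_add
    (a := (stateInner y (localGround θ α y, Φ) (R.hamiltonianValue θ α y Φ G)).re) (e := groundEnergy α + α * R.formFactorNormSq y)
    (δ := (C₁ + 683 + C₂) * q + (2 + 48 * E) * C₃ * r) (by linarith) (by positivity) hc0
    (by linarith : c ≤ F + A) hx hν
  refine hmain.trans ?_
  have hfin : (K * α ^ 2 * (2580480 / L ^ 5 + C₃ * (α ^ 3 * ℓ)) +
      ((C₁ + 683 + C₂) * q + (2 + 48 * E) * C₃ * r)) / c ≤
      (K * (2580480 + C₃) + (C₁ + 683 + C₂) + (2 + 48 * E) * C₃) / c * (q + r) := by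
    rw [div_mul_eq_mul_div]
    gcongr
    have e1 : K * α ^ 2 * (2580480 / L ^ 5 + C₃ * (α ^ 3 * ℓ)) = K * 2580480 * q +
        K * C₃ * (α * r) := by rw [hq, hr]; ring
    have e2 : K * C₃ * (α * r) ≤ K * C₃ * r := by
      gcongr
      exact mul_le_of_le_one_left hr0 (by linarith)
    rw [e1]
    have t1 : 0 ≤ K * C₃ * q := by positivity
    have t2 : 0 ≤ K * 2580480 * r := by positivity
    have t3 : 0 ≤ (C₁ + 683 + C₂) * r := by positivity
    have t4 : 0 ≤ (2 + 48 * E) * C₃ * q := by positivity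
    linarith
  linarith

end Energy

end CasimirPolder

end

/-! ### The energy of the trial vector -/

theorem theorem2p4 (R : CasimirPolder.Radiation) (θ : ℝ → ℝ)
    (hθ : CasimirPolder.IsLocalizer θ) :
    ∃ α₀ : ℝ, 0 < α₀ ∧ α₀ < 1 ∧ ∃ C : ℝ, ∀ α : ℝ, 0 < α → α ≤ α₀ → ∀ L : ℝ, 1 < L →
      ∃ Φ : CasimirPolder.E3 × CasimirPolder.Mode → ℂ,
        R.IsPhiSharp α (L / α) Φ ∧
        ∃ Hφ : CasimirPolder.State,
          R.HasHamiltonianValue α (L / α) (R.trial θ α (L / α) Φ) Hφ ∧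
          0 < CasimirPolder.stateNormSq (L / α) (R.trial θ α (L / α) Φ) ∧
          (CasimirPolder.stateInner (L / α) (R.trial θ α (L / α) Φ) Hφ).re /
              CasimirPolder.stateNormSq (L / α) (R.trial θ α (L / α) Φ) ≤
            CasimirPolder.groundEnergy α - α ^ 2 / L ^ 3 + α * R.formFactorNormSq (L / α)
              - R.phiSharpNormSq α (L / α) Φ + 4 * α ^ 3 * R.phiStarNormSq
              + C * (α ^ 2 / L ^ 5 + α ^ 4 * Real.log α⁻¹ + α ^ 2 * L * Real.exp (-(L / 2))) := by
  obtain ⟨C, hC, h⟩ := R.exists_energy_bound hθ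
  refine ⟨1 / 2, by norm_num, by norm_num, C, fun α hα hα2 L hL => ?_⟩
  have hy : 0 < L / α := by positivity
  obtain ⟨Φ, G, w, hΦ⟩ := R.exists_isSharpField hα (L / α)
  have ht := R.trial_snd θ α (L / α) Φ
  have hae : (R.trial θ α (L / α) Φ).2 =ᵐ[CasimirPolder.jointMeasure (L / α)] Φ := by
    filter_upwards [CasimirPolder.ae_joint_snd ht] with p hp using hp p.1
  obtain ⟨h1, h2⟩ := h α hα hα2 L hL Φ G w hΦ
  have eN : CasimirPolder.stateNormSq (L / α) (R.trial θ α (L / α) Φ) =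
      CasimirPolder.stateNormSq (L / α) (CasimirPolder.localGround θ α (L / α), Φ) := by
    unfold CasimirPolder.stateNormSq
    congr 1
    refine integral_congr_ae ?_
    filter_upwards [hae] with p hp
    rw [hp]
  have eI : CasimirPolder.stateInner (L / α) (R.trial θ α (L / α) Φ)
      (R.hamiltonianValue θ α (L / α) Φ G) =
      CasimirPolder.stateInner (L / α) (CasimirPolder.localGround θ α (L / α), Φ)
      (R.hamiltonianValue θ α (L / α) Φ G) := by
    unfold CasimirPolder.stateInner
    congr 1
    refine integral_congr_ae ?_
    filter_upwards [hae] with p hp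
    simp only [hp]
  refine ⟨Φ, hΦ.isPhiSharp, R.hamiltonianValue θ α (L / α) Φ G,
    (hΦ.hasHamiltonianValue hθ hα hy).congr ht, by rwa [eN], ?_⟩
  rw [eN, eI, R.phiStarNormSq_eq_zero]
  -- The exponential term is nonnegative slack: the tails have been estimated by fifth moments.
  have h3 : 0 ≤ C * (α ^ 2 * L * Real.exp (-(L / 2))) := by positivity
  linarith
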